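/- Let $N\ge 1$ be an integer, $\mathbb T=\mathbb R^3/N\mathbb Z^3$, $\Gamma=\mathbb Z^3/N\mathbb Z^3$, $\overline N=N^3$, $\overline{\mathbb T}=\mathbb T^{\overline N}$, and let $e,Z,M>0$. Let $\sigma\in C^2(\mathbb T)$ be real-valued with $\int_{\mathbb T}\sigma(x)\,dx=eZ$. Let $\mathcal V=H^1(\overline{\mathbb T})\times\overline{\mathbb T}\times\mathbb R^{3\overline N}$ be the space of states $X=(\psi,q,p)$, where $\psi\in H^1(\overline{\mathbb T})$ is complex-valued, $q=(q(n))_{n\in\Gamma}$ with $q(n)\in\mathbb T$, and $p=(p(n))_{n\in\Gamma}$ with $p(n)\in\mathbb R^3$. Define the charge and the energy $$Q(X)=\int_{\overline{\mathbb T}}|\psi|^2\,d\overline x,\qquad E(X)=\tfrac12\int_{\overline{\mathbb T}}|\nabla\psi|^2\,d\overline x+\tfrac12\int_{\mathbb T}\rho\,G\rho\,dx+\sum_{n\in\Gamma}\frac{|p(n)|^2}{2M},$$ where $$\rho(x)=\sum_{n\in\Gamma}\sigma(x-n-q(n))-e\sum_{j=1}^{\overline N}\int_{\mathbb T^{\overline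 N-1}}|\psi(\overline x)|^2\Big|_{x_j=x}\,dx_1\dots\widehat{dx_j}\dots dx_{\overline N}$$ and $G=(-\Delta)^{-1}$ is given by the Fourier series $G\rho(x)=\sum_{\xi\in\frac{2\pi}N\mathbb Z^3\setminus 0}|\xi|^{-2}\tilde\rho(\xi)e^{i\xi x}$ for $\rho(x)=\sum_{\xi}\tilde\rho(\xi)e^{i\xi x}$. Let $\mathcal M=\{X\in\mathcal V: Q(X)=Z\}$. The Schrödinger–Poisson–Newton system in Hamiltonian form is $\dot X(t)=JE'(X(t))$, $t\in\mathbb R$, with $J(\eta,v,w)=(-\tfrac i2\eta,\,w,\,-v)$. It is understood as an equation in $H^{-1}(\overline{\mathbb T})\oplus\mathbb R^{3\overline N}\oplus\mathbb R^{3\overline N}$, where $E'(X)$ is the Fréchet differential of $E$ at $X$ in the tangent directions $H^1(\overline{\mathbb T})\oplus\mathbb R^{3\overline N}\oplus\mathbb R^{3\overline N}$, $H^{-1}$ is the dual of the real Hilbert space $H^1$, and functions are identified with functionals by means of the real scalar product $(\psi,\varphi)=\mathrm{Re}\int\psi\overline\varphi\,d\overline x$. **Theorem.** Let $X_0\in\mathcal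 M$. Then: i) there exists a unique $X\in C(\mathbb R,\mathcal V)$ with $X(0)=X_0$ that solves $\dot X(t)=JE'(X(t))$ for all $t\in\mathbb R$; ii) $E(X(t))=E(X_0)$ and $Q(X(t))=Q(X_0)$ for all $t\in\mathbb R$. Moreover, if the wave function of $X_0$ is antisymmetric under permutations of the $\overline N$ variables $x_1,\dots,x_{\overline N}\in\mathbb T$, then so is the wave function of $X(t)$ for every $t\in\mathbb R$. -/

import Mathlib

open MeasureTheory

noncomputable section

namespace SPN

/-- The period `N` of the torus is positive. -/
instance factPos (N : ℕ) [NeZero N] : Fact ((0 : ℝ) < (N : ℝ)) :=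
  ⟨Nat.cast_pos.mpr (Nat.pos_of_ne_zero (NeZero.ne N))⟩

/-! ### Tori, lattice, configuration space -/

/-- The torus `𝕋 = ℝ³ / Nℤ³`, of volume `N³`. -/
abbrev Torus (N : ℕ) : Type := Fin 3 → AddCircle (N : ℝ)

/-- The configuration space `𝕋^{N³}` of the electrons. -/
abbrev Conf (N : ℕ) : Type := Fin (N ^ 3) → Torus N

/-- The lattice `Γ = ℤ³ / Nℤ³` of reference positions of the ions. -/
abbrev Lattice (N : ℕ) : Type := Fin 3 → ZMod N

/-- The lattice point `n ∈ Γ` as a point of the torus. -/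
def latticePt {N : ℕ} (n : Lattice N) : Torus N := fun i => (((n i).val : ℝ) : AddCircle (N : ℝ))

/-- The projection `ℝ³ → 𝕋`. -/
def toTorus (N : ℕ) (y : Fin 3 → ℝ) : Torus N := fun i => ((y i : ℝ) : AddCircle (N : ℝ))

/-- `σ ∈ C²(𝕋)`: the periodic function `ℝ³ → ℝ` given by `σ` is of class `C²`. -/
def IsC2 {N : ℕ} (σ : Torus N → ℝ) : Prop := ContDiff ℝ 2 fun y : Fin 3 → ℝ => σ (toTorus N y)

/-- Vectors of `ℝ^{3N³}`, one vector of `ℝ³` for each ion. The norm of this type (a maximum) is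
only used up to equivalence: for continuity and differentiability. -/
abbrev IonVec (N : ℕ) : Type := Lattice N → Fin 3 → ℝ

/-- Ion displacements: points of `𝕋^{N³}`, one point of `𝕋` for each ion. -/
abbrev IonPos (N : ℕ) : Type := Lattice N → Torus N

/-- The projection `ℝ^{3N³} → 𝕋^{N³}`. -/
def toIonPos {N : ℕ} (κ : IonVec N) : IonPos N := fun n => toTorus N (κ n)

/-! ### The Sobolev spaces `H⁰`, `H¹`, `H⁻¹` of the configuration space -/

/-- The index of the real coordinates of the configuration space. -/
abbrev Coord (N : ℕ) : Type := Fin (N ^ 3) × Fin 3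

/-- The point of the configuration space with `k`-th coordinate `s mod N` and all others zero. -/
def coordShift {N : ℕ} (k : Coord N) (s : ℝ) : Conf N :=
  Pi.single k.1 (Pi.single k.2 ((s : ℝ) : AddCircle (N : ℝ)))

/-- A function on the configuration space is smooth if its periodic lift is. -/
def IsSmooth {N : ℕ} (φ : Conf N → ℂ) : Prop :=
  ContDiff ℝ ((⊤ : ℕ∞) : WithTop ℕ∞)
    fun y : Fin (N ^ 3) → Fin 3 → ℝ => φ (fun j => toTorus N (y j))

/-- `φ'` is the classical partial derivative of `φ` along the `k`-th coordinate. -/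
def IsPartial {N : ℕ} (k : Coord N) (φ φ' : Conf N → ℂ) : Prop :=
  ∀ x : Conf N, HasDerivAt (fun s : ℝ => φ (x + coordShift k s)) (φ' x) 0

/-- `H⁰ = L²` of the configuration space, with complex values. -/
abbrev L2 (N : ℕ) [NeZero N] : Type := Lp ℂ 2 (volume : Measure (Conf N))

/-- `g = ∂ₖψ` in the weak sense. (The two functions `φ`, `φ' = ∂ₖφ` are automatically continuous
when `φ` is smooth.) -/
def IsWeakPartial {N : ℕ} [NeZero N] (k : Coord N) (ψ g : L2 N) : Prop :=
  ∀ φ φ' : C(Conf N, ℂ), IsSmooth φ → IsPartial k φ φ' →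
    ∫ x, ψ x * φ' x = - ∫ x, g x * φ x

lemma integrable_mul {N : ℕ} [NeZero N] (ψ : L2 N) (φ : C(Conf N, ℂ)) :
    Integrable (fun x => ψ x * φ x) (volume : Measure (Conf N)) := by
  have h1 : Integrable (fun x => ψ x) (volume : Measure (Conf N)) :=
    (Lp.memLp ψ).integrable (by norm_num)
  exact h1.mul_bdd (c := ‖φ‖) φ.continuous.aestronglyMeasurable
    (Filter.Eventually.of_forall fun x => φ.norm_coe_le_norm x)

lemma integral_add_mul {N : ℕ} [NeZero N] (ψ₁ ψ₂ : L2 N) (φ : C(Conf N, ℂ)) :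
    ∫ x, (ψ₁ + ψ₂) x * φ x = (∫ x, ψ₁ x * φ x) + ∫ x, ψ₂ x * φ x := by
  rw [← integral_add (integrable_mul ψ₁ φ) (integrable_mul ψ₂ φ)]
  refine integral_congr_ae ?_
  filter_upwards [Lp.coeFn_add ψ₁ ψ₂] with x hx
  rw [hx, Pi.add_apply, add_mul]

lemma integral_smul_mul {N : ℕ} [NeZero N] (c : ℂ) (ψ : L2 N) (φ : C(Conf N, ℂ)) :
    ∫ x, (c • ψ) x * φ x = c * ∫ x, ψ x * φ x := by
  rw [← integral_const_mul]
  refine integral_congr_ae ?_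
  filter_upwards [Lp.coeFn_smul c ψ] with x hx
  rw [hx, Pi.smul_apply, smul_eq_mul, mul_assoc]

/-- The Sobolev space `H¹` of the configuration space: the families consisting of an `L²` function
(index `none`) and its weak first partial derivatives (index `some k`), all in `L²`. The norm
inherited from the Hilbert sum is `‖ψ‖² = ‖ψ‖²_{L²} + ‖∇ψ‖²_{L²}`. -/
def H1 (N : ℕ) [NeZero N] : Submodule ℂ (PiLp 2 fun _ : Option (Coord N) => L2 N) where
  carrier := {u | ∀ k : Coord N, IsWeakPartial k (u none) (u (some k))}
  add_mem' := by
    intro u v hu hv k φ φ' h h'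
    have e1 := hu k φ φ' h h'
    have e2 := hv k φ φ' h h'
    rw [PiLp.add_apply, PiLp.add_apply, integral_add_mul, integral_add_mul, e1, e2]
    ring
  zero_mem' := by
    intro k φ φ' _ _
    have h0 : ∀ χ : C(Conf N, ℂ), ∫ x, (0 : L2 N) x * χ x = 0 := by
      intro χ
      have := integral_smul_mul (0 : ℂ) (0 : L2 N) χ
      simpa only [zero_smul, zero_mul] using this
    rw [PiLp.zero_apply, PiLp.zero_apply, h0, h0, neg_zero]
  smul_mem' := by
    intro c u hu k φ φ' h h'
    have e1 := hu k φ φ' h h'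
    rw [PiLp.smul_apply, PiLp.smul_apply, integral_smul_mul, integral_smul_mul, e1]
    ring

variable {N : ℕ} [NeZero N]

/-- The inclusion `H¹ → L²`. -/
def toL2 : H1 N →L[ℂ] L2 N :=
  (PiLp.proj 2 (fun _ : Option (Coord N) => L2 N) none : _ →L[ℂ] L2 N) ∘L (H1 N).subtypeL

/-- The weak partial derivative `∂ₖψ ∈ L²` of `ψ ∈ H¹`. -/
def wpartial (k : Coord N) : H1 N →L[ℂ] L2 N :=
  (PiLp.proj 2 (fun _ : Option (Coord N) => L2 N) (some k) : _ →L[ℂ] L2 N) ∘L (H1 N).subtypeL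

/-- `H⁻¹`: the dual of the real Hilbert space `H¹`. -/
abbrev Hm1 (N : ℕ) [NeZero N] : Type := H1 N →L[ℝ] ℝ

/-- Identification of `ψ ∈ H¹` with the element `φ ↦ (ψ, φ) = Re ∫ ψ φ̄` of `H⁻¹`. -/
def toHm1 (ψ : H1 N) : Hm1 N :=
  Complex.reCLM ∘L (((innerSL ℂ (toL2 ψ)) ∘L toL2).restrictScalars ℝ)

/-- Multiplication by `c ∈ ℂ` on `H⁻¹`, extending the one on `L²`: `(c η)(φ) = η(c̄ φ)`. -/
def cmul (c : ℂ) (η : Hm1 N) : Hm1 N :=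
  η ∘L ((star c • ContinuousLinearMap.id ℂ (H1 N)).restrictScalars ℝ)

/-! ### Phase space -/

/-- The phase space `𝒱 = H¹ × 𝕋^{N³} × ℝ^{3N³}` of the states `X = (ψ, q, p)`. -/
abbrev Phase (N : ℕ) [NeZero N] : Type := H1 N × IonPos N × IonVec N

/-- The tangent space `𝒲 = H¹ ⊕ ℝ^{3N³} ⊕ ℝ^{3N³}`. -/
abbrev Tangent (N : ℕ) [NeZero N] : Type := H1 N × IonVec N × IonVec N

/-- Its dual `𝒲⁻¹ = H⁻¹ ⊕ ℝ^{3N³} ⊕ ℝ^{3N³}`. -/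
abbrev Cotangent (N : ℕ) [NeZero N] : Type := Hm1 N × IonVec N × IonVec N

/-- Translation of a state by a tangent vector. -/
def translate (X : Phase N) (Y : Tangent N) : Phase N :=
  (X.1 + Y.1, X.2.1 + toIonPos Y.2.1, X.2.2 + Y.2.2)

/-- The Euclidean scalar product with a fixed vector of `ℝ^{3N³}`. -/
def dotCLM (v : IonVec N) : IonVec N →L[ℝ] ℝ :=
  ∑ n : Lattice N, ∑ i : Fin 3, v n i •
    ((ContinuousLinearMap.proj i : (Fin 3 → ℝ) →L[ℝ] ℝ) ∘L
      (ContinuousLinearMap.proj n : IonVec N →L[ℝ] (Fin 3 → ℝ)))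

/-- The duality `⟨D, Y⟩ = η(φ) + v·κ + w·π` for `D = (η, v, w) ∈ 𝒲⁻¹`, `Y = (φ, κ, π) ∈ 𝒲`. -/
def pairing (D : Cotangent N) : Tangent N →L[ℝ] ℝ :=
  D.1 ∘L ContinuousLinearMap.fst ℝ (H1 N) (IonVec N × IonVec N) +
    ((dotCLM D.2.1) ∘L ContinuousLinearMap.fst ℝ (IonVec N) (IonVec N) +
      (dotCLM D.2.2) ∘L ContinuousLinearMap.snd ℝ (IonVec N) (IonVec N)) ∘L
        ContinuousLinearMap.snd ℝ (H1 N) (IonVec N × IonVec N)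

/-- The symplectic operator `J (η, v, w) = (-(i/2) η, w, -v)`. -/
def symplJ (D : Cotangent N) : Cotangent N := (cmul (-Complex.I / 2) D.1, D.2.2, -D.2.1)

/-! ### Charge densities, Poisson equation, energy and charge -/

/-- The charge density `∑ₙ σ(x - n - q(n))` of the ions. -/
def ionDensity (σ : Torus N → ℝ) (q : IonPos N) (x : Torus N) : ℝ :=
  ∑ n : Lattice N, σ (x - latticePt n - q n)

/-- The charge density of the electrons,
`-e ∑ⱼ ∫ |ψ(x₁, …, x_{j-1}, x, x_{j+1}, …)|² dx₁ … dx_{j-1} dx_{j+1} …`. -/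
def elDensity (e : ℝ) (ψ : L2 N) (x : Torus N) : ℝ :=
  -e * ∑ j : Fin (N ^ 3), ∫ y : ({i : Fin (N ^ 3) // i ≠ j} → Torus N),
    ‖ψ (fun i => if h : i = j then x else y ⟨i, h⟩)‖ ^ 2

/-- The total charge density. -/
def density (e : ℝ) (σ : Torus N → ℝ) (ψ : L2 N) (q : IonPos N) (x : Torus N) : ℝ :=
  ionDensity σ q x + elDensity e ψ x

/-- The exponential `e^{i ξ·x}` on the torus, for the wave vector `ξ = (2π/N) m`, `m ∈ ℤ³`. -/
def mode (m : Fin 3 → ℤ) (x : Torus N) : ℂ := ∏ i, fourier (m i) (x i)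

/-- The square `|ξ|²` of the wave vector `ξ = (2π/N) m`. -/
def waveSq (N : ℕ) (m : Fin 3 → ℤ) : ℝ := ∑ i, (2 * Real.pi * (m i : ℝ) / (N : ℝ)) ^ 2

/-- The Fourier coefficient `|𝕋|⁻¹ ∫ ρ(x) e^{-i ξ·x} dx`. -/
def fourierCoef (ρ : Torus N → ℝ) (m : Fin 3 → ℤ) : ℂ :=
  ((N : ℂ) ^ 3)⁻¹ * ∫ x : Torus N, (ρ x : ℂ) * star (mode m x)

/-- The operator `G = (-Δ)⁻¹` on the torus, as a Fourier series without the zero mode. -/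
def greenOp (ρ : Torus N → ℝ) (x : Torus N) : ℂ :=
  ∑' m : Fin 3 → ℤ,
    if m = 0 then 0 else fourierCoef ρ m / (waveSq N m : ℂ) * mode m x

/-- The energy
`E(ψ, q, p) = ½ ∫ |∇ψ|² + ½ (ρ, Gρ) + ∑ₙ p(n)² / (2M)`. -/
def energy (e M : ℝ) (σ : Torus N → ℝ) (X : Phase N) : ℝ :=
  1 / 2 * ∑ k : Coord N, ‖wpartial k X.1‖ ^ 2 +
  1 / 2 * (∫ x : Torus N,
    (density e σ (toL2 X.1) X.2.1 x : ℂ) * greenOp (density e σ (toL2 X.1) X.2.1) x).re +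
  ∑ n : Lattice N, (∑ i, X.2.2 n i ^ 2) / (2 * M)

/-- The charge `Q(ψ, q, p) = ‖ψ‖²_{L²}`. -/
def charge (X : Phase N) : ℝ := ‖toL2 X.1‖ ^ 2

/-! ### The Hamilton system -/

/-- `D = E'(X) ∈ 𝒲⁻¹`: the energy is Fréchet differentiable at `X` with differential `⟨D, ·⟩`. -/
def IsEnergyGradient (e M : ℝ) (σ : Torus N → ℝ) (X : Phase N) (D : Cotangent N) : Prop :=
  HasFDerivAt (fun Y : Tangent N => energy e M σ (translate X Y)) (pairing D) 0

/-- The curve `q` in the torus `𝕋^{N³}` has velocity `v` at the time `t`. -/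
def HasTorusVelocity (q : ℝ → IonPos N) (v : IonVec N) (t : ℝ) : Prop :=
  ∃ r : ℝ → IonVec N, (∀ s, toIonPos (r s) = q s) ∧ HasDerivAt r v t

/-- The curve `X` in `𝒱` has the velocity `Ẋ(t) = D`, as a curve in `H⁻¹ × 𝕋^{N³} × ℝ^{3N³}`. -/
def HasVelocity (X : ℝ → Phase N) (D : Cotangent N) (t : ℝ) : Prop :=
  HasDerivAt (fun s => toHm1 (X s).1) D.1 t ∧
  HasTorusVelocity (fun s => (X s).2.1) D.2.1 t ∧
  HasDerivAt (fun s => (X s).2.2) D.2.2 t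

/-- `X` solves the Hamilton system `Ẋ(t) = J E'(X(t))` for all `t ∈ ℝ`, as an equation in `𝒲⁻¹`. -/
def IsSolution (e M : ℝ) (σ : Torus N → ℝ) (X : ℝ → Phase N) : Prop :=
  ∀ t : ℝ, ∃ D : Cotangent N, IsEnergyGradient e M σ (X t) D ∧ HasVelocity X (symplJ D) t

/-- Antisymmetry of a wave function under permutations of the electrons. -/
def IsAntisymmetric (ψ : L2 N) : Prop :=
  ∀ π : Equiv.Perm (Fin (N ^ 3)),
    ∀ᵐ x : Conf N, ψ (fun j => x (π j)) = ((Equiv.Perm.sign π : ℤ) : ℂ) * ψ x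

end SPN

end

open MeasureTheory

noncomputable section

namespace SPN

set_option linter.unusedSectionVars false

variable {N : ℕ} [NeZero N]

/-! Everything is done in Fourier variables. The same exponentials, suitably normalised, form
orthonormal bases `fb` of L² and `hb` of H¹; a weak derivative multiplies the coefficient of a mode
by iξ (`isWeakPartial_iff`); and the Coulomb energy is half the volume times Σ |ξ|⁻² |ρ̂|²
(`integral_density_greenOp`), hence nonnegative. Write ⟨m⟩ for `br m`.

The analytic core is that the potential V acts well on H¹. The electronic part of ρ̂(m) is a sum of
products (e^{iξx_j}ψ, ψ), and Schur's test for the kernel 1/⟨ζ − η⟩ gives Σ ⟨m⟩⁻¹ |ρ̂(m)| < ∞ with a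
bound quadratic in the H¹ norm (`sum_bil_le`); for the ions, σ ∈ C² gives Σ |σ̂| < ∞
(`summable_sigma`). Multiplication by a mode costs a factor ⟨m⟩ on H¹ and (−Δ)⁻¹ gains ⟨m⟩⁻², so the
series of Vψ converges absolutely in H¹. Thus Vψ and the forces are bounded and Lipschitz for
bounded wave functions (`exists_force_bounds`), and the energy has an explicit gradient
(`isEnergyGradient_iff`).

Conjugation with the free group e^{itΔ/2} removes the unbounded Laplacian (`hasDerivAt_interaction`,
`hasDerivAt_schroedinger`), and the ion positions are lifted from the torus to Euclidean space. The
system becomes an ordinary differential equation in the Banach space `Tangent N` with the locally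
Lipschitz vector field `field`; this gives uniqueness (`IsCurve.eq`). For global existence, wave
function and momenta are cut off in the field, which makes the equation solvable for all times.
Charge and energy are conserved as long as the cutoff is inactive (`hasDerivAt_invariants`). As the
Coulomb energy is nonnegative, they bound the H¹ norm and the momenta (`energy_bounds`), and a
continuity argument shows that the cutoff never acts (`exists_isCurve_of_initial`).

Energy conservation is delicate because the velocity of ψ is only given in H⁻¹. The Coulomb gradient
takes values in H¹, and this allows the chain rule `hasDerivAt_comp_weak`. Antisymmetric functions
are the common fixed points of the signed permutation operators `permT`; the field is equivariant
under them, so antisymmetry persists by uniqueness (`IsCurve.isAntisymmetric`). -/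

/-! ### A Schur bound for lattice sums -/

/-- The largest absolute value of the coordinates of a lattice point. -/
def supAbs (m : Fin 3 → ℤ) : ℕ := Finset.univ.sup fun i => (m i).natAbs

/-- The weight `1 + |m|` of a lattice point. -/
def br (m : Fin 3 → ℤ) : ℝ := (supAbs m : ℝ) + 1

lemma natAbs_le_supAbs (m : Fin 3 → ℤ) (i : Fin 3) : (m i).natAbs ≤ supAbs m :=
  Finset.le_sup (f := fun i => (m i).natAbs) (Finset.mem_univ i)

lemma supAbs_le_iff {m : Fin 3 → ℤ} {k : ℕ} : supAbs m ≤ k ↔ ∀ i, (m i).natAbs ≤ k := by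
  simp [supAbs]

lemma supAbs_add_le (m n : Fin 3 → ℤ) : supAbs (m + n) ≤ supAbs m + supAbs n :=
  supAbs_le_iff.2 fun i => (Int.natAbs_add_le _ _).trans
    (add_le_add (natAbs_le_supAbs m i) (natAbs_le_supAbs n i))

@[simp] lemma supAbs_neg (m : Fin 3 → ℤ) : supAbs (-m) = supAbs m := by
  simp [supAbs]

lemma one_le_br (m : Fin 3 → ℤ) : 1 ≤ br m := by
  unfold br; have : (0 : ℝ) ≤ supAbs m := Nat.cast_nonneg _
  linarith

lemma br_pos (m : Fin 3 → ℤ) : 0 < br m := lt_of_lt_of_le one_pos (one_le_br m)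

@[simp] lemma br_neg (m : Fin 3 → ℤ) : br (-m) = br m := by simp [br]

/-- A shell is the difference of two cubes: at radius k + 1 it has (2k+3)³ − (2k+1)³ = 24(k+1)² + 2
points. -/
lemma card_shell_le (s : Finset (Fin 3 → ℤ)) (k : ℕ) :
    ((s.filter fun m => supAbs m = k).card : ℝ) ≤ 24 * ((k : ℝ) + 1) ^ 2 := by
  classical
  let B : ℕ → Finset (Fin 3 → ℤ) := fun k => Fintype.piFinset fun _ => Finset.Icc (-(k : ℤ)) k
  have hB : ∀ k m, m ∈ B k ↔ supAbs m ≤ k := by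
    intro k m
    simp only [B, Fintype.mem_piFinset, Finset.mem_Icc, supAbs_le_iff]
    exact forall_congr' fun i => by omega
  have hc : ∀ k, (B k).card = (2 * k + 1) ^ 3 := by
    intro k
    simp only [B, Fintype.card_piFinset, Int.card_Icc, Finset.prod_const, Finset.card_univ,
      Fintype.card_fin]
    congr 1; omega
  rcases k with _ | k
  · have : (s.filter fun m => supAbs m = 0) ⊆ B 0 := fun m hm => by
      rw [hB]; exact (Finset.mem_filter.1 hm).2.le
    have h := Finset.card_le_card this
    rw [hc] at h
    have h' : ((s.filter fun m => supAbs m = 0).card : ℝ) ≤ 1 := by exact_mod_cast h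
    norm_num; linarith
  · have hsub : (s.filter fun m => supAbs m = k + 1) ⊆ B (k + 1) \ B k := fun m hm => by
      have := (Finset.mem_filter.1 hm).2
      rw [Finset.mem_sdiff, hB, hB]; omega
    have h := Finset.card_le_card hsub
    rw [Finset.card_sdiff_of_subset (fun m hm => (hB _ _).2 (((hB _ _).1 hm).trans (by omega))),
      hc, hc] at h
    have h2 : (s.filter fun m => supAbs m = k + 1).card + (2 * k + 1) ^ 3
        ≤ (2 * (k + 1) + 1) ^ 3 := by
      have : (2 * k + 1) ^ 3 ≤ (2 * (k + 1) + 1) ^ 3 := Nat.pow_le_pow_left (by omega) 3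
      omega
    have h3 : ((s.filter fun m => supAbs m = k + 1).card : ℝ) + (2 * k + 1) ^ 3
        ≤ (2 * (k + 1) + 1) ^ 3 := by exact_mod_cast h2
    push_cast
    nlinarith [(Nat.cast_nonneg k : (0 : ℝ) ≤ k)]

/-- Summation of a radial function over shells. -/
lemma sum_radial_le (s : Finset (Fin 3 → ℤ)) (g : ℕ → ℝ) (hg : ∀ k, 0 ≤ g k) (t : Finset ℕ)
    (hst : ∀ m ∈ s, supAbs m ∈ t) :
    ∑ m ∈ s, g (supAbs m) ≤ ∑ k ∈ t, 24 * ((k : ℝ) + 1) ^ 2 * g k := by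
  rw [← Finset.sum_fiberwise_of_maps_to hst]
  refine Finset.sum_le_sum fun k _ => ?_
  rw [Finset.sum_congr rfl (g := fun _ => g k) (fun m hm => by rw [(Finset.mem_filter.1 hm).2]),
    Finset.sum_const, nsmul_eq_mul]
  exact mul_le_mul_of_nonneg_right (card_shell_le s k) (hg k)

/-- Telescopes, because 1/√(k+1) ≤ 2(√(k+1) − √k). -/
lemma sum_inv_sqrt_le (n : ℕ) :
    ∑ k ∈ Finset.range n, 1 / √((k : ℝ) + 1) ≤ 2 * √(n : ℝ) := by
  induction n with
  | zero => simp
  | succ n ih =>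
    rw [Finset.sum_range_succ]
    have h1 : 0 < √((n : ℝ) + 1) := Real.sqrt_pos.2 (by positivity)
    have h2 : √(n : ℝ) ^ 2 = n := Real.sq_sqrt (by positivity)
    have h3 : √((n : ℝ) + 1) ^ 2 = n + 1 := Real.sq_sqrt (by positivity)
    have h4 : 1 / √((n : ℝ) + 1) ≤ 2 * √((n : ℝ) + 1) - 2 * √(n : ℝ) := by
      rw [div_le_iff₀ h1]
      nlinarith [sq_nonneg (√((n : ℝ) + 1) - √(n : ℝ))]
    push_cast
    linarith

/-- The asymptotic constant is 2; the case k = 0 needs more than 3, and 4 serves all k. -/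
lemma tail_telescope (k : ℕ) :
    1 / (((k : ℝ) + 1) * √((k : ℝ) + 1)) ≤ 4 * (1 / √((k : ℝ) + 1) - 1 / √((k : ℝ) + 1 + 1)) := by
  set a := √((k : ℝ) + 1) with ha
  set b := √((k : ℝ) + 1 + 1) with hb
  have hk : (0 : ℝ) ≤ k := Nat.cast_nonneg k
  have ha0 : 0 < a := Real.sqrt_pos.2 (by positivity)
  have hb0 : 0 < b := Real.sqrt_pos.2 (by positivity)
  have ha2 : a ^ 2 = k + 1 := Real.sq_sqrt (by positivity)
  have hb2 : b ^ 2 = k + 1 + 1 := Real.sq_sqrt (by positivity)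
  have hab : a ≤ b := Real.sqrt_le_sqrt (by linarith)
  rw [← ha2, div_sub_div _ _ ha0.ne' hb0.ne', mul_div_assoc', div_le_div_iff₀ (by positivity)
    (by positivity)]
  have h1 : (b - a) * (b + a) = 1 := by nlinarith
  have h2 : b ≤ 3 / 2 * a := by
    by_contra h
    push Not at h
    nlinarith
  have h3 : b * (b + a) ≤ 15 / 4 * a ^ 2 := by nlinarith
  have h5 : (b - a) = 1 / (b + a) := by field_simp; linarith
  have h6 : b ≤ 4 * a ^ 2 * (b - a) := by
    rw [h5, mul_one_div, le_div_iff₀ (by positivity)]; nlinarith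
  nlinarith [mul_le_mul_of_nonneg_left h6 ha0.le]

lemma sum_tail_le (R : ℕ) (t : Finset ℕ) (ht : ∀ k ∈ t, R ≤ k) :
    ∑ k ∈ t, 1 / (((k : ℝ) + 1) * √((k : ℝ) + 1)) ≤ 4 * (1 / √((R : ℝ) + 1)) := by
  have hsub : t ⊆ Finset.Ico R (R + (t.sup id + 1)) := fun k hk => by
    have : k ≤ t.sup id := Finset.le_sup (f := id) hk
    have := ht k hk
    rw [Finset.mem_Ico]; omega
  refine (Finset.sum_le_sum_of_subset_of_nonneg hsub fun _ _ _ => by positivity).trans ?_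
  have key : ∀ n : ℕ, ∑ k ∈ Finset.Ico R (R + n), 1 / (((k : ℝ) + 1) * √((k : ℝ) + 1))
      ≤ 4 * (1 / √((R : ℝ) + 1) - 1 / √(((R + n : ℕ) : ℝ) + 1)) := by
    intro n
    induction n with
    | zero => simp
    | succ n ih =>
      rw [← add_assoc, Finset.sum_Ico_succ_top (by omega)]
      have := tail_telescope (R + n)
      push_cast at this ih ⊢
      linarith
  refine (key _).trans ?_
  have : 0 ≤ 1 / √(((R + (t.sup id + 1) : ℕ) : ℝ) + 1) := by positivity
  linarith

/-- The Schur bound `∑_η ⟨η⟩^{-5/2} ⟨ζ - η⟩^{-1} ≤ C ⟨ζ⟩^{-1/2}` on `ℤ³`. -/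
lemma schur_sum_le (s : Finset (Fin 3 → ℤ)) (ζ : Fin 3 → ℤ) :
    ∑ η ∈ s, 1 / (br η ^ 2 * √(br η) * br (ζ - η)) ≤ 1000 / √(br ζ) := by
  classical
  set Z := br ζ with hZ
  have hZ0 : 0 < Z := br_pos ζ
  have hsZ : 0 < √Z := Real.sqrt_pos.2 hZ0
  have hZs : √Z * √Z = Z := Real.mul_self_sqrt hZ0.le
  -- Three regions: η small against ζ, η large with ζ − η of size at most ζ, and both large. The
  -- final constant rounds up 96 + 192 + 400.
  set s1 := s.filter fun η => 2 * br η ≤ Z with hs1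
  set s2 := s.filter fun η => ¬ 2 * br η ≤ Z with hs2
  set s21 := s2.filter fun η => br (ζ - η) ≤ Z with hs21
  set s22 := s2.filter fun η => ¬ br (ζ - η) ≤ Z with hs22
  rw [← Finset.sum_filter_add_sum_filter_not s (fun η => 2 * br η ≤ Z), ← hs1, ← hs2,
    ← Finset.sum_filter_add_sum_filter_not s2 (fun η => br (ζ - η) ≤ Z), ← hs21, ← hs22]
  -- Here ⟨ζ⟩ ≤ 2⟨ζ − η⟩, so a factor 1/⟨ζ⟩ comes out, and the shells leave Σ (k+1)^{-1/2}, of order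
  -- √⟨ζ⟩.
  have b1 : ∑ η ∈ s1, 1 / (br η ^ 2 * √(br η) * br (ζ - η)) ≤ 96 / √Z := by
    have e1 : ∀ η ∈ s1, 1 / (br η ^ 2 * √(br η) * br (ζ - η))
        ≤ 2 / Z * (1 / (((supAbs η : ℝ) + 1) ^ 2 * √((supAbs η : ℝ) + 1))) := by
      intro η hη
      have h1 : 2 * br η ≤ Z := (Finset.mem_filter.1 hη).2
      have h2 : supAbs ζ ≤ supAbs (ζ - η) + supAbs η := by
        simpa using supAbs_add_le (ζ - η) η
      have h2' : (supAbs ζ : ℝ) ≤ supAbs (ζ - η) + supAbs η := by exact_mod_cast h2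
      have h3 : Z ≤ 2 * br (ζ - η) := by unfold br at *; linarith
      change _ ≤ 2 / Z * (1 / (br η ^ 2 * √(br η)))
      have hη0 := br_pos η
      have := br_pos (ζ - η)
      rw [div_mul_div_comm, div_le_div_iff₀ (by positivity) (by positivity)]
      have hp : 0 < br η ^ 2 * √(br η) := by positivity
      nlinarith [mul_le_mul_of_nonneg_left h3 hp.le]
    refine (Finset.sum_le_sum e1).trans ?_
    rw [← Finset.mul_sum]
    have e2 := sum_radial_le s1 (fun k => 1 / (((k : ℝ) + 1) ^ 2 * √((k : ℝ) + 1)))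
      (fun k => by positivity) (Finset.range (supAbs ζ + 1)) (fun η hη => by
        have h1 : 2 * br η ≤ Z := (Finset.mem_filter.1 hη).2
        rw [Finset.mem_range]
        have h4 : (supAbs η : ℝ) < supAbs ζ + 1 := by unfold br at *; linarith [br_pos η, one_le_br η, (Nat.cast_nonneg (supAbs η) : (0:ℝ) ≤ _)]
        exact_mod_cast h4)
    have e3 : ∑ k ∈ Finset.range (supAbs ζ + 1), 24 * ((k : ℝ) + 1) ^ 2 *
        (1 / (((k : ℝ) + 1) ^ 2 * √((k : ℝ) + 1))) ≤ 24 * (2 * √Z) := by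
      have := sum_inv_sqrt_le (supAbs ζ + 1)
      push_cast at this
      refine le_trans (le_of_eq ?_) (mul_le_mul_of_nonneg_left this (by norm_num : (0:ℝ) ≤ 24))
      rw [Finset.mul_sum]
      refine Finset.sum_congr rfl fun k _ => ?_
      have : (0:ℝ) < √((k : ℝ) + 1) := Real.sqrt_pos.2 (by positivity)
      field_simp
    refine (mul_le_mul_of_nonneg_left (e2.trans e3) (by positivity)).trans (le_of_eq ?_)
    rw [div_mul_eq_mul_div, div_eq_div_iff hZ0.ne' hsZ.ne']
    linear_combination 96 * hZs
  -- Here ⟨η⟩ > ⟨ζ⟩/2, so ⟨η⟩^{-5/2} ≤ 8⟨ζ⟩^{-5/2}; the sum of 1/⟨ξ⟩ over ξ = ζ − η in the cube ⟨ξ⟩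
  -- ≤ ⟨ζ⟩ is of order ⟨ζ⟩².
  have b2 : ∑ η ∈ s21, 1 / (br η ^ 2 * √(br η) * br (ζ - η)) ≤ 192 / √Z := by
    have e1 : ∀ η ∈ s21, 1 / (br η ^ 2 * √(br η) * br (ζ - η))
        ≤ 8 / (Z ^ 2 * √Z) * (1 / ((supAbs (ζ - η) : ℝ) + 1)) := by
      intro η hη
      have h1 : ¬ 2 * br η ≤ Z := (Finset.mem_filter.1 (Finset.mem_filter.1 hη).1).2
      push Not at h1
      change _ ≤ _ * (1 / br (ζ - η))
      have hη0 := br_pos η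
      have := br_pos (ζ - η)
      have h2 : √Z ≤ 2 * √(br η) := by
        have : √Z ≤ √(4 * br η) := Real.sqrt_le_sqrt (by linarith)
        rwa [Real.sqrt_mul (by norm_num), show (4:ℝ) = 2 ^ 2 by norm_num,
          Real.sqrt_sq (by norm_num)] at this
      have h3 : Z ^ 2 ≤ 4 * br η ^ 2 := by nlinarith
      have h4 : Z ^ 2 * √Z ≤ 8 * (br η ^ 2 * √(br η)) := by
        calc Z ^ 2 * √Z ≤ (4 * br η ^ 2) * (2 * √(br η)) := by gcongr
          _ = _ := by ring
      rw [div_mul_div_comm, div_le_div_iff₀ (by positivity) (by positivity)]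
      nlinarith [mul_le_mul_of_nonneg_right h4 this.le]
    refine (Finset.sum_le_sum e1).trans ?_
    rw [← Finset.mul_sum]
    have e2 : ∑ η ∈ s21, 1 / ((supAbs (ζ - η) : ℝ) + 1)
        = ∑ ξ ∈ s21.image (fun η => ζ - η), 1 / ((supAbs ξ : ℝ) + 1) := by
      rw [Finset.sum_image (fun a _ b _ h => sub_right_injective h)]
    have e3 := sum_radial_le (s21.image (fun η => ζ - η)) (fun k => 1 / ((k : ℝ) + 1))
      (fun k => by positivity) (Finset.range (supAbs ζ + 1)) (fun ξ hξ => by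
        obtain ⟨η, hη, rfl⟩ := Finset.mem_image.1 hξ
        have h1 : br (ζ - η) ≤ Z := (Finset.mem_filter.1 hη).2
        rw [Finset.mem_range]
        have h4 : (supAbs (ζ - η) : ℝ) ≤ supAbs ζ := by unfold br at *; linarith
        have : supAbs (ζ - η) ≤ supAbs ζ := by exact_mod_cast h4
        omega)
    have e4 : ∑ k ∈ Finset.range (supAbs ζ + 1), 24 * ((k : ℝ) + 1) ^ 2 * (1 / ((k : ℝ) + 1))
        ≤ 24 * Z ^ 2 := by
      have : ∀ k ∈ Finset.range (supAbs ζ + 1),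
          24 * ((k : ℝ) + 1) ^ 2 * (1 / ((k : ℝ) + 1)) ≤ 24 * Z := by
        intro k hk
        have h1 : (k : ℝ) ≤ supAbs ζ := by exact_mod_cast Nat.lt_succ_iff.1 (Finset.mem_range.1 hk)
        have : 24 * ((k : ℝ) + 1) ^ 2 * (1 / ((k : ℝ) + 1)) = 24 * (k + 1) := by field_simp
        rw [this]; unfold br at hZ; linarith
      refine (Finset.sum_le_sum this).trans (le_of_eq ?_)
      rw [Finset.sum_const, Finset.card_range, nsmul_eq_mul]
      have : ((supAbs ζ + 1 : ℕ) : ℝ) = Z := by rw [hZ, br]; push_cast; rfl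
      rw [this]; ring
    rw [e2]
    refine (mul_le_mul_of_nonneg_left (e3.trans e4) (by positivity)).trans (le_of_eq ?_)
    field_simp
    norm_num
  -- Here ⟨η⟩ ≤ 2⟨ζ − η⟩, which leaves the tail of Σ ⟨η⟩^{-7/2} beyond about ⟨ζ⟩/2.
  have b3 : ∑ η ∈ s22, 1 / (br η ^ 2 * √(br η) * br (ζ - η)) ≤ 400 / √Z := by
    have e1 : ∀ η ∈ s22, 1 / (br η ^ 2 * √(br η) * br (ζ - η))
        ≤ 2 * (1 / (((supAbs η : ℝ) + 1) ^ 3 * √((supAbs η : ℝ) + 1))) := by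
      intro η hη
      have h1 : ¬ br (ζ - η) ≤ Z := (Finset.mem_filter.1 hη).2
      push Not at h1
      change _ ≤ 2 * (1 / (br η ^ 3 * √(br η)))
      have hη0 := br_pos η
      have := br_pos (ζ - η)
      have h2 : supAbs η ≤ supAbs ζ + supAbs (ζ - η) := by
        have := supAbs_add_le ζ (-(ζ - η))
        rw [supAbs_neg] at this
        simpa using this
      have h2' : (supAbs η : ℝ) ≤ supAbs ζ + supAbs (ζ - η) := by exact_mod_cast h2
      have h3 : br η ≤ 2 * br (ζ - η) := by unfold br at *; linarith
      rw [mul_one_div, div_le_div_iff₀ (by positivity) (by positivity)]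
      have hp : 0 < br η ^ 2 * √(br η) := by positivity
      nlinarith [mul_le_mul_of_nonneg_left h3 hp.le]
    refine (Finset.sum_le_sum e1).trans ?_
    rw [← Finset.mul_sum]
    have e2 := sum_radial_le s22 (fun k => 1 / (((k : ℝ) + 1) ^ 3 * √((k : ℝ) + 1)))
      (fun k => by positivity) (s22.image supAbs) (fun η hη => Finset.mem_image_of_mem _ hη)
    have e3 : ∑ k ∈ s22.image supAbs, 24 * ((k : ℝ) + 1) ^ 2 *
        (1 / (((k : ℝ) + 1) ^ 3 * √((k : ℝ) + 1)))
        = 24 * ∑ k ∈ s22.image supAbs, 1 / (((k : ℝ) + 1) * √((k : ℝ) + 1)) := by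
      rw [Finset.mul_sum]
      refine Finset.sum_congr rfl fun k _ => ?_
      have : (0:ℝ) < √((k : ℝ) + 1) := Real.sqrt_pos.2 (by positivity)
      field_simp
    have e4 := sum_tail_le (supAbs ζ / 2) (s22.image supAbs) (fun k hk => by
      obtain ⟨η, hη, rfl⟩ := Finset.mem_image.1 hk
      have h1 : ¬ 2 * br η ≤ Z := (Finset.mem_filter.1 (Finset.mem_filter.1 hη).1).2
      push Not at h1
      have h4 : (supAbs ζ : ℝ) < 2 * supAbs η + 1 := by unfold br at *; linarith
      have : supAbs ζ < 2 * supAbs η + 1 := by exact_mod_cast h4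
      omega)
    have e5 : 1 / √(((supAbs ζ / 2 : ℕ) : ℝ) + 1) ≤ 2 / √Z := by
      have h1 : supAbs ζ + 1 ≤ 4 * (supAbs ζ / 2 + 1) := by omega
      have h2 : Z ≤ 4 * (((supAbs ζ / 2 : ℕ) : ℝ) + 1) := by rw [hZ, br]; exact_mod_cast h1
      have h3 : √Z ≤ 2 * √(((supAbs ζ / 2 : ℕ) : ℝ) + 1) := by
        have := Real.sqrt_le_sqrt h2
        rwa [Real.sqrt_mul (by norm_num), show (4:ℝ) = 2 ^ 2 by norm_num,
          Real.sqrt_sq (by norm_num)] at this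
      have h4 : 0 < √(((supAbs ζ / 2 : ℕ) : ℝ) + 1) := Real.sqrt_pos.2 (by positivity)
      rw [div_le_div_iff₀ h4 hsZ]; linarith
    rw [e3] at e2
    have : 2 * (24 * (4 * (2 / √Z))) ≤ 400 / √Z := by
      rw [show 2 * (24 * (4 * (2 / √Z))) = 384 / √Z by ring]
      gcongr; norm_num
    linarith
  have : 96 / √Z + (192 / √Z + 400 / √Z) ≤ 1000 / √Z := by
    rw [← add_div, ← add_div]; gcongr; norm_num
  linarith

/-- `∑ ⟨m⟩^{-4} < ∞` on `ℤ³`. -/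
lemma summable_br_pow_four : Summable fun m : Fin 3 → ℤ => 1 / br m ^ 4 := by
  refine summable_of_sum_le (c := 96) (fun m => by have := br_pos m; positivity) fun s => ?_
  have e2 := sum_radial_le s (fun k => 1 / ((k : ℝ) + 1) ^ 4)
      (fun k => by positivity) (s.image supAbs) (fun η hη => Finset.mem_image_of_mem _ hη)
  have e4 := sum_tail_le 0 (s.image supAbs) (fun k _ => Nat.zero_le k)
  have e3 : ∑ k ∈ s.image supAbs, 24 * ((k : ℝ) + 1) ^ 2 * (1 / ((k : ℝ) + 1) ^ 4)
      ≤ 24 * ∑ k ∈ s.image supAbs, 1 / (((k : ℝ) + 1) * √((k : ℝ) + 1)) := by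
    rw [Finset.mul_sum]
    refine Finset.sum_le_sum fun k _ => ?_
    have h0 : (0:ℝ) < √((k : ℝ) + 1) := Real.sqrt_pos.2 (by positivity)
    have h1 : √((k : ℝ) + 1) ≤ k + 1 := by
      rw [Real.sqrt_le_left (by positivity)]; nlinarith [(Nat.cast_nonneg k : (0 : ℝ) ≤ k)]
    rw [mul_assoc]
    refine mul_le_mul_of_nonneg_left ?_ (by norm_num)
    rw [mul_one_div, div_le_div_iff₀ (by positivity) (by positivity)]
    have : (0:ℝ) < (k + 1) ^ 3 := by positivity
    nlinarith [mul_le_mul_of_nonneg_left h1 this.le]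
  norm_num at e4
  change ∑ m ∈ s, 1 / br m ^ 4 ≤ _ at e2
  norm_num at e2 e3 ⊢
  linarith

/-! ### Characters of tori -/

instance torusBorelSpace : BorelSpace (Torus N) := inferInstance
instance torusSecondCountable : SecondCountableTopology (Torus N) := inferInstance
instance torusAddHaar : (volume : Measure (Torus N)).IsAddHaarMeasure := inferInstance

/-- The integral of a nontrivial character vanishes. -/
lemma integral_character_eq_zero {G : Type*} [AddCommGroup G] [MeasurableSpace G]
    [MeasurableAdd G] (μ : Measure G) [μ.IsAddRightInvariant] (χ : G → ℂ) (y : G)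
    (hχ : ∀ x, χ (x + y) = χ x * χ y) (hy : χ y ≠ 1) : ∫ x, χ x ∂μ = 0 := by
  have h := integral_add_right_eq_self (μ := μ) χ y
  simp_rw [hχ] at h
  rw [integral_mul_const] at h
  have : (∫ x, χ x ∂μ) * (χ y - 1) = 0 := by rw [mul_sub, h]; ring
  exact (mul_eq_zero.1 this).resolve_right (sub_ne_zero.2 hy)

/-- The derivative of a function along a one-parameter group of translations integrates to zero. -/
lemma integral_deriv_translation_eq_zero {G : Type*} [AddCommGroup G] [TopologicalSpace G]
    [CompactSpace G] [MeasurableSpace G] [BorelSpace G] [MeasurableAdd G] (μ : Measure G)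
    [IsFiniteMeasure μ] [μ.IsAddRightInvariant] (h : ℝ → G) (h0 : h 0 = 0)
    (hadd : ∀ s t, h (s + t) = h s + h t) (f f' : C(G, ℂ))
    (hf : ∀ x, HasDerivAt (fun s => f (x + h s)) (f' x) 0) : ∫ x, f' x ∂μ = 0 := by
  have hder : ∀ x s, HasDerivAt (fun s => f (x + h s)) (f' (x + h s)) s := by
    intro x s
    have h1 := hf (x + h s)
    have h2 : HasDerivAt (fun u => f (x + h s + h (u - s))) (f' (x + h s)) s := by
      have := HasDerivAt.comp_sub_const s s (f := fun u => f (x + h s + h u)) (by simpa using h1)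
      simpa using this
    refine h2.congr_of_eventuallyEq (Filter.Eventually.of_forall fun u => ?_)
    simp only
    rw [add_assoc, ← hadd, add_sub_cancel]
  have key := (hasDerivAt_integral_of_dominated_loc_of_deriv_le (μ := μ) (𝕜 := ℝ)
    (F := fun s x => f (x + h s)) (F' := fun s x => f' (x + h s)) (x₀ := 0)
    (bound := fun _ => ‖f'‖) (s := Set.univ) Filter.univ_mem
    (Filter.Eventually.of_forall fun s =>
      (f.continuous.measurable.comp (measurable_add_const (h s))).aestronglyMeasurable)
    (by
      simp only [h0, add_zero]
      exact Integrable.of_bound f.continuous.measurable.aestronglyMeasurable ‖f‖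
        (Filter.Eventually.of_forall f.norm_coe_le_norm))
    (f'.continuous.measurable.comp (measurable_add_const (h 0))).aestronglyMeasurable
    (Filter.Eventually.of_forall fun x s _ => f'.norm_coe_le_norm _)
    (integrable_const _) (Filter.Eventually.of_forall fun x s _ => hder x s)).2
  -- Translation invariance makes the integral independent of s, so its derivative, already computed
  -- under the integral sign, is zero.
  have hconst : (fun s : ℝ => ∫ x, f (x + h s) ∂μ) = fun _ => ∫ x, f x ∂μ := by
    funext s
    exact integral_add_right_eq_self (μ := μ) (fun x => f x) (h s)
  rw [hconst] at key
  have := key.unique (hasDerivAt_const _ _)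
  simpa only [h0, add_zero] using this

/-! ### Modes of the torus -/

/-- The coordinates of the wave vector. -/
def xi (N : ℕ) (n : ℤ) : ℝ := 2 * Real.pi * (n : ℝ) / (N : ℝ)

lemma xi_neg (n : ℤ) : xi N (-n) = -xi N n := by simp [xi]; ring

lemma xi_add (n m : ℤ) : xi N (n + m) = xi N n + xi N m := by simp [xi]; ring

lemma xi_eq (n : ℤ) : xi N n = xi N 1 * n := by simp [xi]; ring

lemma xi_one_pos : 0 < xi N 1 := by
  have : (0 : ℝ) < N := (factPos N).out
  have := Real.pi_pos
  simp only [xi, Int.cast_one]; positivity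

lemma mode_add (m n : Fin 3 → ℤ) (x : Torus N) : mode (m + n) x = mode m x * mode n x := by
  simp only [mode, Pi.add_apply, fourier_add, Finset.prod_mul_distrib]

@[simp] lemma mode_zero (x : Torus N) : mode 0 x = 1 := by simp [mode]

lemma mode_neg (m : Fin 3 → ℤ) (x : Torus N) : mode (-m) x = star (mode m x) := by
  simp only [mode, Pi.neg_apply, fourier_neg, Complex.star_def, map_prod]

lemma mode_translate (m : Fin 3 → ℤ) (x y : Torus N) :
    mode m (x + y) = mode m x * mode m y := by
  simp only [mode, Pi.add_apply, ← Finset.prod_mul_distrib]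
  refine Finset.prod_congr rfl fun i _ => ?_
  simp only [fourier_apply, smul_add, AddCircle.toCircle_add, Circle.coe_mul]

lemma norm_mode (m : Fin 3 → ℤ) (x : Torus N) : ‖mode m x‖ = 1 := by
  simp [mode, norm_prod, fourier_apply, Circle.norm_coe]

@[fun_prop]
lemma continuous_mode (m : Fin 3 → ℤ) : Continuous (mode m : Torus N → ℂ) := by
  unfold mode; fun_prop

lemma fourier_coe_eq (n : ℤ) (s : ℝ) :
    fourier n ((s : ℝ) : AddCircle (N : ℝ)) = Complex.exp (Complex.I * (xi N n * s : ℝ)) := by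
  rw [fourier_coe_apply]
  congr 1
  simp only [xi]; push_cast; ring

lemma mode_toTorus (m : Fin 3 → ℤ) (y : Fin 3 → ℝ) :
    mode m (toTorus N y) = Complex.exp (Complex.I * (∑ i, xi N (m i) * y i : ℝ)) := by
  simp only [mode, toTorus, fourier_coe_eq, ← Complex.exp_sum]
  congr 1
  push_cast
  rw [Finset.mul_sum]

/-! ### Modes of the configuration space -/

/-- The indices of the modes of the configuration space. -/
abbrev Modes (N : ℕ) : Type := Fin (N ^ 3) → Fin 3 → ℤ

/-- The exponentials on the configuration space. -/
def cmode (k : Modes N) : C(Conf N, ℂ) where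
  toFun x := ∏ j, mode (k j) (x j)
  continuous_toFun := by fun_prop

lemma cmode_apply (k : Modes N) (x : Conf N) : cmode k x = ∏ j, mode (k j) (x j) := rfl

lemma cmode_add (k l : Modes N) : cmode (k + l) = cmode k * cmode l := by
  ext x
  simp only [cmode_apply, ContinuousMap.mul_apply, Pi.add_apply, mode_add,
    Finset.prod_mul_distrib]

lemma cmode_zero : cmode (0 : Modes N) = 1 := by
  ext x; simp [cmode_apply]

lemma cmode_neg (k : Modes N) : cmode (-k) = star (cmode k) := by
  ext x
  simp only [cmode_apply, Pi.neg_apply, mode_neg, ContinuousMap.star_apply, star_prod]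

lemma cmode_translate (k : Modes N) (x y : Conf N) :
    cmode k (x + y) = cmode k x * cmode k y := by
  simp only [cmode_apply, Pi.add_apply, mode_translate, Finset.prod_mul_distrib]

lemma norm_cmode (k : Modes N) (x : Conf N) : ‖cmode k x‖ = 1 := by
  simp [cmode_apply, norm_prod, norm_mode]

lemma cmode_coordShift (k : Modes N) (c : Coord N) (s : ℝ) :
    cmode k (coordShift c s) = Complex.exp (Complex.I * (xi N (k c.1 c.2) * s : ℝ)) := by
  rw [← fourier_coe_eq, cmode_apply, Finset.prod_eq_single c.1]
  · simp only [coordShift, Pi.single_eq_same, mode]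
    rw [Finset.prod_eq_single c.2]
    · simp
    · intro i _ hi; simp [Pi.single_eq_of_ne hi]
    · simp
  · intro j _ hj
    simp [coordShift, Pi.single_eq_of_ne hj, mode]
  · simp

lemma coordShift_add (c : Coord N) (s t : ℝ) :
    coordShift c (s + t) = (coordShift c s + coordShift c t : Conf N) := by
  simp only [coordShift, AddCircle.coe_add, Pi.single_add]

@[simp] lemma coordShift_zero (c : Coord N) : (coordShift c 0 : Conf N) = 0 := by
  simp [coordShift]

lemma exists_cmode_ne_one {k : Modes N} (hk : k ≠ 0) : ∃ y, cmode k y ≠ 1 := by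
  obtain ⟨j, hj⟩ := Function.ne_iff.1 hk
  obtain ⟨i, hi⟩ := Function.ne_iff.1 hj
  have hxi : xi N (k j i) ≠ 0 := by
    rw [xi_eq]
    exact mul_ne_zero xi_one_pos.ne' (Int.cast_ne_zero.2 hi)
  -- Half a period in a direction of nonzero frequency gives the value e^{iπ} = −1.
  refine ⟨coordShift (j, i) (Real.pi / xi N (k j i)), ?_⟩
  rw [cmode_coordShift, mul_div_cancel₀ _ hxi, mul_comm, Complex.exp_pi_mul_I]
  norm_num

lemma integral_cmode {k : Modes N} (hk : k ≠ 0) : ∫ x, cmode k x = 0 := by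
  obtain ⟨y, hy⟩ := exists_cmode_ne_one hk
  exact integral_character_eq_zero volume _ y (fun x => cmode_translate k x y) hy

lemma hasDerivAt_cmode (k : Modes N) (c : Coord N) :
    IsPartial c (cmode k) ((Complex.I * xi N (k c.1 c.2)) • cmode k) := by
  intro x
  simp only [cmode_translate, cmode_coordShift]
  have h1 : HasDerivAt (fun s : ℝ => Complex.I * ((xi N (k c.1 c.2) * s : ℝ) : ℂ))
      (Complex.I * xi N (k c.1 c.2)) 0 := by
    have := ((hasDerivAt_id (0 : ℝ)).const_mul (xi N (k c.1 c.2))).ofReal_comp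
    simpa using this.const_mul Complex.I
  have h2 := (h1.cexp).const_mul (cmode k x)
  simpa [mul_comm] using h2

lemma isSmooth_cmode (k : Modes N) : IsSmooth (cmode k) := by
  unfold IsSmooth
  have : (fun y : Fin (N ^ 3) → Fin 3 → ℝ => cmode k fun j => toTorus N (y j)) = fun y =>
      ∏ j, Complex.exp (Complex.I * (∑ i, xi N (k j i) * y j i : ℝ)) := by
    funext y
    simp only [cmode_apply, mode_toTorus]
  rw [this]
  refine contDiff_prod fun j _ => ContDiff.cexp (contDiff_const.mul ?_)
  have h : ContDiff ℝ ((⊤ : ℕ∞) : WithTop ℕ∞)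
      fun y : Fin (N ^ 3) → Fin 3 → ℝ => ∑ i, xi N (k j i) * y j i :=
    ContDiff.sum fun i _ => contDiff_const.mul (contDiff_apply_apply ℝ ℝ j i)
  exact Complex.ofRealCLM.contDiff.comp h

/-! ### The Fourier basis of `L²` -/

/-- The square root of the volume of the configuration space. -/
def rvol (N : ℕ) [NeZero N] : ℝ := √(volume.real (Set.univ : Set (Conf N)))

lemma rvol_pos : 0 < rvol N := Real.sqrt_pos.2 <| by
  have h : (volume : Measure (Conf N)) Set.univ ≠ 0 := by
    rw [volume_pi, Measure.pi_univ]
    refine Finset.prod_ne_zero_iff.2 fun j _ => ?_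
    rw [volume_pi, Measure.pi_univ]
    refine Finset.prod_ne_zero_iff.2 fun i _ => ?_
    rw [AddCircle.measure_univ]
    exact (ENNReal.ofReal_pos.2 (factPos N).out).ne'
  exact ENNReal.toReal_pos h (measure_ne_top _ _)

/-- A continuous function as an element of `L²`. -/
def toL2C (f : C(Conf N, ℂ)) : L2 N := ContinuousMap.toLp 2 volume ℂ f

lemma coeFn_toL2C (f : C(Conf N, ℂ)) : toL2C f =ᵐ[volume] f := ContinuousMap.coeFn_toLp volume f

lemma inner_toL2C (f : C(Conf N, ℂ)) (ψ : L2 N) :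
    inner ℂ (toL2C f) ψ = ∫ x, ψ x * star (f x) := by
  rw [L2.inner_def]
  refine integral_congr_ae ?_
  filter_upwards [coeFn_toL2C f] with x hx
  rw [hx]; rfl

lemma inner_toL2C_cmode (k l : Modes N) :
    inner ℂ (toL2C (cmode k)) (toL2C (cmode l)) = if k = l then (rvol N : ℂ) ^ 2 else 0 := by
  have h : inner ℂ (toL2C (cmode k)) (toL2C (cmode l)) = ∫ x, cmode (l - k) x := by
    rw [inner_toL2C]
    refine integral_congr_ae ?_
    filter_upwards [coeFn_toL2C (cmode l)] with x hx
    rw [hx, sub_eq_add_neg, cmode_add, cmode_neg]; rfl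
  rw [h]
  split_ifs with hkl
  · subst hkl
    simp only [sub_self, cmode_zero, ContinuousMap.one_apply, integral_const]
    rw [← Complex.ofReal_pow, rvol, Real.sq_sqrt measureReal_nonneg]
    simp
  · exact integral_cmode (sub_ne_zero.2 (Ne.symm hkl))

/-- The normalized modes. -/
def nmode (k : Modes N) : L2 N := ((rvol N : ℂ)⁻¹) • toL2C (cmode k)

lemma orthonormal_nmode : Orthonormal ℂ (nmode : Modes N → L2 N) := by
  classical
  rw [orthonormal_iff_ite]
  intro k l
  have h : (rvol N : ℂ) ≠ 0 := by exact_mod_cast (rvol_pos (N := N)).ne'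
  rw [nmode, nmode, inner_smul_left, inner_smul_right, inner_toL2C_cmode]
  split_ifs
  · simp only [map_inv₀, Complex.conj_ofReal]; field_simp
  · simp

/-- The star subalgebra spanned by the modes. -/
def modeSubalgebra (N : ℕ) [NeZero N] : StarSubalgebra ℂ C(Conf N, ℂ) where
  toSubalgebra := Algebra.adjoin ℂ (Set.range cmode)
  star_mem' := by
    change Algebra.adjoin ℂ (Set.range cmode) ≤ star (Algebra.adjoin ℂ (Set.range cmode))
    refine Algebra.adjoin_le ?_
    rintro _ ⟨n, rfl⟩
    refine Algebra.subset_adjoin ⟨-n, ?_⟩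
    rw [cmode_neg]

/-- A product of modes is a mode, so the generated algebra is no larger than the linear span. -/
lemma modeSubalgebra_coe :
    (modeSubalgebra N).toSubalgebra.toSubmodule = Submodule.span ℂ (Set.range cmode) := by
  apply Algebra.adjoin_eq_span_of_subset
  refine .trans (fun x ↦ Submonoid.closure_induction (fun _ ↦ id) ⟨0, cmode_zero⟩ ?_)
    Submodule.subset_span
  rintro _ _ _ _ ⟨m, rfl⟩ ⟨n, rfl⟩
  exact ⟨m + n, cmode_add m n⟩

/-- One mode, of frequency one in a coordinate where the two points differ, separates them because
`AddCircle.toCircle` is injective. -/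
lemma modeSubalgebra_separatesPoints : (modeSubalgebra N).SeparatesPoints := by
  intro x y hxy
  obtain ⟨j, hj⟩ := Function.ne_iff.1 hxy
  obtain ⟨i, hi⟩ := Function.ne_iff.1 hj
  refine ⟨_, ⟨cmode (Pi.single j (Pi.single i 1)), Algebra.subset_adjoin ⟨_, rfl⟩, rfl⟩, ?_⟩
  have h : ∀ z : Conf N, cmode (Pi.single j (Pi.single i 1)) z = fourier 1 (z j i) := by
    intro z
    rw [cmode_apply, Finset.prod_eq_single j, Pi.single_eq_same, mode, Finset.prod_eq_single i,
      Pi.single_eq_same]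
    · intro l _ hl; simp [Pi.single_eq_of_ne hl]
    · simp
    · intro l _ hl; simp [Pi.single_eq_of_ne hl]
    · simp
  simp only [h, fourier_one, ne_eq]
  intro h'
  exact hi (AddCircle.injective_toCircle (factPos N).out.ne' (Subtype.ext h'))

lemma span_cmode_closure : (Submodule.span ℂ (Set.range (cmode (N := N)))).topologicalClosure
    = ⊤ := by
  rw [← modeSubalgebra_coe]
  exact congr_arg (Subalgebra.toSubmodule <| StarSubalgebra.toSubalgebra ·)
    (ContinuousMap.starSubalgebra_topologicalClosure_eq_top_of_separatesPoints _
      modeSubalgebra_separatesPoints)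

/-- Stone–Weierstrass gives uniform density of the trigonometric polynomials, and continuous
functions are dense in L². -/
lemma span_nmode_closure :
    ⊤ ≤ (Submodule.span ℂ (Set.range (nmode (N := N)))).topologicalClosure := by
  have h1 : (Submodule.span ℂ (Set.range fun k => toL2C (cmode (N := N) k))).topologicalClosure
      = ⊤ := by
    have := (ContinuousMap.toLp_denseRange (p := 2) ℂ (volume : Measure (Conf N)) ℂ
      (by norm_num)).topologicalClosure_map_submodule (span_cmode_closure (N := N))
    rw [Submodule.map_span, ← Set.range_comp] at this
    exact this
  rw [← h1]
  refine Submodule.topologicalClosure_mono (Submodule.span_le.2 ?_)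
  rintro _ ⟨k, rfl⟩
  have h : (rvol N : ℂ) ≠ 0 := by exact_mod_cast (rvol_pos (N := N)).ne'
  have : toL2C (cmode k) = (rvol N : ℂ) • nmode k := by
    rw [nmode, smul_smul, mul_inv_cancel₀ h, one_smul]
  change toL2C (cmode k) ∈ _
  rw [this]
  exact Submodule.smul_mem _ _ (Submodule.subset_span ⟨k, rfl⟩)

/-- The Fourier basis of `L²` of the configuration space. -/
def fb (N : ℕ) [NeZero N] : HilbertBasis (Modes N) ℂ (L2 N) :=
  HilbertBasis.mk orthonormal_nmode span_nmode_closure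

/-- The Fourier coefficients on the configuration space. -/
def fc (k : Modes N) : L2 N →L[ℂ] ℂ := innerSL ℂ (nmode k)

lemma fc_apply (k : Modes N) (ψ : L2 N) : fc k ψ = inner ℂ (nmode k) ψ := rfl

lemma fb_apply (k : Modes N) : fb N k = nmode k := by
  simp [fb]

lemma fc_eq_integral (k : Modes N) (ψ : L2 N) :
    fc k ψ = (rvol N : ℂ)⁻¹ * ∫ x, ψ x * star (cmode k x) := by
  rw [fc_apply, nmode, inner_smul_left, inner_toL2C]
  simp

lemma hasSum_fc_inner (ψ φ : L2 N) :
    HasSum (fun k => star (fc k ψ) * fc k φ) (inner ℂ ψ φ) := by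
  convert! (fb N).hasSum_inner_mul_inner ψ φ using 2 with k
  rw [fb_apply, fc_apply, fc_apply, Complex.star_def, inner_conj_symm]

lemma hasSum_fc_sq (ψ : L2 N) : HasSum (fun k => ‖fc k ψ‖ ^ 2) (‖ψ‖ ^ 2) := by
  have h := Complex.hasSum_re (hasSum_fc_inner ψ ψ)
  rw [inner_self_eq_norm_sq_to_K] at h
  convert! h using 2 with k
  · rw [Complex.star_def, ← Complex.normSq_eq_conj_mul_self, Complex.ofReal_re,
      Complex.normSq_eq_norm_sq]
  · norm_cast

lemma ext_fc {ψ φ : L2 N} (h : ∀ k, fc k ψ = fc k φ) : ψ = φ := by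
  have h1 := hasSum_fc_sq (ψ - φ)
  simp only [map_sub, h, sub_self, norm_zero, ne_eq, OfNat.ofNat_ne_zero, not_false_eq_true,
    zero_pow] at h1
  have := h1.unique hasSum_zero
  exact sub_eq_zero.1 (norm_eq_zero.1 (pow_eq_zero_iff (by norm_num) |>.1 this))

/-! ### The Sobolev space `H¹` in Fourier variables -/

lemma integral_mul_eq_inner (ψ : L2 N) (φ : C(Conf N, ℂ)) :
    ∫ x, ψ x * φ x = inner ℂ (toL2C (star φ)) ψ := by
  rw [inner_toL2C]; simp

/-- The Fourier coefficients of a partial derivative. -/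
lemma fc_isPartial {c : Coord N} {φ φ' : C(Conf N, ℂ)} (h : IsPartial c φ φ') (k : Modes N) :
    fc k (toL2C φ') = Complex.I * xi N (k c.1 c.2) * fc k (toL2C φ) := by
  have h1 : ∀ f : C(Conf N, ℂ), fc k (toL2C f)
      = (rvol N : ℂ)⁻¹ * ∫ x, (f * cmode (-k)) x := by
    intro f
    rw [fc_eq_integral]
    congr 1
    refine integral_congr_ae ?_
    filter_upwards [coeFn_toL2C f] with x hx
    rw [hx, cmode_neg]; rfl
  have h2 := integral_deriv_translation_eq_zero (volume : Measure (Conf N)) (coordShift c)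
    (coordShift_zero c) (coordShift_add c) (φ * cmode (-k))
    (φ' * cmode (-k) + φ * ((Complex.I * xi N ((-k) c.1 c.2)) • cmode (-k))) (fun x => by
      refine ((h x).mul (hasDerivAt_cmode (-k) c x)).congr_deriv ?_
      simp; ring)
  rw [h1, h1]
  have hi : ∀ f : C(Conf N, ℂ), Integrable (fun x => f x) (volume : Measure (Conf N)) :=
    fun f => Integrable.of_bound f.continuous.measurable.aestronglyMeasurable ‖f‖
      (Filter.Eventually.of_forall f.norm_coe_le_norm)
  simp only [ContinuousMap.add_apply] at h2
  rw [integral_add (hi _) (hi _)] at h2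
  have h4 : ∫ x, (φ * ((Complex.I * xi N ((-k) c.1 c.2)) • cmode (-k))) x
      = -(Complex.I * xi N (k c.1 c.2)) * ∫ x, (φ * cmode (-k)) x := by
    rw [← integral_const_mul]
    refine integral_congr_ae (Filter.Eventually.of_forall fun x => ?_)
    simp only [ContinuousMap.mul_apply, ContinuousMap.smul_apply, Pi.neg_apply, xi_neg,
      smul_eq_mul]
    push_cast; ring
  rw [h4] at h2
  linear_combination (rvol N : ℂ)⁻¹ * h2

lemma isPartial_star {c : Coord N} {φ φ' : C(Conf N, ℂ)} (h : IsPartial c φ φ') :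
    IsPartial c (star φ : C(Conf N, ℂ)) (star φ' : C(Conf N, ℂ)) := by
  intro x
  exact (h x).star

/-- Forward: the mode of index −k is an admissible test function. Backward: Parseval reduces the
identity to coefficients, where the classical derivative of the test function carries the factor iξ
by `fc_isPartial`. -/
lemma isWeakPartial_iff (c : Coord N) (ψ g : L2 N) :
    IsWeakPartial c ψ g ↔ ∀ k : Modes N, fc k g = Complex.I * xi N (k c.1 c.2) * fc k ψ := by
  constructor
  · intro h k
    have h1 := h (cmode (-k)) ((Complex.I * xi N ((-k) c.1 c.2)) • cmode (-k))
      (isSmooth_cmode _) (hasDerivAt_cmode _ c)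
    have h2 : ∀ f : L2 N, fc k f = (rvol N : ℂ)⁻¹ * ∫ x, f x * cmode (-k) x := by
      intro f; rw [fc_eq_integral, cmode_neg]; rfl
    rw [h2, h2]
    have h3 : ∫ x, ψ x * ((Complex.I * xi N ((-k) c.1 c.2)) • cmode (-k)) x
        = -(Complex.I * xi N (k c.1 c.2)) * ∫ x, ψ x * cmode (-k) x := by
      rw [← integral_const_mul]
      refine integral_congr_ae (Filter.Eventually.of_forall fun x => ?_)
      simp only [ContinuousMap.smul_apply, Pi.neg_apply, xi_neg, smul_eq_mul]
      push_cast; ring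
    rw [h3] at h1
    linear_combination (rvol N : ℂ)⁻¹ * h1
  · intro h φ φ' _ hp
    rw [integral_mul_eq_inner, integral_mul_eq_inner]
    have h1 := hasSum_fc_inner (toL2C (star φ')) ψ
    have h2 := (hasSum_fc_inner (toL2C (star φ)) g).neg
    refine h1.unique ?_
    convert! h2 using 2 with k
    rw [fc_isPartial (isPartial_star hp) k, h k]
    simp only [Complex.star_def, map_mul, Complex.conj_I, Complex.conj_ofReal]
    ring

lemma mem_H1_iff (u : PiLp 2 fun _ : Option (Coord N) => L2 N) :
    u ∈ H1 N ↔ ∀ (c : Coord N) (k : Modes N),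
      fc k (u (some c)) = Complex.I * xi N (k c.1 c.2) * fc k (u none) :=
  forall_congr' fun c => isWeakPartial_iff c _ _

lemma fc_wpartial (c : Coord N) (k : Modes N) (u : H1 N) :
    fc k (wpartial c u) = Complex.I * xi N (k c.1 c.2) * fc k (toL2 u) :=
  (mem_H1_iff _).1 u.2 c k

/-- Each coefficient identity is a closed condition in the Hilbert sum. The resulting completeness
of H¹ is needed for the Hilbert basis and for Picard–Lindelöf. -/
lemma H1_isClosed : IsClosed (H1 N : Set (PiLp 2 fun _ : Option (Coord N) => L2 N)) := by
  have : (H1 N : Set (PiLp 2 fun _ : Option (Coord N) => L2 N)) = ⋂ c : Coord N, ⋂ k : Modes N,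
      {u | fc k (u (some c)) = Complex.I * xi N (k c.1 c.2) * fc k (u none)} := by
    ext u
    simp only [SetLike.mem_coe, mem_H1_iff, Set.mem_iInter, Set.mem_ofPred_eq]
  rw [this]
  refine isClosed_iInter fun c => isClosed_iInter fun k => isClosed_eq ?_ ?_ <;> fun_prop

instance H1_complete : CompleteSpace (H1 N) := H1_isClosed.completeSpace_coe

lemma ext_toL2 {u v : H1 N} (h : toL2 u = toL2 v) : u = v := by
  refine Subtype.ext (PiLp.ext fun o => ?_)
  rcases o with _ | c
  · exact h
  · refine ext_fc fun k => ?_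
    have h1 := fc_wpartial c k u
    have h2 := fc_wpartial c k v
    rw [h, ← h2] at h1
    exact h1

/-- Construction of elements of `H¹`. -/
def mkH1 (ψ : L2 N) (g : Coord N → L2 N)
    (h : ∀ c k, fc k (g c) = Complex.I * xi N (k c.1 c.2) * fc k ψ) : H1 N :=
  ⟨WithLp.toLp 2 fun o => Option.casesOn o ψ g, (mem_H1_iff _).2 h⟩

@[simp] lemma toL2_mkH1 (ψ : L2 N) (g : Coord N → L2 N) (h) : toL2 (mkH1 ψ g h) = ψ := rfl

@[simp] lemma wpartial_mkH1 (ψ : L2 N) (g : Coord N → L2 N) (h) (c : Coord N) :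
    wpartial c (mkH1 ψ g h) = g c := rfl

lemma H1_inner_eq (u v : H1 N) :
    inner ℂ u v = inner ℂ (toL2 u) (toL2 v) + ∑ c, inner ℂ (wpartial c u) (wpartial c v) := by
  rw [Submodule.coe_inner, PiLp.inner_apply, Fintype.sum_option]; rfl

lemma H1_norm_sq (u : H1 N) : ‖u‖ ^ 2 = ‖toL2 u‖ ^ 2 + ∑ c, ‖wpartial c u‖ ^ 2 := by
  rw [Submodule.coe_norm, PiLp.norm_sq_eq_of_L2, Fintype.sum_option]; rfl

lemma norm_toL2_le (u : H1 N) : ‖toL2 u‖ ≤ ‖u‖ := by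
  refine le_of_sq_le_sq ?_ (norm_nonneg u)
  rw [H1_norm_sq]
  have : 0 ≤ ∑ c, ‖wpartial c u‖ ^ 2 := by positivity
  linarith

lemma norm_wpartial_le (c : Coord N) (u : H1 N) : ‖wpartial c u‖ ≤ ‖u‖ := by
  refine le_of_sq_le_sq ?_ (norm_nonneg u)
  rw [H1_norm_sq]
  have := Finset.single_le_sum (f := fun c => ‖wpartial c u‖ ^ 2) (fun _ _ => by positivity)
    (Finset.mem_univ c)
  have h2 : 0 ≤ ‖toL2 u‖ ^ 2 := by positivity
  linarith

/-- The wave number squared of a mode. -/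
def ksq (k : Modes N) : ℝ := ∑ c : Coord N, xi N (k c.1 c.2) ^ 2

lemma ksq_nonneg (k : Modes N) : 0 ≤ ksq k := Finset.sum_nonneg fun _ _ => sq_nonneg _

lemma fc_nmode (k l : Modes N) : fc k (nmode l) = if k = l then 1 else 0 :=
  orthonormal_iff_ite.1 orthonormal_nmode k l

/-- The modes as elements of `H¹`. -/
def hmode (k : Modes N) : H1 N :=
  mkH1 (nmode k) (fun c => (Complex.I * xi N (k c.1 c.2)) • nmode k) fun c l => by
    rw [map_smul, fc_nmode, smul_eq_mul]
    split_ifs with h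
    · rw [h]
    · simp

@[simp] lemma toL2_hmode (k : Modes N) : toL2 (hmode k) = nmode k := rfl

lemma wpartial_hmode (k : Modes N) (c : Coord N) :
    wpartial c (hmode k) = (Complex.I * xi N (k c.1 c.2)) • nmode k := rfl

/-- The weight 1 + |ξ|² dictates the normalisation of `hnmode`, and it turns H¹ orthogonality to a
mode into the vanishing of an L² coefficient. -/
lemma inner_hmode (k : Modes N) (u : H1 N) :
    inner ℂ (hmode k) u = (1 + ksq k : ℝ) * fc k (toL2 u) := by
  rw [H1_inner_eq, toL2_hmode, ← fc_apply]
  have : ∀ c, inner ℂ (wpartial c (hmode k)) (wpartial c u)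
      = ((xi N (k c.1 c.2) ^ 2 : ℝ) : ℂ) * fc k (toL2 u) := by
    intro c
    rw [wpartial_hmode, inner_smul_left, ← fc_apply, fc_wpartial]
    simp only [map_mul, Complex.conj_I, Complex.conj_ofReal]
    push_cast
    linear_combination (-(xi N (k c.1 c.2) : ℂ) ^ 2 * fc k (toL2 u)) * Complex.I_sq
  simp only [this, ← Finset.sum_mul, ksq]
  push_cast; ring

/-- The normalized modes in `H¹`. -/
def hnmode (k : Modes N) : H1 N := ((√(1 + ksq k) : ℝ) : ℂ)⁻¹ • hmode k

lemma sqrt_one_add_ksq_pos (k : Modes N) : 0 < √(1 + ksq k) :=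
  Real.sqrt_pos.2 (by have := ksq_nonneg k; linarith)

lemma inner_hnmode (k : Modes N) (u : H1 N) :
    inner ℂ (hnmode k) u = (√(1 + ksq k) : ℝ) * fc k (toL2 u) := by
  have h := (sqrt_one_add_ksq_pos k).ne'
  have h2 : ((1 + ksq k : ℝ) : ℂ) = (√(1 + ksq k) : ℝ) * (√(1 + ksq k) : ℝ) := by
    rw [← Complex.ofReal_mul, Real.mul_self_sqrt (by have := ksq_nonneg k; linarith)]
  rw [hnmode]
  have h3 := inner_smul_left (hmode k) u (((√(1 + ksq k) : ℝ) : ℂ)⁻¹)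
  refine h3.trans ?_
  rw [inner_hmode, h2]
  have : ((√(1 + ksq k) : ℝ) : ℂ) ≠ 0 := by exact_mod_cast h
  simp only [map_inv₀, Complex.conj_ofReal]
  field_simp

lemma orthonormal_hnmode : Orthonormal ℂ (hnmode : Modes N → H1 N) := by
  classical
  rw [orthonormal_iff_ite]
  intro k l
  have h := (sqrt_one_add_ksq_pos l).ne'
  have : ((√(1 + ksq l) : ℝ) : ℂ) ≠ 0 := by exact_mod_cast h
  rw [inner_hnmode, hnmode, map_smul, map_smul, toL2_hmode, fc_nmode]
  split_ifs with hkl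
  · subst hkl; rw [smul_eq_mul, mul_one, mul_inv_cancel₀ this]
  · simp

/-- The Fourier basis of `H¹`. -/
def hb (N : ℕ) [NeZero N] : HilbertBasis (Modes N) ℂ (H1 N) :=
  HilbertBasis.mkOfOrthogonalEqBot orthonormal_hnmode <| by
    rw [Submodule.eq_bot_iff]
    intro u hu
    refine ext_toL2 (ext_fc fun k => ?_)
    have h1 := (Submodule.mem_orthogonal _ _).1 hu (hnmode k) (Submodule.subset_span ⟨k, rfl⟩)
    rw [inner_hnmode] at h1
    have : ((√(1 + ksq k) : ℝ) : ℂ) ≠ 0 := by exact_mod_cast (sqrt_one_add_ksq_pos k).ne'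
    rw [(mul_eq_zero.1 h1).resolve_left this]
    simp

lemma hb_apply (k : Modes N) : hb N k = hnmode k := by
  simp [hb]

lemma hb_repr_apply (u : H1 N) (k : Modes N) :
    (hb N).repr u k = (√(1 + ksq k) : ℝ) * fc k (toL2 u) := by
  rw [HilbertBasis.repr_apply_apply, hb_apply, inner_hnmode]

lemma ext_H1_fc {u v : H1 N} (h : ∀ k, fc k (toL2 u) = fc k (toL2 v)) : u = v :=
  ext_toL2 (ext_fc h)

/-- A real functional on `H¹` is determined by its values on the multiples of the modes. -/
lemma ext_Hm1 {η θ : Hm1 N} (h : ∀ (k : Modes N) (c : ℂ), η (c • hmode k) = θ (c • hmode k)) :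
    η = θ := by
  have hd : (Submodule.span ℂ (Set.range (hb N))).topologicalClosure = ⊤ := (hb N).dense_span
  ext u
  have hu : u ∈ (Submodule.span ℂ (Set.range (hb N))).topologicalClosure := by rw [hd]; trivial
  have hcl : IsClosed {u : H1 N | η u = θ u} := isClosed_eq η.continuous θ.continuous
  refine closure_minimal (fun w hw => ?_) hcl hu
  have hw' : ∀ c : ℂ, η (c • w) = θ (c • w) := by
    induction hw using Submodule.span_induction with
    | mem x hx =>
      obtain ⟨k, rfl⟩ := hx
      intro c
      rw [hb_apply, hnmode, smul_smul]
      exact h k _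
    | zero => simp
    | add x y _ _ hx hy => intro c; simp [smul_add, hx c, hy c]
    | smul a x _ hx => intro c; rw [smul_smul]; exact hx _
  simpa using hw' 1

/-! ### Multiplication by modes -/

lemma memLp_mul (φ : C(Conf N, ℂ)) (ψ : L2 N) :
    MemLp (fun x => φ x * ψ x) 2 (volume : Measure (Conf N)) :=
  (Lp.memLp ψ).of_le_mul (c := ‖φ‖)
    (φ.continuous.measurable.aestronglyMeasurable.mul (Lp.memLp ψ).1)
    (Filter.Eventually.of_forall fun x => by
      rw [norm_mul]; exact mul_le_mul_of_nonneg_right (φ.norm_coe_le_norm x) (norm_nonneg _))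

/-- Multiplication of an `L²` function by a continuous function. -/
def mulL2 (φ : C(Conf N, ℂ)) : L2 N →L[ℂ] L2 N :=
  LinearMap.mkContinuous
    { toFun := fun ψ => (memLp_mul φ ψ).toLp _
      map_add' := fun ψ χ => by
        rw [← MemLp.toLp_add]
        refine MemLp.toLp_congr _ _ ?_
        filter_upwards [Lp.coeFn_add ψ χ] with x hx
        simp only [hx, Pi.add_apply, mul_add]
      map_smul' := fun c ψ => by
        rw [RingHom.id_apply, ← MemLp.toLp_const_smul]
        refine MemLp.toLp_congr _ _ ?_
        filter_upwards [Lp.coeFn_smul c ψ] with x hx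
        simp only [hx, Pi.smul_apply, smul_eq_mul]; ring }
    ‖φ‖ fun ψ => by
      refine Lp.norm_le_mul_norm_of_ae_le_mul ?_
      filter_upwards [(memLp_mul φ ψ).coeFn_toLp] with x hx
      change ‖((memLp_mul φ ψ).toLp _ : L2 N) x‖ ≤ _
      rw [hx, norm_mul]
      exact mul_le_mul_of_nonneg_right (φ.norm_coe_le_norm x) (norm_nonneg _)

lemma coeFn_mulL2 (φ : C(Conf N, ℂ)) (ψ : L2 N) :
    mulL2 φ ψ =ᵐ[volume] fun x => φ x * ψ x := (memLp_mul φ ψ).coeFn_toLp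

lemma inner_mulL2_left (φ : C(Conf N, ℂ)) (ψ χ : L2 N) :
    inner ℂ (mulL2 φ ψ) χ = inner ℂ ψ (mulL2 (star φ) χ) := by
  rw [L2.inner_def, L2.inner_def]
  refine integral_congr_ae ?_
  filter_upwards [coeFn_mulL2 φ ψ, coeFn_mulL2 (star φ) χ] with x h1 h2
  rw [h1, h2]
  simp only [RCLike.inner_apply, map_mul, ContinuousMap.star_apply, Complex.star_def]
  ring

lemma fc_mulL2_cmode (k l : Modes N) (ψ : L2 N) :
    fc k (mulL2 (cmode l) ψ) = fc (k - l) ψ := by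
  rw [fc_eq_integral, fc_eq_integral]
  congr 1
  refine integral_congr_ae ?_
  filter_upwards [coeFn_mulL2 (cmode l) ψ] with x hx
  rw [hx, sub_eq_add_neg, cmode_add, cmode_neg]
  simp only [ContinuousMap.mul_apply, ContinuousMap.star_apply, star_mul', star_star]
  ring

lemma norm_mulL2_cmode_le (l : Modes N) (ψ : L2 N) : ‖mulL2 (cmode l) ψ‖ ≤ ‖ψ‖ := by
  have h1 : ‖cmode l‖ ≤ 1 :=
    (ContinuousMap.norm_le _ zero_le_one).2 fun x => (norm_cmode l x).le
  have h2 : ‖mulL2 (cmode l) ψ‖ ≤ ‖cmode l‖ * ‖ψ‖ :=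
    LinearMap.mkContinuous_norm_le _ (norm_nonneg _) _ |> fun h =>
      (ContinuousLinearMap.le_of_opNorm_le _ h ψ)
  nlinarith [norm_nonneg ψ]

/-- Multiplication by the mode `m` in the variable `x_j`, on `L²`. -/
def modeL2 (j : Fin (N ^ 3)) (m : Fin 3 → ℤ) : L2 N →L[ℂ] L2 N := mulL2 (cmode (Pi.single j m))

lemma norm_modeL2_le (j : Fin (N ^ 3)) (m : Fin 3 → ℤ) (ψ : L2 N) : ‖modeL2 j m ψ‖ ≤ ‖ψ‖ :=
  norm_mulL2_cmode_le _ ψ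

lemma inner_modeL2_left (j : Fin (N ^ 3)) (m : Fin 3 → ℤ) (ψ χ : L2 N) :
    inner ℂ (modeL2 j m ψ) χ = inner ℂ ψ (modeL2 j (-m) χ) := by
  rw [modeL2, inner_mulL2_left, modeL2, Pi.single_neg, cmode_neg]

lemma fc_modeL2 (j : Fin (N ^ 3)) (m : Fin 3 → ℤ) (k : Modes N) (ψ : L2 N) :
    fc k (modeL2 j m ψ) = fc (k - Pi.single j m) ψ := fc_mulL2_cmode _ _ _

lemma abs_xi_le (m : Fin 3 → ℤ) (i : Fin 3) : |xi N (m i)| ≤ xi N 1 * br m := by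
  rw [xi_eq, abs_mul, abs_of_pos xi_one_pos]
  refine mul_le_mul_of_nonneg_left ?_ xi_one_pos.le
  have : ((m i).natAbs : ℝ) ≤ supAbs m := by exact_mod_cast natAbs_le_supAbs m i
  rw [Nat.cast_natAbs, Int.cast_abs] at this
  unfold br; linarith

lemma abs_xi_single_le (j : Fin (N ^ 3)) (m : Fin 3 → ℤ) (c : Coord N) :
    |xi N ((Pi.single j m : Modes N) c.1 c.2)| ≤ xi N 1 * br m := by
  rcases eq_or_ne c.1 j with h | h
  · rw [h, Pi.single_eq_same]; exact abs_xi_le m c.2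
  · rw [Pi.single_eq_of_ne h, Pi.zero_apply, xi_eq, Int.cast_zero, mul_zero, abs_zero]
    have := br_pos m; have := xi_one_pos (N := N); positivity

lemma H1_norm_le_sum (u : H1 N) : ‖u‖ ≤ ‖toL2 u‖ + ∑ c, ‖wpartial c u‖ := by
  refine le_of_sq_le_sq ?_ (by positivity)
  rw [H1_norm_sq, add_sq]
  have h := Finset.sum_sq_le_sq_sum_of_nonneg (s := Finset.univ)
    (f := fun c : Coord N => ‖wpartial c u‖) fun _ _ => norm_nonneg _
  have h2 : 0 ≤ 2 * ‖toL2 u‖ * ∑ c, ‖wpartial c u‖ := by positivity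
  linarith

/-- The bound for the multiplication by modes on `H¹`. -/
def modeBound (N : ℕ) : ℝ := 1 + Fintype.card (Coord N) * (1 + xi N 1)

lemma modeBound_pos : 0 < modeBound N := by
  have := xi_one_pos (N := N); unfold modeBound; positivity

/-- Multiplication by the mode `m` in the variable `x_j`, on `H¹`. -/
def modeH1 (j : Fin (N ^ 3)) (m : Fin 3 → ℤ) : H1 N →L[ℂ] H1 N :=
  LinearMap.mkContinuous
    { toFun := fun u => mkH1 (modeL2 j m (toL2 u))
        -- Product rule; the extra term, in which the mode is differentiated, is the source of the
        -- factor `br m` in the operator bound.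
        (fun c => modeL2 j m (wpartial c u) +
          (Complex.I * xi N ((Pi.single j m : Modes N) c.1 c.2)) • modeL2 j m (toL2 u))
        fun c k => by
          rw [map_add, map_smul, fc_modeL2, fc_modeL2, fc_wpartial, smul_eq_mul, Pi.sub_apply,
            Pi.sub_apply, sub_eq_add_neg (k c.1 c.2), xi_add, xi_neg]
          push_cast; ring
      map_add' := fun u v => by
        refine ext_toL2 ?_
        simp only [map_add, toL2_mkH1]
      map_smul' := fun a u => by
        refine ext_toL2 ?_
        simp only [map_smul, toL2_mkH1, RingHom.id_apply] }
    (modeBound N * br m) fun u => by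
      refine (H1_norm_le_sum _).trans ?_
      simp only [LinearMap.coe_mk, AddHom.coe_mk, toL2_mkH1, wpartial_mkH1]
      have h1 := (norm_modeL2_le j m (toL2 u)).trans (norm_toL2_le u)
      have hb := one_le_br m
      have hx := xi_one_pos (N := N)
      have h2 : ∀ c : Coord N, ‖modeL2 j m (wpartial c u) +
          (Complex.I * xi N ((Pi.single j m : Modes N) c.1 c.2)) • modeL2 j m (toL2 u)‖
          ≤ (1 + xi N 1) * br m * ‖u‖ := by
        intro c
        refine (norm_add_le _ _).trans ?_
        rw [norm_smul, norm_mul, Complex.norm_I, one_mul, Complex.norm_real, Real.norm_eq_abs]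
        have h3 := (norm_modeL2_le j m (wpartial c u)).trans (norm_wpartial_le c u)
        have h4 := mul_le_mul (abs_xi_single_le j m c) h1 (norm_nonneg _) (by positivity)
        nlinarith [norm_nonneg u]
      have h5 := Finset.sum_le_sum (s := Finset.univ) fun c _ => h2 c
      rw [Finset.sum_const, Finset.card_univ, nsmul_eq_mul] at h5
      unfold modeBound
      nlinarith [norm_nonneg u]

@[simp] lemma toL2_modeH1 (j : Fin (N ^ 3)) (m : Fin 3 → ℤ) (u : H1 N) :
    toL2 (modeH1 j m u) = modeL2 j m (toL2 u) := rfl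

lemma wpartial_modeH1 (j : Fin (N ^ 3)) (m : Fin 3 → ℤ) (u : H1 N) (c : Coord N) :
    wpartial c (modeH1 j m u) = modeL2 j m (wpartial c u) +
          (Complex.I * xi N ((Pi.single j m : Modes N) c.1 c.2)) • modeL2 j m (toL2 u) := rfl

lemma norm_modeH1_le (j : Fin (N ^ 3)) (m : Fin 3 → ℤ) : ‖modeH1 (N := N) j m‖
    ≤ modeBound N * br m :=
  LinearMap.mkContinuous_norm_le _
    (mul_nonneg modeBound_pos.le (br_pos m).le) _

/-! ### Bounds for the densities -/

lemma hasSum_H1_sq (u : H1 N) :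
    HasSum (fun k => (1 + ksq k) * ‖fc k (toL2 u)‖ ^ 2) (‖u‖ ^ 2) := by
  have h := Complex.hasSum_re ((hb N).hasSum_inner_mul_inner u u)
  rw [inner_self_eq_norm_sq_to_K] at h
  convert! h using 2 with k
  · rw [hb_apply, ← inner_conj_symm, ← Complex.normSq_eq_conj_mul_self, Complex.ofReal_re,
      Complex.normSq_eq_norm_sq, inner_hnmode, norm_mul, Complex.norm_real, mul_pow,
      Real.norm_eq_abs, sq_abs, Real.sq_sqrt (by have := ksq_nonneg k; linarith)]
  · norm_cast

/-- A constant comparing the weights `br` with the wave numbers. -/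
def brBound (N : ℕ) : ℝ := 2 * (1 + 1 / xi N 1 ^ 2)

lemma brBound_pos : 0 < brBound N := by
  have := xi_one_pos (N := N); unfold brBound; positivity

/-- `supAbs` is attained at one coordinate, whose squared frequency is a single summand of `ksq`. So
the weight of each one-electron index is controlled by the H¹ weight. -/
lemma br_sq_le (k : Modes N) (j : Fin (N ^ 3)) : br (k j) ^ 2 ≤ brBound N * (1 + ksq k) := by
  have hx := xi_one_pos (N := N)
  obtain ⟨i, _, hi⟩ := Finset.exists_mem_eq_sup (Finset.univ : Finset (Fin 3)) ⟨0, by simp⟩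
    fun i => (k j i).natAbs
  have h1 : (supAbs (k j) : ℝ) ^ 2 = (k j i : ℝ) ^ 2 := by
    rw [supAbs, hi, Nat.cast_natAbs, Int.cast_abs, sq_abs]
  have h2 : xi N (k j i) ^ 2 ≤ ksq k :=
    Finset.single_le_sum (f := fun c : Coord N => xi N (k c.1 c.2) ^ 2) (fun _ _ => sq_nonneg _)
      (Finset.mem_univ (j, i))
  rw [xi_eq, mul_pow, ← h1] at h2
  have h3 : (supAbs (k j) : ℝ) ^ 2 ≤ 1 / xi N 1 ^ 2 * ksq k := by
    rw [one_div, ← div_eq_inv_mul, le_div_iff₀ (by positivity)]; linarith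
  have h4 : br (k j) ^ 2 ≤ 2 * (1 + (supAbs (k j) : ℝ) ^ 2) := by
    unfold br; nlinarith [sq_nonneg ((supAbs (k j) : ℝ) - 1)]
  have h5 := ksq_nonneg k
  have h6 : 0 ≤ 1 / xi N 1 ^ 2 := by positivity
  unfold brBound
  nlinarith

/-- The Schur kernel. -/
def schurK (ζ η : Fin 3 → ℤ) : ℝ := √(br ζ) * (1 / (br η ^ 2 * √(br η) * br (ζ - η)))

lemma schurK_nonneg (ζ η : Fin 3 → ℤ) : 0 ≤ schurK ζ η := by
  have := br_pos η; have := br_pos (ζ - η); unfold schurK; positivity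

lemma sum_schurK_le (s : Finset (Fin 3 → ℤ)) (ζ : Fin 3 → ℤ) :
    ∑ η ∈ s, schurK ζ η ≤ 1000 := by
  unfold schurK
  rw [← Finset.mul_sum]
  have h : 0 < √(br ζ) := Real.sqrt_pos.2 (br_pos ζ)
  refine (mul_le_mul_of_nonneg_left (schur_sum_le s ζ) h.le).trans (le_of_eq ?_)
  field_simp

/-- The pointwise form of Schur's test. With p² = ⟨ζ⟩ and q² = ⟨η⟩ the difference of the two sides
is a positive multiple of (p⁵a − q⁵b)²; these powers are the ones for which the row sums of `schurK`
are bounded. -/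
lemma schur_amgm (ζ η : Fin 3 → ℤ) (a b : ℝ) :
    1 / br (ζ - η) * (a * b) ≤
      1 / 2 * ((br ζ * a) ^ 2 * schurK ζ η + (br η * b) ^ 2 * schurK η ζ) := by
  have hz := br_pos ζ
  have he := br_pos η
  have hd := br_pos (ζ - η)
  have hde : br (η - ζ) = br (ζ - η) := by rw [← br_neg, neg_sub]
  obtain ⟨p, hp, hp2⟩ : ∃ p, 0 < p ∧ p ^ 2 = br ζ :=
    ⟨√(br ζ), Real.sqrt_pos.2 hz, Real.sq_sqrt hz.le⟩
  obtain ⟨q, hq, hq2⟩ : ∃ q, 0 < q ∧ q ^ 2 = br η :=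
    ⟨√(br η), Real.sqrt_pos.2 he, Real.sq_sqrt he.le⟩
  unfold schurK
  rw [hde, ← hp2, ← hq2, Real.sqrt_sq hp.le, Real.sqrt_sq hq.le]
  have : 1 / 2 * ((p ^ 2 * a) ^ 2 * (p * (1 / ((q ^ 2) ^ 2 * q * br (ζ - η)))) +
      (q ^ 2 * b) ^ 2 * (q * (1 / ((p ^ 2) ^ 2 * p * br (ζ - η))))) - 1 / br (ζ - η) * (a * b)
      = 1 / (2 * br (ζ - η) * p ^ 5 * q ^ 5) * (p ^ 5 * a - q ^ 5 * b) ^ 2 := by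
    field_simp
    ring
  have h2 : 0 ≤ 1 / (2 * br (ζ - η) * p ^ 5 * q ^ 5) * (p ^ 5 * a - q ^ 5 * b) ^ 2 := by
    positivity
  linarith

/-- The Fourier integral `∫ f̄ e^{-i ξ x_j} g`. -/
def bil (j : Fin (N ^ 3)) (m : Fin 3 → ℤ) (f g : H1 N) : ℂ :=
  inner ℂ (modeL2 j m (toL2 f)) (toL2 g)

lemma summable_weighted (j : Fin (N ^ 3)) (u : H1 N) :
    Summable (fun k : Modes N => (br (k j) * ‖fc k (toL2 u)‖) ^ 2) ∧
    ∑' k : Modes N, (br (k j) * ‖fc k (toL2 u)‖) ^ 2 ≤ brBound N * ‖u‖ ^ 2 := by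
  have h := (hasSum_H1_sq u).mul_left (brBound N)
  have hle : ∀ k : Modes N, (br (k j) * ‖fc k (toL2 u)‖) ^ 2
      ≤ brBound N * ((1 + ksq k) * ‖fc k (toL2 u)‖ ^ 2) := by
    intro k
    rw [mul_pow, ← mul_assoc]
    exact mul_le_mul_of_nonneg_right (br_sq_le k j) (by positivity)
  have hs := Summable.of_nonneg_of_le (fun _ => sq_nonneg _) hle h.summable
  exact ⟨hs, (hs.tsum_le_tsum hle h.summable).trans_eq h.tsum_eq⟩

/-- By Parseval, `bil j m f g` correlates the coefficient of f at k, shifted by m in slot j, with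
that of g at k. `schur_amgm` with ζ = k_j − m and η = k_j splits each product into an f-part and a
g-part, and the sum over m at fixed k then meets only row sums of the Schur kernel. -/
lemma sum_bil_le_add (j : Fin (N ^ 3)) (f g : H1 N) (s : Finset (Fin 3 → ℤ)) :
    ∑ m ∈ s, 1 / br m * ‖bil j m f g‖ ≤ 500 * brBound N * (‖f‖ ^ 2 + ‖g‖ ^ 2) := by
  classical
  set A : Modes N → ℝ := fun k => (br (k j) * ‖fc k (toL2 f)‖) ^ 2 with hA
  set B : Modes N → ℝ := fun k => (br (k j) * ‖fc k (toL2 g)‖) ^ 2 with hB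
  obtain ⟨hAs, hAt⟩ := summable_weighted j f
  obtain ⟨hBs, hBt⟩ := summable_weighted j g
  have hK1 : ∀ ζ η, schurK ζ η ≤ 1000 := fun ζ η => by
    simpa using sum_schurK_le {η} ζ
  -- the two majorants
  have hS1 : ∀ m, Summable fun k : Modes N => A k * schurK (k j) (k j + m) := fun m =>
    Summable.of_nonneg_of_le (fun k => mul_nonneg (sq_nonneg _) (schurK_nonneg _ _))
      (fun k => mul_le_mul_of_nonneg_left (hK1 _ _) (sq_nonneg _)) (hAs.mul_right 1000)
  have hS2 : ∀ m, Summable fun k : Modes N => B k * schurK (k j) (k j - m) := fun m =>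
    Summable.of_nonneg_of_le (fun k => mul_nonneg (sq_nonneg _) (schurK_nonneg _ _))
      (fun k => mul_le_mul_of_nonneg_left (hK1 _ _) (sq_nonneg _)) (hBs.mul_right 1000)
  have hterm : ∀ m, 1 / br m * ‖bil j m f g‖ ≤
      1 / 2 * (∑' k : Modes N, A k * schurK (k j) (k j + m) +
        ∑' k : Modes N, B k * schurK (k j) (k j - m)) := by
    intro m
    have hbr := br_pos m
    -- The f-majorant is needed at the index k shifted by m in slot j; the shift is a bijection and
    -- does not change its total sum.
    set sh : Modes N ≃ Modes N := Equiv.subRight (Pi.single j m) with hsh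
    have e1 : ∀ k : Modes N, A (sh k) * schurK (sh k j) (sh k j + m)
        = (br (k j - m) * ‖fc (k - Pi.single j m) (toL2 f)‖) ^ 2 * schurK (k j - m) (k j) := by
      intro k
      simp only [hA, hsh, Equiv.subRight_apply, Pi.sub_apply, Pi.single_eq_same, sub_add_cancel]
    have hS1' := (sh.summable_iff (f := fun k => A k * schurK (k j) (k j + m))).2 (hS1 m)
    have hT1 := sh.tsum_eq (fun k => A k * schurK (k j) (k j + m))
    have hsum := (hS1'.add (hS2 m)).mul_left (1 / 2 : ℝ)
    have hle : ∀ k : Modes N,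
        ‖star (fc k (modeL2 j m (toL2 f))) * fc k (toL2 g)‖ ≤
        br m * (1 / 2 * (((fun k => A k * schurK (k j) (k j + m)) ∘ sh) k +
          B k * schurK (k j) (k j - m))) := by
      intro k
      have h1 := schur_amgm (k j - m) (k j) ‖fc (k - Pi.single j m) (toL2 f)‖ ‖fc k (toL2 g)‖
      rw [sub_sub_cancel_left, br_neg] at h1
      rw [Function.comp_apply, e1, fc_modeL2, norm_mul, norm_star]
      rw [one_div, inv_mul_le_iff₀ hbr] at h1
      exact h1
    have h3 := hasSum_fc_inner (modeL2 j m (toL2 f)) (toL2 g)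
    have h4 : ‖bil j m f g‖ ≤ br m * (1 / 2 * (∑' k : Modes N, A k * schurK (k j) (k j + m) +
        ∑' k : Modes N, B k * schurK (k j) (k j - m))) := by
      have h5 := tsum_of_norm_bounded (hsum.mul_left (br m)).hasSum hle
      rw [h3.tsum_eq] at h5
      refine h5.trans (le_of_eq ?_)
      rw [tsum_mul_left, tsum_mul_left, hS1'.tsum_add (hS2 m), ← hT1]
      rfl
    rw [one_div, inv_mul_le_iff₀ hbr]
    exact h4
  refine (Finset.sum_le_sum fun m _ => hterm m).trans ?_
  rw [← Finset.mul_sum, Finset.sum_add_distrib]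
  have hfin1 : ∑ m ∈ s, ∑' k : Modes N, A k * schurK (k j) (k j + m)
      ≤ 1000 * (brBound N * ‖f‖ ^ 2) := by
    rw [← Summable.tsum_finsetSum fun m _ => hS1 m]
    refine le_trans ?_ (mul_le_mul_of_nonneg_left hAt (by norm_num))
    rw [← tsum_mul_left]
    refine (summable_sum fun m _ => hS1 m).tsum_le_tsum (fun k => ?_) (hAs.mul_left 1000)
    rw [← Finset.mul_sum, mul_comm]
    refine mul_le_mul_of_nonneg_right ?_ (sq_nonneg _)
    rw [← Finset.sum_image (f := fun η => schurK (k j) η) (s := s) (g := fun m => k j + m)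
      (fun a _ b _ h => add_left_cancel h)]
    exact sum_schurK_le _ _
  have hfin2 : ∑ m ∈ s, ∑' k : Modes N, B k * schurK (k j) (k j - m)
      ≤ 1000 * (brBound N * ‖g‖ ^ 2) := by
    rw [← Summable.tsum_finsetSum fun m _ => hS2 m]
    refine le_trans ?_ (mul_le_mul_of_nonneg_left hBt (by norm_num))
    rw [← tsum_mul_left]
    refine (summable_sum fun m _ => hS2 m).tsum_le_tsum (fun k => ?_) (hBs.mul_left 1000)
    rw [← Finset.mul_sum, mul_comm]
    refine mul_le_mul_of_nonneg_right ?_ (sq_nonneg _)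
    rw [← Finset.sum_image (f := fun η => schurK (k j) η) (s := s) (g := fun m => k j - m)
      (fun a _ b _ h => sub_right_injective h)]
    exact sum_schurK_le _ _
  linarith

lemma bil_smul_smul (j : Fin (N ^ 3)) (m : Fin 3 → ℤ) (a b : ℂ) (f g : H1 N) :
    bil j m (a • f) (b • g) = star a * b * bil j m f g := by
  simp only [bil, map_smul, inner_smul_left, inner_smul_right, Complex.star_def]; ring

/-- The electronic densities of `H¹` functions have Coulomb potentials with gradient in the Wiener
algebra. -/
lemma sum_bil_le (j : Fin (N ^ 3)) (f g : H1 N) (s : Finset (Fin 3 → ℤ)) :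
    ∑ m ∈ s, 1 / br m * ‖bil j m f g‖ ≤ 1000 * brBound N * (‖f‖ * ‖g‖) := by
  rcases eq_or_ne f 0 with rfl | hf
  · simp [bil]
  rcases eq_or_ne g 0 with rfl | hg
  · simp [bil]
  have hf' := norm_pos_iff.2 hf
  have hg' := norm_pos_iff.2 hg
  -- Normalising both arguments turns the sum of squared norms into their product: 500 · (1 + 1) =
  -- 1000.
  have h := sum_bil_le_add j (((‖f‖⁻¹ : ℝ) : ℂ) • f) (((‖g‖⁻¹ : ℝ) : ℂ) • g) s
  have hn : ∀ u : H1 N, 0 < ‖u‖ → ‖((‖u‖⁻¹ : ℝ) : ℂ) • u‖ = 1 := by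
    intro u hu
    rw [norm_smul, Complex.norm_real, norm_inv, norm_norm, inv_mul_cancel₀ hu.ne']
  rw [hn f hf', hn g hg'] at h
  simp only [bil_smul_smul, norm_mul, norm_star, Complex.norm_real, norm_inv, norm_norm] at h
  have h2 : ∑ m ∈ s, 1 / br m * (‖f‖⁻¹ * ‖g‖⁻¹ * ‖bil j m f g‖)
      = ‖f‖⁻¹ * ‖g‖⁻¹ * ∑ m ∈ s, 1 / br m * ‖bil j m f g‖ := by
    rw [Finset.mul_sum]
    exact Finset.sum_congr rfl fun _ _ => by ring
  rw [h2, ← mul_inv, inv_mul_le_iff₀ (by positivity)] at h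
  linarith

lemma summable_bil (j : Fin (N ^ 3)) (f g : H1 N) :
    Summable fun m => 1 / br m * ‖bil j m f g‖ :=
  summable_of_sum_le (fun m => by have := br_pos m; positivity) (sum_bil_le j f g)

/-- Integration by parts in `H¹`. -/
lemma inner_wpartial_left (c : Coord N) (u v : H1 N) :
    inner ℂ (wpartial c u) (toL2 v) = -inner ℂ (toL2 u) (wpartial c v) := by
  refine (hasSum_fc_inner _ _).unique ?_
  convert! (hasSum_fc_inner (toL2 u) (wpartial c v)).neg using 2 with k
  rw [fc_wpartial, fc_wpartial]
  simp only [Complex.star_def, map_mul, Complex.conj_I, Complex.conj_ofReal]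
  ring

/-- Integration by parts: iξe^{iξx_j}f is the commutator of ∂ with the mode, applied to f, so one
power of |m| is paid for by a derivative on f or on g. This pointwise decay complements the weighted
summability of `sum_bil_le`. -/
lemma norm_bil_le (j : Fin (N ^ 3)) (m : Fin 3 → ℤ) (f g : H1 N) :
    br m * ‖bil j m f g‖ ≤ (1 + 2 / xi N 1) * (‖f‖ * ‖g‖) := by
  have hx := xi_one_pos (N := N)
  have h0 : ‖bil j m f g‖ ≤ ‖f‖ * ‖g‖ :=
    (norm_inner_le_norm _ _).trans (mul_le_mul ((norm_modeL2_le _ _ _).trans (norm_toL2_le f))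
      (norm_toL2_le g) (norm_nonneg _) (norm_nonneg _))
  obtain ⟨i, _, hi⟩ := Finset.exists_mem_eq_sup (Finset.univ : Finset (Fin 3)) ⟨0, by simp⟩
    fun i => (m i).natAbs
  have h1 : (supAbs m : ℝ) = |(m i : ℝ)| := by
    rw [supAbs, hi, Nat.cast_natAbs, Int.cast_abs]
  have h2 := wpartial_modeH1 j m f (j, i)
  have h3 : (Complex.I * xi N (m i)) • modeL2 j m (toL2 f)
      = wpartial (j, i) (modeH1 j m f) - modeL2 j m (wpartial (j, i) f) := by
    rw [h2, Pi.single_eq_same]; abel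
  have h4 : ‖inner ℂ ((Complex.I * xi N (m i)) • modeL2 j m (toL2 f)) (toL2 g)‖
      ≤ 2 * (‖f‖ * ‖g‖) := by
    rw [h3, inner_sub_left, inner_wpartial_left, toL2_modeH1]
    refine (norm_sub_le _ _).trans ?_
    rw [norm_neg]
    have h5 := (norm_inner_le_norm (𝕜 := ℂ) (modeL2 j m (toL2 f)) (wpartial (j, i) g)).trans
      (mul_le_mul ((norm_modeL2_le _ _ _).trans (norm_toL2_le f)) (norm_wpartial_le _ g)
        (norm_nonneg _) (norm_nonneg _))
    have h6 := (norm_inner_le_norm (𝕜 := ℂ) (modeL2 j m (wpartial (j, i) f)) (toL2 g)).trans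
      (mul_le_mul ((norm_modeL2_le _ _ _).trans (norm_wpartial_le _ f)) (norm_toL2_le g)
        (norm_nonneg _) (norm_nonneg _))
    linarith
  rw [inner_smul_left, norm_mul, RCLike.norm_conj, norm_mul, Complex.norm_I, one_mul,
    Complex.norm_real, Real.norm_eq_abs, xi_eq, abs_mul, abs_of_pos hx, ← h1] at h4
  change xi N 1 * supAbs m * ‖bil j m f g‖ ≤ _ at h4
  have h7 : (supAbs m : ℝ) * ‖bil j m f g‖ ≤ 2 / xi N 1 * (‖f‖ * ‖g‖) := by
    rw [div_mul_eq_mul_div, le_div_iff₀ hx]; linarith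
  unfold br
  linarith

/-! ### Fourier coefficients of smooth functions on the torus -/

/-- Lets continuity on the torus be read off from the periodic lift. -/
lemma isQuotientMap_toTorus : Topology.IsQuotientMap (toTorus N) := by
  have h : ∀ _ : Fin 3, IsOpenQuotientMap (fun s : ℝ => (s : AddCircle (N : ℝ))) :=
    fun _ => QuotientAddGroup.isOpenQuotientMap_mk
  have h1 : IsOpenMap (toTorus N) :=
    IsOpenMap.piMap (fun i => (h i).isOpenMap)
      (Filter.Eventually.of_forall fun i => (h i).surjective)
  have h2 : Continuous (toTorus N) :=
    continuous_pi fun i => (h i).continuous.comp (continuous_apply i)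
  have h3 : Function.Surjective (toTorus N) := by
    intro x
    choose y hy using fun i => (h i).surjective (x i)
    exact ⟨y, funext hy⟩
  exact h1.isQuotientMap h2 h3

lemma surjective_toTorus : Function.Surjective (toTorus N) := isQuotientMap_toTorus.surjective

lemma continuous_of_lift {f : Torus N → ℝ} (h : Continuous fun y => f (toTorus N y)) :
    Continuous f := isQuotientMap_toTorus.continuous_iff.2 h

lemma toTorus_add (y z : Fin 3 → ℝ) : toTorus N (y + z) = toTorus N y + toTorus N z := by
  ext i; simp [toTorus]

/-- Translation of the torus along a coordinate. -/
def torusShift (i : Fin 3) (s : ℝ) : Torus N := toTorus N (Pi.single i s)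

@[simp] lemma torusShift_zero (i : Fin 3) : torusShift i 0 = (0 : Torus N) := by
  ext; simp [torusShift, toTorus]

lemma torusShift_add (i : Fin 3) (s t : ℝ) :
    torusShift i (s + t) = (torusShift i s + torusShift i t : Torus N) := by
  rw [torusShift, Pi.single_add, toTorus_add]; rfl

lemma mode_torusShift (m : Fin 3 → ℤ) (i : Fin 3) (s : ℝ) :
    mode m (torusShift i s : Torus N) = Complex.exp (Complex.I * (xi N (m i) * s : ℝ)) := by
  rw [torusShift, mode_toTorus]
  congr 3
  rw [Finset.sum_eq_single i]
  · simp
  · intro j _ hj; simp [Pi.single_eq_of_ne hj]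
  · simp

/-- The partial derivatives of a `C^{n+1}` function on the torus exist and are `C^n`. -/
lemma exists_torus_partial (n : ℕ) (f : Torus N → ℝ)
    (hf : ContDiff ℝ (n + 1 : ℕ) fun y => f (toTorus N y)) (i : Fin 3) :
    ∃ g : Torus N → ℝ, (ContDiff ℝ n fun y => g (toTorus N y)) ∧
      ∀ x, HasDerivAt (fun s => f (x + torusShift i s)) (g x) 0 := by
  set F : (Fin 3 → ℝ) → ℝ := fun y => f (toTorus N y) with hF
  have hd : ∀ y, HasDerivAt (fun s => f (toTorus N y + torusShift i s))
      (fderiv ℝ F y (Pi.single i 1)) 0 := by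
    intro y
    have h1 : DifferentiableAt ℝ F y := hf.differentiable (by simp) y
    have h2 : HasDerivAt (fun s : ℝ => y + s • (Pi.single i (1 : ℝ) : Fin 3 → ℝ))
        (Pi.single i 1) 0 := by
      simpa using ((hasDerivAt_id (0 : ℝ)).smul_const (Pi.single i (1 : ℝ) : Fin 3 → ℝ)).const_add y
    have h3 : HasFDerivAt F (fderiv ℝ F y) (y + (0 : ℝ) • (Pi.single i (1 : ℝ) : Fin 3 → ℝ)) := by
      simpa using h1.hasFDerivAt
    have h4 := h3.comp_hasDerivAt (0 : ℝ) h2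
    refine h4.congr_of_eventuallyEq (Filter.Eventually.of_forall fun s => ?_)
    simp only [hF, Function.comp_apply, toTorus_add, torusShift]
    congr 3
    ext j
    rcases eq_or_ne j i with rfl | hj
    · simp
    · simp [Pi.single_eq_of_ne hj]
  refine ⟨fun x => deriv (fun s => f (x + torusShift i s)) 0, ?_, fun x => ?_⟩
  · have : (fun y => deriv (fun s => f (toTorus N y + torusShift i s)) 0)
        = fun y => fderiv ℝ F y (Pi.single i 1) := funext fun y => (hd y).deriv
    rw [this]
    exact (hf.fderiv_right (m := n) (by norm_cast)).clm_apply contDiff_const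
  · obtain ⟨y, rfl⟩ := surjective_toTorus x
    exact (hd y).differentiableAt.hasDerivAt

/-- The derivative of f e^{-iξ·x} along the i-th coordinate has mean zero. -/
lemma fourierCoef_partial {f g : Torus N → ℝ} (hf : Continuous f) (hg : Continuous g) (i : Fin 3)
    (h : ∀ x, HasDerivAt (fun s => f (x + torusShift i s)) (g x) 0) (m : Fin 3 → ℤ) :
    fourierCoef g m = Complex.I * xi N (m i) * fourierCoef f m := by
  let Fc : C(Torus N, ℂ) := ⟨fun x => (f x : ℂ) * star (mode m x), by fun_prop⟩
  let Gc : C(Torus N, ℂ) := ⟨fun x => (g x : ℂ) * star (mode m x), by fun_prop⟩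
  have hi : ∀ f : C(Torus N, ℂ), Integrable (fun x => f x) (volume : Measure (Torus N)) :=
    fun f => Integrable.of_bound f.continuous.measurable.aestronglyMeasurable ‖f‖
      (Filter.Eventually.of_forall f.norm_coe_le_norm)
  have h2 := integral_deriv_translation_eq_zero (volume : Measure (Torus N)) (torusShift i)
    (torusShift_zero i) (torusShift_add i) Fc
    (Gc + (-(Complex.I * xi N (m i))) • Fc) (fun x => by
      have h3 : HasDerivAt (fun s : ℝ => mode (-m) (x + torusShift i s))
          (-(Complex.I * xi N (m i)) * mode (-m) x) 0 := by
        simp only [mode_translate, mode_torusShift]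
        have h1 : HasDerivAt (fun s : ℝ => Complex.I * ((xi N ((-m) i) * s : ℝ) : ℂ))
            (Complex.I * xi N ((-m) i)) 0 := by
          have := ((hasDerivAt_id (0 : ℝ)).const_mul (xi N ((-m) i))).ofReal_comp
          simpa using this.const_mul Complex.I
        refine ((h1.cexp).const_mul (mode (-m) x)).congr_deriv ?_
        simp [xi_neg]; ring
      have h4 := ((h x).ofReal_comp).mul h3
      simp only [mode_neg] at h4
      refine h4.congr_deriv ?_
      simp [Fc, Gc]; ring)
  have h5 : ∫ x, (Gc + (-(Complex.I * xi N (m i))) • Fc) x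
      = (∫ x, Gc x) + -(Complex.I * xi N (m i)) * ∫ x, Fc x := by
    rw [← integral_const_mul, ← integral_add (hi Gc) ((hi Fc).const_mul _)]
    rfl
  rw [h5] at h2
  change _ * (∫ x, Gc x) = _ * (_ * ∫ x, Fc x)
  linear_combination ((N : ℂ) ^ 3)⁻¹ * h2

lemma integral_mode {m : Fin 3 → ℤ} (hm : m ≠ 0) : ∫ x : Torus N, mode m x = 0 := by
  obtain ⟨i, hi⟩ := Function.ne_iff.1 hm
  have hxi : xi N (m i) ≠ 0 := by
    rw [xi_eq]
    exact mul_ne_zero xi_one_pos.ne' (Int.cast_ne_zero.2 hi)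
  refine integral_character_eq_zero volume _ (torusShift i (Real.pi / xi N (m i)))
    (fun x => mode_translate m x _) ?_
  rw [mode_torusShift, mul_div_cancel₀ _ hxi, mul_comm, Complex.exp_pi_mul_I]
  norm_num

lemma volume_torus : volume.real (Set.univ : Set (Torus N)) = (N : ℝ) ^ 3 := by
  rw [Measure.real, volume_pi, Measure.pi_univ]
  simp [AddCircle.measure_univ]

lemma N_pos : (0 : ℝ) < N := (factPos N).out

/-- Bessel's inequality on the torus. -/
lemma summable_fourierCoef_sq {f : Torus N → ℝ} (hf : Continuous f) :
    Summable fun m => ‖fourierCoef f m‖ ^ 2 := by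
  classical
  let md : (Fin 3 → ℤ) → C(Torus N, ℂ) := fun m => ⟨mode m, continuous_mode m⟩
  let r : ℝ := √((N : ℝ) ^ 3)
  have hr : 0 < r := Real.sqrt_pos.2 (by have := N_pos (N := N); positivity)
  have hr2 : (r : ℂ) ^ 2 = (N : ℂ) ^ 3 := by
    rw [← Complex.ofReal_pow, Real.sq_sqrt (by have := N_pos (N := N); positivity)]; push_cast; rfl
  have hrc : (r : ℂ) ≠ 0 := by exact_mod_cast hr.ne'
  let F : C(Torus N, ℂ) := ⟨fun x => (f x : ℂ), by fun_prop⟩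
  let tl : C(Torus N, ℂ) → Lp ℂ 2 (volume : Measure (Torus N)) :=
    fun g => ContinuousMap.toLp 2 volume ℂ g
  have hin : ∀ g h : C(Torus N, ℂ), inner ℂ (tl g) (tl h) = ∫ x, h x * star (g x) := by
    intro g h
    rw [L2.inner_def]
    refine integral_congr_ae ?_
    filter_upwards [ContinuousMap.coeFn_toLp (p := 2) (𝕜 := ℂ) volume g,
      ContinuousMap.coeFn_toLp (p := 2) (𝕜 := ℂ) volume h] with x h1 h2
    rw [h1, h2]; rfl
  have hor : Orthonormal ℂ fun m => ((r : ℂ)⁻¹) • tl (md m) := by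
    rw [orthonormal_iff_ite]
    intro k l
    have h : inner ℂ (tl (md k)) (tl (md l)) = ∫ x : Torus N, mode (l - k) x := by
      rw [hin]
      refine integral_congr_ae (Filter.Eventually.of_forall fun x => ?_)
      simp only [md, ContinuousMap.coe_mk, sub_eq_add_neg, mode_add, mode_neg]
    rw [inner_smul_left, inner_smul_right, h]
    split_ifs with hkl
    · subst hkl
      simp only [sub_self, mode_zero, integral_const, volume_torus]
      simp only [map_inv₀, Complex.conj_ofReal, Complex.real_smul, mul_one]
      push_cast
      rw [← hr2]; field_simp
    · rw [integral_mode (sub_ne_zero.2 (Ne.symm hkl))]; simp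
  have hs := hor.inner_products_summable (tl F)
  refine (hs.mul_left (1 / r ^ 2)).congr fun m => ?_
  have : inner ℂ (((r : ℂ)⁻¹) • tl (md m)) (tl F) = r * fourierCoef f m := by
    rw [inner_smul_left, hin, fourierCoef, ← hr2]
    simp only [map_inv₀, Complex.conj_ofReal]
    change (r : ℂ)⁻¹ * (∫ x : Torus N, (f x : ℂ) * star (mode m x)) = _
    field_simp
  rw [this, norm_mul, Complex.norm_real, Real.norm_eq_abs, abs_of_pos hr]
  field_simp

lemma norm_fourierCoef_le {f : Torus N → ℝ} (hf : Continuous f) :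
    ∃ C, 0 ≤ C ∧ ∀ m, ‖fourierCoef f m‖ ≤ C := by
  obtain ⟨hs⟩ : Nonempty (Summable fun m => ‖fourierCoef f m‖ ^ 2) := ⟨summable_fourierCoef_sq hf⟩
  refine ⟨√(∑' m, ‖fourierCoef f m‖ ^ 2), Real.sqrt_nonneg _, fun m => ?_⟩
  exact Real.le_sqrt_of_sq_le (hs.le_tsum m fun _ _ => sq_nonneg _)

lemma waveSq_eq (m : Fin 3 → ℤ) : waveSq N m = ∑ i, xi N (m i) ^ 2 := rfl

/-- A nonzero m has `supAbs m ≥ 1`, hence `br m ≤ 2 * supAbs m`; this is where the division by 2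
comes from. -/
lemma waveSq_ge {m : Fin 3 → ℤ} (hm : m ≠ 0) : (xi N 1 / 2) ^ 2 * br m ^ 2 ≤ waveSq N m := by
  have hx := xi_one_pos (N := N)
  obtain ⟨i, _, hi⟩ := Finset.exists_mem_eq_sup (Finset.univ : Finset (Fin 3)) ⟨0, by simp⟩
    fun i => (m i).natAbs
  have h1 : (supAbs m : ℝ) ^ 2 = (m i : ℝ) ^ 2 := by
    rw [supAbs, hi, Nat.cast_natAbs, Int.cast_abs, sq_abs]
  have h2 : xi N (m i) ^ 2 ≤ waveSq N m :=
    Finset.single_le_sum (f := fun i => xi N (m i) ^ 2) (fun _ _ => sq_nonneg _)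
      (Finset.mem_univ i)
  rw [xi_eq, mul_pow, ← h1] at h2
  have h3 : 1 ≤ supAbs m := by
    by_contra h
    push Not at h
    refine hm (funext fun i => ?_)
    have := natAbs_le_supAbs m i
    simp only [Pi.zero_apply]; omega
  have h4 : (1 : ℝ) ≤ supAbs m := by exact_mod_cast h3
  have h5 : br m ^ 2 ≤ 4 * (supAbs m : ℝ) ^ 2 := by unfold br; nlinarith
  nlinarith [sq_nonneg (xi N 1)]

lemma waveSq_pos {m : Fin 3 → ℤ} (hm : m ≠ 0) : 0 < waveSq N m := by
  refine lt_of_lt_of_le ?_ (waveSq_ge hm)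
  have := xi_one_pos (N := N); have := br_pos m; positivity

lemma IsC2.continuous {σ : Torus N → ℝ} (hσ : IsC2 σ) : Continuous σ :=
  continuous_of_lift (ContDiff.continuous hσ)

/-- T sums the moduli of the coefficients of the three pure second derivatives of σ. These are
continuous, so Bessel's inequality makes the coefficients square summable, in particular bounded. -/
lemma exists_laplace_bound {σ : Torus N → ℝ} (hσ : IsC2 σ) :
    ∃ T : (Fin 3 → ℤ) → ℝ, (∀ m, waveSq N m * ‖fourierCoef σ m‖ ≤ T m) ∧
      (Summable fun m => T m ^ 2) ∧ ∃ C, ∀ m, T m ≤ C := by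
  have h1 : ∀ i, ∃ g : Torus N → ℝ, Continuous g ∧
      ∀ m, ‖fourierCoef g m‖ = xi N (m i) ^ 2 * ‖fourierCoef σ m‖ := by
    intro i
    obtain ⟨g, hg, hgd⟩ := exists_torus_partial 1 σ (by exact_mod_cast hσ) i
    obtain ⟨k, hk, hkd⟩ := exists_torus_partial 0 g (by exact_mod_cast hg) i
    have hgc := continuous_of_lift hg.continuous
    have hkc := continuous_of_lift hk.continuous
    refine ⟨k, hkc, fun m => ?_⟩
    rw [fourierCoef_partial hgc hkc i hkd, fourierCoef_partial hσ.continuous hgc i hgd]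
    simp only [norm_mul, Complex.norm_I, one_mul, Complex.norm_real, Real.norm_eq_abs]
    rw [← mul_assoc, abs_mul_abs_self]; ring
  choose g hgc hg using h1
  choose C hC0 hC using fun i => norm_fourierCoef_le (hgc i)
  refine ⟨fun m => ∑ i, ‖fourierCoef (g i) m‖, fun m => ?_, ?_, ∑ i, C i, fun m => ?_⟩
  · simp only [hg, ← Finset.sum_mul, waveSq_eq]; exact le_rfl
  · have h2 := (summable_sum fun i (_ : i ∈ Finset.univ) => summable_fourierCoef_sq (hgc i)).mul_left 3
    refine Summable.of_nonneg_of_le (fun _ => sq_nonneg _) (fun m => ?_) h2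
    have := sq_sum_le_card_mul_sum_sq (s := Finset.univ) (f := fun i => ‖fourierCoef (g i) m‖)
    simpa using this
  · exact Finset.sum_le_sum fun i _ => hC i m

/-- Dimension three enters here: |ξ|⁻² is square summable off zero because Σ ⟨m⟩⁻⁴ converges, and
|ξ|²σ̂ is square summable, so their product is summable. The zero mode is added separately. -/
lemma summable_sigma {σ : Torus N → ℝ} (hσ : IsC2 σ) : Summable fun m => ‖fourierCoef σ m‖ := by
  classical
  obtain ⟨T, hT, hTs, _⟩ := exists_laplace_bound hσ
  have hx := xi_one_pos (N := N)
  have h1 := (summable_br_pow_four.mul_left (1 / (xi N 1 / 2) ^ 4)).add hTs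
  have h2 : Summable fun m : Fin 3 → ℤ => if m = 0 then ‖fourierCoef σ m‖ else 0 :=
    summable_of_ne_finset_zero (s := {0}) fun m hm => by
      rw [if_neg (by simpa using hm)]
  refine Summable.of_nonneg_of_le (fun _ => norm_nonneg _) (fun m => ?_) (h2.add h1)
  have hb := br_pos m
  by_cases hm : m = 0
  · simp only [if_pos hm]
    have : 0 ≤ 1 / (xi N 1 / 2) ^ 4 * (1 / br m ^ 4) + T m ^ 2 := by positivity
    linarith
  · simp only [if_neg hm, zero_add]
    set w := (xi N 1 / 2) ^ 2 * br m ^ 2 with hw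
    have hw0 : 0 < w := by positivity
    have h3 : w * ‖fourierCoef σ m‖ ≤ T m :=
      (mul_le_mul_of_nonneg_right (waveSq_ge hm) (norm_nonneg _)).trans (hT m)
    have h4 : 1 / (xi N 1 / 2) ^ 4 * (1 / br m ^ 4) = (1 / w) ^ 2 := by
      rw [hw]; field_simp
    rw [h4]
    have h5 : ‖fourierCoef σ m‖ ≤ 1 / w * T m := by
      rw [one_div, ← div_eq_inv_mul, le_div_iff₀ hw0]; linarith
    nlinarith [sq_nonneg (1 / w - T m), sq_nonneg (1 / w + T m)]

lemma exists_sigma_bound {σ : Torus N → ℝ} (hσ : IsC2 σ) :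
    ∃ C, 0 ≤ C ∧ ∀ m, br m * ‖fourierCoef σ m‖ ≤ C := by
  obtain ⟨T, hT, _, C, hC⟩ := exists_laplace_bound hσ
  have hx := xi_one_pos (N := N)
  refine ⟨max ‖fourierCoef σ 0‖ (C / (xi N 1 / 2) ^ 2), le_max_of_le_left (norm_nonneg _),
    fun m => ?_⟩
  by_cases hm : m = 0
  · subst hm
    refine le_max_of_le_left ?_
    have h0 : supAbs (0 : Fin 3 → ℤ) = 0 := Nat.le_zero.1 (supAbs_le_iff.2 (by simp))
    simp [br, h0]
  · refine le_max_of_le_right ?_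
    have h3 := ((mul_le_mul_of_nonneg_right (waveSq_ge hm) (norm_nonneg _)).trans
      (hT m)).trans (hC m)
    rw [le_div_iff₀ (by positivity)]
    refine le_trans ?_ h3
    have h1 := one_le_br m
    have : br m ≤ br m ^ 2 := by nlinarith
    have h4 : 0 ≤ (xi N 1 / 2) ^ 2 * ‖fourierCoef σ m‖ := by positivity
    nlinarith [mul_le_mul_of_nonneg_left this h4]

/-! ### Fourier coefficients of the charge density -/

/-- The Fourier coefficients of the ionic density. -/
def ionC (σ : Torus N → ℝ) (q : IonPos N) (m : Fin 3 → ℤ) : ℂ :=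
  fourierCoef σ m * ∑ n, star (mode m (latticePt n + q n))

/-- The Fourier coefficients of the electronic density. -/
def elC (e : ℝ) (u : H1 N) (m : Fin 3 → ℤ) : ℂ :=
  -(e : ℂ) * ((N : ℂ) ^ 3)⁻¹ * ∑ j, bil j m u u

/-- The Fourier coefficients of the charge density. -/
def rhoC (e : ℝ) (σ : Torus N → ℝ) (u : H1 N) (q : IonPos N) (m : Fin 3 → ℤ) : ℂ :=
  ionC σ q m + elC e u m

lemma integrable_torus (f : C(Torus N, ℂ)) : Integrable (fun x => f x) (volume : Measure (Torus N)) :=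
  Integrable.of_bound f.continuous.measurable.aestronglyMeasurable ‖f‖
      (Filter.Eventually.of_forall f.norm_coe_le_norm)

lemma fourierCoef_translate (σ : Torus N → ℝ) (a : Torus N) (m : Fin 3 → ℤ) :
    fourierCoef (fun x => σ (x - a)) m = fourierCoef σ m * star (mode m a) := by
  have h := integral_add_right_eq_self (μ := (volume : Measure (Torus N)))
    (fun x => (σ (x - a) : ℂ) * star (mode m x)) a
  rw [fourierCoef, ← h]
  simp only [add_sub_cancel_right, mode_translate, star_mul', ← mul_assoc, integral_mul_const]
  rw [fourierCoef, mul_assoc]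

lemma continuous_ionDensity {σ : Torus N → ℝ} (hσ : Continuous σ) (q : IonPos N) :
    Continuous (ionDensity σ q) := by
  unfold ionDensity; fun_prop

lemma fourierCoef_ionDensity {σ : Torus N → ℝ} (hσ : Continuous σ) (q : IonPos N)
    (m : Fin 3 → ℤ) : fourierCoef (ionDensity σ q) m = ionC σ q m := by
  have h1 : ∀ n, fourierCoef σ m * star (mode m (latticePt n + q n))
      = fourierCoef (fun x => σ (x - (latticePt n + q n))) m := fun n =>
    (fourierCoef_translate σ _ m).symm
  rw [ionC, Finset.mul_sum, Finset.sum_congr rfl fun n _ => h1 n]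
  simp only [fourierCoef]
  rw [← Finset.mul_sum, ← integral_finsetSum]
  · congr 1
    refine integral_congr_ae (Filter.Eventually.of_forall fun x => ?_)
    simp only [ionDensity, Complex.ofReal_sum, Finset.sum_mul, sub_sub]
  · intro n _
    exact integrable_torus ⟨fun x => (σ (x - (latticePt n + q n)) : ℂ) * star (mode m x), by fun_prop⟩

/-- Splitting off one variable from the configuration space. -/
def glueEquiv (j : Fin (N ^ 3)) :
    (Torus N × ({i : Fin (N ^ 3) // i ≠ j} → Torus N)) ≃ᵐ Conf N :=
  ((MeasurableEquiv.funUnique {i : Fin (N ^ 3) // i = j} (Torus N)).symm.prodCongr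
    (MeasurableEquiv.refl _)).trans
    (MeasurableEquiv.piEquivPiSubtypeProd (fun _ : Fin (N ^ 3) => Torus N) (fun i => i = j)).symm

lemma glueEquiv_apply (j : Fin (N ^ 3)) (x : Torus N) (y : {i : Fin (N ^ 3) // i ≠ j} → Torus N) :
    glueEquiv j (x, y) = fun i => if h : i = j then x else y ⟨i, h⟩ := by
  funext i
  by_cases h : i = j
  · subst h
    simp [glueEquiv, MeasurableEquiv.piEquivPiSubtypeProd, Equiv.piEquivPiSubtypeProd]
    rfl
  · simp [glueEquiv, MeasurableEquiv.piEquivPiSubtypeProd, Equiv.piEquivPiSubtypeProd, h]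
    rfl

lemma measurePreserving_glueEquiv (j : Fin (N ^ 3)) :
    MeasurePreserving (glueEquiv (N := N) j) (volume.prod volume) volume := by
  refine MeasurePreserving.trans (μb := volume) (e := _) (e' := _) ?_ ?_
  · exact ((volume_preserving_funUnique {i : Fin (N ^ 3) // i = j} (Torus N)).symm _).prod
      (MeasurePreserving.id _)
  · convert! (volume_preserving_piEquivPiSubtypeProd (fun _ : Fin (N ^ 3) => Torus N)
      (fun i => i = j)).symm _

lemma integrable_sq (ψ : L2 N) : Integrable (fun z => ‖ψ z‖ ^ 2) (volume : Measure (Conf N)) :=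
  (Lp.memLp ψ).integrable_norm_pow (by norm_num)

lemma integrable_glue (j : Fin (N ^ 3)) (ψ : L2 N) :
    Integrable (fun p => ‖ψ (glueEquiv j p)‖ ^ 2)
      ((volume : Measure (Torus N)).prod
        (volume : Measure ({i : Fin (N ^ 3) // i ≠ j} → Torus N))) :=
  ((measurePreserving_glueEquiv j).integrable_comp_emb
    (glueEquiv j).measurableEmbedding).2 (integrable_sq ψ)

lemma integrable_marginal (j : Fin (N ^ 3)) (ψ : L2 N) :
    Integrable fun x : Torus N => ∫ y : ({i : Fin (N ^ 3) // i ≠ j} → Torus N),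
      ‖ψ (fun i => if h : i = j then x else y ⟨i, h⟩)‖ ^ 2 := by
  have := (integrable_glue j ψ).integral_prod_left
  simpa only [glueEquiv_apply] using this

/-- Fubini along `glueEquiv`: the mode depends on x_j alone and leaves the inner integral. -/
lemma integral_marginal_mode (j : Fin (N ^ 3)) (ψ : L2 N) (m : Fin 3 → ℤ) :
    ∫ x : Torus N, ((∫ y : ({i : Fin (N ^ 3) // i ≠ j} → Torus N),
      ‖ψ (fun i => if h : i = j then x else y ⟨i, h⟩)‖ ^ 2 : ℝ) : ℂ) * star (mode m x)
      = inner ℂ (modeL2 j m ψ) ψ := by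
  have hm : ∀ z : Conf N, cmode (Pi.single j m) z = mode m (z j) := by
    intro z
    rw [cmode_apply, Finset.prod_eq_single j, Pi.single_eq_same]
    · intro i _ hi; rw [Pi.single_eq_of_ne hi, mode_zero]
    · simp
  have h1 : inner ℂ (modeL2 j m ψ) ψ = ∫ z, ((‖ψ z‖ ^ 2 : ℝ) : ℂ) * star (mode m (z j)) := by
    rw [L2.inner_def]
    refine integral_congr_ae ?_
    filter_upwards [coeFn_mulL2 (cmode (Pi.single j m)) ψ] with z hz
    rw [modeL2, hz, hm, RCLike.inner_apply, map_mul, Complex.star_def, Complex.ofReal_pow]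
    linear_combination (starRingEnd ℂ (mode m (z j))) * (Complex.mul_conj' (ψ z))
  have hint : Integrable (fun z : Conf N => ((‖ψ z‖ ^ 2 : ℝ) : ℂ) * star (mode m (z j))) :=
    (integrable_sq ψ).ofReal.mul_bdd (c := 1)
      (by
        have : Continuous fun z : Conf N => star (mode m (z j)) := by fun_prop
        exact this.measurable.aestronglyMeasurable)
      (Filter.Eventually.of_forall fun z => by rw [norm_star, norm_mode])
  rw [h1, ← (measurePreserving_glueEquiv j).integral_comp (glueEquiv j).measurableEmbedding,
    integral_prod]
  · refine integral_congr_ae (Filter.Eventually.of_forall fun x => ?_)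
    simp only [glueEquiv_apply, dif_pos]
    rw [integral_mul_const, integral_complex_ofReal]
  · exact ((measurePreserving_glueEquiv j).integrable_comp_emb
      (glueEquiv j).measurableEmbedding).2 hint

lemma integrable_elDensity (e : ℝ) (ψ : L2 N) : Integrable (elDensity e ψ) := by
  unfold elDensity
  exact (integrable_finsetSum _ fun j _ => integrable_marginal j ψ).const_mul _

lemma integrable_mul_mode {f : Torus N → ℝ} (hf : Integrable f) (m : Fin 3 → ℤ) :
    Integrable fun x => (f x : ℂ) * star (mode m x) :=
  hf.ofReal.mul_bdd (c := 1)
    (by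
      have : Continuous fun z : Torus N => star (mode m z) := by fun_prop
      exact this.measurable.aestronglyMeasurable)
    (Filter.Eventually.of_forall fun z => by rw [norm_star, norm_mode])

lemma fourierCoef_elDensity (e : ℝ) (u : H1 N) (m : Fin 3 → ℤ) :
    fourierCoef (elDensity e (toL2 u)) m = elC e u m := by
  have h : ∀ x : Torus N, (elDensity e (toL2 u) x : ℂ) * star (mode m x)
      = -(e : ℂ) * ∑ j, ((∫ y : ({i : Fin (N ^ 3) // i ≠ j} → Torus N),
      ‖toL2 u (fun i => if h : i = j then x else y ⟨i, h⟩)‖ ^ 2 : ℝ) : ℂ) * star (mode m x) := by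
    intro x
    rw [elDensity, ← Finset.sum_mul]
    push_cast; ring
  rw [fourierCoef, integral_congr_ae (Filter.Eventually.of_forall h), integral_const_mul,
    integral_finsetSum _ fun j _ => integrable_mul_mode (integrable_marginal j _) m,
    Finset.sum_congr rfl fun j _ => integral_marginal_mode j _ m, elC]
  simp only [bil]; ring

lemma integrable_density (e : ℝ) {σ : Torus N → ℝ} (hσ : Continuous σ) (ψ : L2 N) (q : IonPos N) :
    Integrable (density e σ ψ q) := by
  have hc := continuous_ionDensity hσ q
  have h : Integrable (ionDensity σ q) := by
    rw [← integrableOn_univ]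
    exact hc.continuousOn.integrableOn_compact isCompact_univ
  exact h.add (integrable_elDensity e ψ)

lemma fourierCoef_density (e : ℝ) {σ : Torus N → ℝ} (hσ : Continuous σ) (u : H1 N) (q : IonPos N)
    (m : Fin 3 → ℤ) : fourierCoef (density e σ (toL2 u) q) m = rhoC e σ u q m := by
  rw [rhoC, ← fourierCoef_ionDensity hσ, ← fourierCoef_elDensity]
  simp only [fourierCoef]
  have hc := continuous_ionDensity hσ q
  have h : Integrable (ionDensity σ q) := by
    rw [← integrableOn_univ]
    exact hc.continuousOn.integrableOn_compact isCompact_univ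
  rw [← mul_add, ← integral_add (integrable_mul_mode h m)
    (integrable_mul_mode (integrable_elDensity e _) m)]
  congr 1
  refine integral_congr_ae (Filter.Eventually.of_forall fun x => ?_)
  simp only [density]; push_cast; ring

/-! ### The Coulomb energy in Fourier variables -/

/-- The Fourier multiplier of `(-Δ)⁻¹`. -/
def wgt (N : ℕ) (m : Fin 3 → ℤ) : ℝ := if m = 0 then 0 else 1 / waveSq N m

lemma wgt_nonneg (m : Fin 3 → ℤ) : 0 ≤ wgt N m := by
  unfold wgt
  split_ifs with h
  · exact le_rfl
  · exact (one_div_pos.2 (waveSq_pos h)).le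

/-- A constant comparing the multiplier of `(-Δ)⁻¹` with the weights `br`. -/
def wBound (N : ℕ) : ℝ := 1 / (xi N 1 / 2) ^ 2

lemma wBound_pos : 0 < wBound N := by
  have := xi_one_pos (N := N); unfold wBound; positivity

lemma wgt_le (m : Fin 3 → ℤ) : wgt N m ≤ wBound N * (1 / br m ^ 2) := by
  have h0 := xi_one_pos (N := N)
  have hb := br_pos m
  unfold wgt
  split_ifs with h
  · have := wBound_pos (N := N); positivity
  · rw [wBound, one_div_mul_one_div]
    exact one_div_le_one_div_of_le (by positivity) (waveSq_ge h)

lemma wgt_mul_br_le (m : Fin 3 → ℤ) : wgt N m * br m ≤ wBound N * (1 / br m) := by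
  have hb := br_pos m
  refine (mul_le_mul_of_nonneg_right (wgt_le m) hb.le).trans (le_of_eq ?_)
  field_simp

lemma wgt_le_div_br (m : Fin 3 → ℤ) : wgt N m ≤ wBound N * (1 / br m) := by
  refine le_trans ?_ (wgt_mul_br_le m)
  exact le_mul_of_one_le_right (wgt_nonneg m) (one_le_br m)

lemma norm_ionC_le (σ : Torus N → ℝ) (q : IonPos N) (m : Fin 3 → ℤ) :
    ‖ionC σ q m‖ ≤ Fintype.card (Lattice N) * ‖fourierCoef σ m‖ := by
  rw [ionC, norm_mul, mul_comm]
  refine mul_le_mul_of_nonneg_right ((norm_sum_le _ _).trans (le_of_eq ?_)) (norm_nonneg _)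
  simp [norm_mode]

lemma norm_elC_le (e : ℝ) (u : H1 N) (m : Fin 3 → ℤ) :
    ‖elC e u m‖ ≤ |e| * ((N : ℝ) ^ 3)⁻¹ * ∑ j, ‖bil j m u u‖ := by
  rw [elC, norm_mul]
  refine mul_le_mul (le_of_eq ?_) (norm_sum_le _ _) (norm_nonneg _)
    (by have := N_pos (N := N); positivity)
  simp

lemma summable_elC (e : ℝ) (u : H1 N) : Summable fun m => 1 / br m * ‖elC e u m‖ := by
  refine Summable.of_nonneg_of_le (fun m => by have := br_pos m; positivity) (fun m => ?_)
    ((summable_sum fun j (_ : j ∈ Finset.univ) => summable_bil j u u).mul_left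
      (|e| * ((N : ℝ) ^ 3)⁻¹))
  have hb := br_pos m
  refine (mul_le_mul_of_nonneg_left (norm_elC_le e u m) (by positivity)).trans (le_of_eq ?_)
  rw [← Finset.mul_sum]; ring

lemma summable_ionC {σ : Torus N → ℝ} (hσ : IsC2 σ) (q : IonPos N) :
    Summable fun m => ‖ionC σ q m‖ :=
  Summable.of_nonneg_of_le (fun _ => norm_nonneg _) (norm_ionC_le σ q)
    ((summable_sigma hσ).mul_left _)

lemma one_div_br_le_one (m : Fin 3 → ℤ) : 1 / br m ≤ 1 := by
  rw [div_le_one (br_pos m)]; exact one_le_br m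

lemma summable_rhoC (e : ℝ) {σ : Torus N → ℝ} (hσ : IsC2 σ) (u : H1 N) (q : IonPos N) :
    Summable fun m => 1 / br m * ‖rhoC e σ u q m‖ := by
  refine Summable.of_nonneg_of_le (fun m => by have := br_pos m; positivity) (fun m => ?_)
    ((summable_ionC hσ q).add (summable_elC e u))
  have hb := br_pos m
  rw [rhoC]
  refine (mul_le_mul_of_nonneg_left (norm_add_le _ _) (by positivity)).trans ?_
  rw [mul_add]
  have := mul_le_mul_of_nonneg_right (one_div_br_le_one m) (norm_nonneg (ionC σ q m))
  linarith

lemma summable_wgt_rhoC (e : ℝ) {σ : Torus N → ℝ} (hσ : IsC2 σ) (u : H1 N) (q : IonPos N) :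
    Summable fun m => wgt N m * ‖rhoC e σ u q m‖ := by
  refine Summable.of_nonneg_of_le (fun m => mul_nonneg (wgt_nonneg m) (norm_nonneg _)) (fun m => ?_)
    ((summable_rhoC e hσ u q).mul_left (wBound N))
  rw [← mul_assoc]
  exact mul_le_mul_of_nonneg_right (wgt_le_div_br m) (norm_nonneg _)

/-- The Coulomb energy in Fourier variables. -/
def coulomb (e : ℝ) (σ : Torus N → ℝ) (u : H1 N) (q : IonPos N) : ℝ :=
  1 / 2 * (N : ℝ) ^ 3 * ∑' m, wgt N m * ‖rhoC e σ u q m‖ ^ 2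

lemma greenOp_eq (ρ : Torus N → ℝ) (x : Torus N) :
    greenOp ρ x = ∑' m, (wgt N m : ℂ) * fourierCoef ρ m * mode m x := by
  refine tsum_congr fun m => ?_
  unfold wgt
  split_ifs with h
  · simp
  · push_cast; ring

/-- The density is used only as an integrable function. Since Σ |ξ|⁻² |ρ̂| converges, the Green
series may be integrated against it term by term. -/
lemma integral_density_greenOp (e : ℝ) {σ : Torus N → ℝ} (hσ : IsC2 σ) (u : H1 N) (q : IonPos N) :
    1 / 2 * (∫ x : Torus N, (density e σ (toL2 u) q x : ℂ) *
      greenOp (density e σ (toL2 u) q) x).re = coulomb e σ u q := by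
  set ρ := density e σ (toL2 u) q with hρ
  have hN := N_pos (N := N)
  have hint : Integrable ρ := integrable_density e hσ.continuous _ q
  have hmode : ∀ m, Integrable fun x => (ρ x : ℂ) * ((wgt N m : ℂ) * rhoC e σ u q m * mode m x) := by
    intro m
    have h1 := (integrable_mul_mode hint (-m)).const_mul ((wgt N m : ℂ) * rhoC e σ u q m)
    refine h1.congr (Filter.Eventually.of_forall fun x => ?_)
    simp only [mode_neg, star_star]; ring
  have hval : ∀ m, ∫ x, (ρ x : ℂ) * ((wgt N m : ℂ) * rhoC e σ u q m * mode m x)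
      = (((N : ℝ) ^ 3 * (wgt N m * ‖rhoC e σ u q m‖ ^ 2) : ℝ) : ℂ) := by
    intro m
    have h1 : ∫ x, (ρ x : ℂ) * mode m x = (N : ℂ) ^ 3 * star (rhoC e σ u q m) := by
      rw [← fourierCoef_density e hσ.continuous, fourierCoef, star_mul', Complex.star_def,
        ← integral_conj]
      have : (N : ℂ) ≠ 0 := by exact_mod_cast hN.ne'
      simp only [map_inv₀, map_pow, map_natCast, map_mul, Complex.conj_ofReal,
        Complex.conj_conj]
      field_simp
      rfl
    have h2 : ∫ x, (ρ x : ℂ) * ((wgt N m : ℂ) * rhoC e σ u q m * mode m x)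
        = (wgt N m : ℂ) * rhoC e σ u q m * ∫ x, (ρ x : ℂ) * mode m x := by
      rw [← integral_const_mul]
      exact integral_congr_ae (Filter.Eventually.of_forall fun x => by ring)
    rw [h2, h1]
    push_cast
    have h3 := Complex.mul_conj' (rhoC e σ u q m)
    rw [Complex.star_def]
    linear_combination (N : ℂ) ^ 3 * (wgt N m : ℂ) * h3
  have hsum : Summable fun m => ∫ x, ‖(ρ x : ℂ) * ((wgt N m : ℂ) * rhoC e σ u q m * mode m x)‖ := by
    refine ((summable_wgt_rhoC e hσ u q).mul_left (∫ x, ‖ρ x‖)).congr fun m => ?_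
    rw [← integral_mul_const]
    refine integral_congr_ae (Filter.Eventually.of_forall fun x => ?_)
    simp only [norm_mul, norm_mode, mul_one, Complex.norm_real]
    rw [Real.norm_of_nonneg (wgt_nonneg m)]
  have key := hasSum_integral_of_summable_integral_norm hmode hsum
  simp only [hval, tsum_mul_left] at key
  have h5 : (∫ x : Torus N, (ρ x : ℂ) * greenOp ρ x)
      = ∫ x, (ρ x : ℂ) * ∑' m, (wgt N m : ℂ) * rhoC e σ u q m * mode m x := by
    refine integral_congr_ae (Filter.Eventually.of_forall fun x => ?_)
    simp only [greenOp_eq, hρ, fourierCoef_density e hσ.continuous]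
  rw [h5, coulomb, ← tsum_mul_left, ← (Complex.hasSum_re key).tsum_eq, ← tsum_mul_left]
  refine tsum_congr fun m => ?_
  rw [Complex.ofReal_re]; ring

/-- The energy in Fourier variables. -/
lemma energy_eq (e M : ℝ) {σ : Torus N → ℝ} (hσ : IsC2 σ) (X : Phase N) :
    energy e M σ X = 1 / 2 * ∑ k : Coord N, ‖wpartial k X.1‖ ^ 2 + coulomb e σ X.1 X.2.1 +
      ∑ n : Lattice N, (∑ i, X.2.2 n i ^ 2) / (2 * M) := by
  rw [energy, integral_density_greenOp e hσ]

/-- The sign that makes the a priori bound possible, although electrons and ions attract each other.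
-/
lemma coulomb_nonneg (e : ℝ) (σ : Torus N → ℝ) (u : H1 N) (q : IonPos N) :
    0 ≤ coulomb e σ u q := by
  have := N_pos (N := N)
  exact mul_nonneg (by positivity)
    (tsum_nonneg fun m => mul_nonneg (wgt_nonneg m) (sq_nonneg _))

/-! ### The differential of the Coulomb energy -/

/-- The phase `ξ·κ(n)`. -/
def wdot (m : Fin 3 → ℤ) (n : Lattice N) : IonVec N →L[ℝ] ℝ :=
  ∑ i : Fin 3, xi N (m i) •
    ((ContinuousLinearMap.proj i : (Fin 3 → ℝ) →L[ℝ] ℝ) ∘L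
      (ContinuousLinearMap.proj n : IonVec N →L[ℝ] (Fin 3 → ℝ)))

lemma wdot_apply (m : Fin 3 → ℤ) (n : Lattice N) (κ : IonVec N) :
    wdot m n κ = ∑ i, xi N (m i) * κ n i := by
  simp [wdot]

lemma abs_wdot_le (m : Fin 3 → ℤ) (n : Lattice N) (κ : IonVec N) :
    |wdot m n κ| ≤ 3 * xi N 1 * br m * ‖κ‖ := by
  rw [wdot_apply]
  refine (Finset.abs_sum_le_sum_abs _ _).trans ?_
  have : ∀ i ∈ (Finset.univ : Finset (Fin 3)), |xi N (m i) * κ n i| ≤ xi N 1 * br m * ‖κ‖ := by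
    intro i _
    rw [abs_mul]
    have h1 : |κ n i| ≤ ‖κ‖ := (norm_le_pi_norm (κ n) i).trans (norm_le_pi_norm κ n)
    have := xi_one_pos (N := N); have := br_pos m
    exact mul_le_mul (abs_xi_le m i) h1 (abs_nonneg _) (by positivity)
  refine (Finset.sum_le_sum this).trans (le_of_eq ?_)
  simp; ring

/-- The phase factors of the ions. -/
def phs (m : Fin 3 → ℤ) (n : Lattice N) (κ : IonVec N) : ℂ :=
  star (mode m (latticePt n + toTorus N (κ n)))

lemma norm_phs (m : Fin 3 → ℤ) (n : Lattice N) (κ : IonVec N) : ‖phs m n κ‖ = 1 := by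
  rw [phs, norm_star, norm_mode]

lemma phs_eq (m : Fin 3 → ℤ) (n : Lattice N) (κ : IonVec N) :
    phs m n κ = star (mode m (latticePt n)) * Complex.exp (-Complex.I * (wdot m n κ : ℂ)) := by
  rw [phs, mode_translate, mode_toTorus, star_mul', wdot_apply]
  congr 1
  rw [Complex.star_def, ← Complex.exp_conj, map_mul, Complex.conj_I, Complex.conj_ofReal]

lemma hasFDerivAt_phs (m : Fin 3 → ℤ) (n : Lattice N) (κ : IonVec N) :
    HasFDerivAt (phs m n) ((-Complex.I * phs m n κ) •
      (Complex.ofRealCLM ∘L wdot m n : IonVec N →L[ℝ] ℂ)) κ := by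
  have h1 : HasFDerivAt (fun κ => (wdot m n κ : ℂ)) (Complex.ofRealCLM ∘L wdot m n) κ :=
    (Complex.ofRealCLM ∘L wdot m n).hasFDerivAt
  have h2 := ((h1.const_mul (-Complex.I)).cexp).const_mul (star (mode m (latticePt n)))
  have h3 : phs m n = fun κ => star (mode m (latticePt n)) *
    Complex.exp (-Complex.I * (wdot m n κ : ℂ)) := funext (phs_eq m n)
  rw [h3]
  refine h2.congr_fderiv ?_
  simp only [smul_smul]
  congr 1
  ring

lemma norm_phs_sub_le (m : Fin 3 → ℤ) (n : Lattice N) (κ κ' : IonVec N) :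
    ‖phs m n κ - phs m n κ'‖ ≤ 3 * xi N 1 * br m * ‖κ - κ'‖ := by
  have hs : ∀ κ'' , HasFDerivAt (phs m n) _ κ'' := fun κ'' => hasFDerivAt_phs (N := N) m n κ''
  have := Convex.norm_image_sub_le_of_norm_hasFDerivWithin_le (𝕜 := ℝ) (f := phs m n)
    (C := 3 * xi N 1 * br m) (s := Set.univ) (x := κ') (y := κ)
    (fun x _ => (hs x).hasFDerivWithinAt) (fun x _ => by
      have h0 := xi_one_pos (N := N); have h00 := br_pos m
      refine ContinuousLinearMap.opNorm_le_bound _ (by positivity) fun π => ?_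
      simp only [smul_apply, ContinuousLinearMap.comp_apply, smul_eq_mul,
        norm_mul, norm_neg, Complex.norm_I, norm_phs, one_mul, Complex.ofRealCLM_apply,
        Complex.norm_real]
      exact abs_wdot_le m n π) convex_univ trivial trivial
  exact this

/-- The Fourier coefficients of the charge density as functions of the lifted positions. -/
def rhoL (e : ℝ) (σ : Torus N → ℝ) (m : Fin 3 → ℤ) (Y : H1 N × IonVec N) : ℂ :=
  rhoC e σ Y.1 (toIonPos Y.2) m

lemma ionC_toIonPos (σ : Torus N → ℝ) (κ : IonVec N) (m : Fin 3 → ℤ) :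
    ionC σ (toIonPos κ) m = fourierCoef σ m * ∑ n, phs m n κ := rfl

/-- The differential of the Fourier coefficients of the charge density. -/
def dRho (e : ℝ) (σ : Torus N → ℝ) (m : Fin 3 → ℤ) (Y Z : H1 N × IonVec N) : ℂ :=
  fourierCoef σ m * (∑ n, -Complex.I * phs m n Y.2 * (wdot m n Z.2 : ℂ)) +
    -(e : ℂ) * ((N : ℂ) ^ 3)⁻¹ * ∑ j, (bil j m Y.1 Z.1 + bil j m Z.1 Y.1)

/-- `bil` is conjugate-linear in its first argument, so the differential is only real-linear. -/
lemma hasFDerivAt_bil (j : Fin (N ^ 3)) (m : Fin 3 → ℤ) (u : H1 N) :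
    ∃ L : H1 N →L[ℝ] ℂ, HasFDerivAt (fun u => bil j m u u) L u ∧
      ∀ h, L h = bil j m u h + bil j m h u := by
  have hA : HasFDerivAt (fun u : H1 N => modeL2 j m (toL2 u))
      (((modeL2 j m) ∘L toL2).restrictScalars ℝ) u :=
    (((modeL2 j m) ∘L toL2).restrictScalars ℝ).hasFDerivAt
  have hB : HasFDerivAt (fun u : H1 N => toL2 u) ((toL2 (N := N)).restrictScalars ℝ) u :=
    ((toL2 (N := N)).restrictScalars ℝ).hasFDerivAt
  exact ⟨_, hA.inner ℂ hB, fun h => by simp [bil]⟩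

lemma hasFDerivAt_rhoL (e : ℝ) (σ : Torus N → ℝ) (m : Fin 3 → ℤ) (Y : H1 N × IonVec N) :
    ∃ L : (H1 N × IonVec N) →L[ℝ] ℂ, HasFDerivAt (rhoL e σ m) L Y ∧
      ∀ Z, L Z = dRho e σ m Y Z := by
  choose B hB hB' using fun j => hasFDerivAt_bil j m Y.1
  have h1 : HasFDerivAt (fun Y : H1 N × IonVec N => fourierCoef σ m * ∑ n, phs m n Y.2) _ Y :=
    (HasFDerivAt.fun_sum fun n (_ : n ∈ Finset.univ) =>
      (hasFDerivAt_phs m n Y.2).comp Y hasFDerivAt_snd).const_mul (fourierCoef σ m)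
  have h2 : HasFDerivAt (fun Y : H1 N × IonVec N => -(e : ℂ) * ((N : ℂ) ^ 3)⁻¹ *
      ∑ j, bil j m Y.1 Y.1) _ Y :=
    (HasFDerivAt.fun_sum fun j (_ : j ∈ Finset.univ) =>
      (hB j).comp Y hasFDerivAt_fst).const_mul (-(e : ℂ) * ((N : ℂ) ^ 3)⁻¹)
  refine ⟨_, h1.add h2, fun Z => ?_⟩
  simp [dRho, hB']

lemma norm_elC_le_div (e : ℝ) (u v : H1 N) (m : Fin 3 → ℤ) :
    br m * ‖-(e : ℂ) * ((N : ℂ) ^ 3)⁻¹ * ∑ j, bil j m u v‖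
      ≤ |e| * ((N : ℝ) ^ 3)⁻¹ * ((N : ℝ) ^ 3 * ((1 + 2 / xi N 1) * (‖u‖ * ‖v‖))) := by
  have hN := N_pos (N := N)
  have h1 : br m * ‖∑ j, bil (N := N) j m u v‖ ≤ (N : ℝ) ^ 3 * ((1 + 2 / xi N 1) * (‖u‖ * ‖v‖)) := by
    refine (mul_le_mul_of_nonneg_left (norm_sum_le _ _) (br_pos m).le).trans ?_
    rw [Finset.mul_sum]
    refine (Finset.sum_le_sum fun j _ => norm_bil_le j m u v).trans (le_of_eq ?_)
    simp
  rw [norm_mul, norm_mul, norm_neg, norm_inv, norm_pow, Complex.norm_real, Complex.norm_natCast,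
    Real.norm_eq_abs, mul_left_comm]
  exact mul_le_mul_of_nonneg_left h1 (by positivity)

/-- Uniform bounds for the Fourier coefficients of the density and their differentials. -/
lemma exists_rhoL_bound (e : ℝ) {σ : Torus N → ℝ} (hσ : IsC2 σ) (R : ℝ) :
    ∃ C, 0 ≤ C ∧ ∀ (m : Fin 3 → ℤ) (Y : H1 N × IonVec N), ‖Y.1‖ ≤ R →
      br m * ‖rhoL e σ m Y‖ ≤ C ∧
      ∀ Z, ‖dRho e σ m Y Z‖ ≤ C * (1 / br m + br m * ‖fourierCoef σ m‖) * ‖Z‖ := by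
  obtain ⟨S, hS0, hS⟩ := exists_sigma_bound hσ
  have hN := N_pos (N := N)
  have hx := xi_one_pos (N := N)
  set K : ℝ := (Fintype.card (Lattice N) : ℝ) with hK
  have hK0 : 0 ≤ K := Nat.cast_nonneg _
  set A : ℝ := |e| * ((N : ℝ) ^ 3)⁻¹ * ((N : ℝ) ^ 3 * (1 + 2 / xi N 1)) with hA
  have hA0 : 0 ≤ A := by positivity
  refine ⟨K * S + A * R ^ 2 + K * (3 * xi N 1) + 2 * A * |R|, by positivity, fun m Y hY => ?_⟩
  have hb := br_pos m
  have hR : 0 ≤ R := (norm_nonneg _).trans hY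
  have hY2 : ‖Y.1‖ * ‖Y.1‖ ≤ R ^ 2 := by nlinarith [norm_nonneg Y.1]
  constructor
  · have h1 := mul_le_mul_of_nonneg_left (norm_ionC_le σ (toIonPos Y.2) m) hb.le
    have h2 := norm_elC_le_div e Y.1 Y.1 m
    have h3 : br m * ‖rhoL e σ m Y‖ ≤ br m * ‖ionC σ (toIonPos Y.2) m‖ + br m * ‖elC e Y.1 m‖ := by
      rw [← mul_add]; exact mul_le_mul_of_nonneg_left (norm_add_le _ _) hb.le
    have h4 : br m * (K * ‖fourierCoef σ m‖) ≤ K * S := by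
      rw [mul_left_comm]; exact mul_le_mul_of_nonneg_left (hS m) hK0
    have h5 : |e| * ((N : ℝ) ^ 3)⁻¹ * ((N : ℝ) ^ 3 * ((1 + 2 / xi N 1) * (‖Y.1‖ * ‖Y.1‖)))
        ≤ A * R ^ 2 := by
      rw [hA]
      refine le_trans (le_of_eq ?_) (mul_le_mul_of_nonneg_left hY2 hA0)
      ring
    have h6 : 0 ≤ K * (3 * xi N 1) + 2 * A * |R| := by positivity
    unfold elC at h3
    linarith
  · intro Z
    have hZ1 : ‖Z.1‖ ≤ ‖Z‖ := norm_fst_le Z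
    have hZ2 : ‖Z.2‖ ≤ ‖Z‖ := norm_snd_le Z
    have hs0 := norm_nonneg (fourierCoef σ m)
    have h1 : ‖fourierCoef σ m * ∑ n, -Complex.I * phs m n Y.2 * (wdot m n Z.2 : ℂ)‖
        ≤ K * (3 * xi N 1) * (br m * ‖fourierCoef σ m‖) * ‖Z‖ := by
      rw [norm_mul]
      have h2 : ‖∑ n, -Complex.I * phs m n Y.2 * (wdot m n Z.2 : ℂ)‖
          ≤ K * (3 * xi N 1 * br m * ‖Z‖) := by
        have h3 : ∀ n ∈ (Finset.univ : Finset (Lattice N)),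
            ‖-Complex.I * phs m n Y.2 * (wdot m n Z.2 : ℂ)‖ ≤ 3 * xi N 1 * br m * ‖Z‖ := by
          intro n _
          simp only [norm_mul, norm_neg, Complex.norm_I, norm_phs, one_mul, Complex.norm_real]
          exact (abs_wdot_le m n Z.2).trans (mul_le_mul_of_nonneg_left hZ2 (by positivity))
        refine (norm_sum_le _ _).trans ((Finset.sum_le_sum h3).trans (le_of_eq ?_))
        rw [Finset.sum_const, Finset.card_univ, nsmul_eq_mul]
      refine (mul_le_mul_of_nonneg_left h2 hs0).trans (le_of_eq (by ring))
    have h3 : ‖-(e : ℂ) * ((N : ℂ) ^ 3)⁻¹ * ∑ j, (bil j m Y.1 Z.1 + bil j m Z.1 Y.1)‖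
        ≤ 2 * A * R * (1 / br m) * ‖Z‖ := by
      rw [Finset.sum_add_distrib, mul_add]
      have h4 := norm_elC_le_div e Y.1 Z.1 m
      have h5 := norm_elC_le_div e Z.1 Y.1 m
      have h6 : ‖Y.1‖ * ‖Z.1‖ ≤ R * ‖Z‖ := mul_le_mul hY hZ1 (norm_nonneg _) hR
      have h7 : |e| * ((N : ℝ) ^ 3)⁻¹ * ((N : ℝ) ^ 3 * ((1 + 2 / xi N 1) * (‖Y.1‖ * ‖Z.1‖)))
          ≤ A * (R * ‖Z‖) := by
        refine le_trans (le_of_eq ?_) (mul_le_mul_of_nonneg_left h6 hA0)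
        ring
      rw [mul_comm ‖Z.1‖ ‖Y.1‖] at h5
      have h8 := norm_add_le (-(e : ℂ) * ((N : ℂ) ^ 3)⁻¹ * ∑ j, bil j m Y.1 Z.1)
        (-(e : ℂ) * ((N : ℂ) ^ 3)⁻¹ * ∑ j, bil j m Z.1 Y.1)
      have h9 : 2 * A * R * (1 / br m) * ‖Z‖ = 2 * (A * (R * ‖Z‖)) / br m := by ring
      rw [h9, le_div_iff₀ hb]
      nlinarith
    have h4 := (norm_add_le _ _).trans (add_le_add h1 h3)
    refine h4.trans ?_
    rw [abs_of_nonneg hR, ← add_mul]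
    refine mul_le_mul_of_nonneg_right ?_ (norm_nonneg _)
    have h5 : 0 ≤ 1 / br m := by positivity
    have h6 : 0 ≤ br m * ‖fourierCoef σ m‖ := by positivity
    have h7 : 0 ≤ K * S := by positivity
    have h8 : 0 ≤ A * R ^ 2 := by positivity
    have h9 : 0 ≤ K * (3 * xi N 1) := by positivity
    have h10 : 0 ≤ 2 * A * R := by positivity
    have e1 : (K * S + A * R ^ 2 + K * (3 * xi N 1) + 2 * A * R) *
        (1 / br m + br m * ‖fourierCoef σ m‖) = (K * S + A * R ^ 2) * (1 / br m + br m * ‖fourierCoef σ m‖)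
        + K * (3 * xi N 1) * (1 / br m) + 2 * A * R * (br m * ‖fourierCoef σ m‖)
        + K * (3 * xi N 1) * (br m * ‖fourierCoef σ m‖) + 2 * A * R * (1 / br m) := by ring
    rw [e1]
    have g1 : 0 ≤ (K * S + A * R ^ 2) * (1 / br m + br m * ‖fourierCoef σ m‖) := by positivity
    have g2 : 0 ≤ K * (3 * xi N 1) * (1 / br m) := by positivity
    have g3 : 0 ≤ 2 * A * R * (br m * ‖fourierCoef σ m‖) := by positivity
    linarith

/-- The differential of the terms of the Coulomb energy. -/
def dTerm (e : ℝ) (σ : Torus N → ℝ) (m : Fin 3 → ℤ) (Y Z : H1 N × IonVec N) : ℝ :=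
  wgt N m * (star (rhoL e σ m Y) * dRho e σ m Y Z).re

lemma hasFDerivAt_coulombTerm (e : ℝ) (σ : Torus N → ℝ) (m : Fin 3 → ℤ) (Y : H1 N × IonVec N) :
    ∃ L : (H1 N × IonVec N) →L[ℝ] ℝ,
      HasFDerivAt (fun Y => wgt N m * ‖rhoL e σ m Y‖ ^ 2) L Y ∧ ∀ Z, L Z = 2 * dTerm e σ m Y Z := by
  obtain ⟨L, hL, hL'⟩ := hasFDerivAt_rhoL e σ m Y
  refine ⟨_, hL.norm_sq.const_mul (wgt N m), fun Z => ?_⟩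
  have h : inner ℝ (rhoL e σ m Y) (L Z) = (star (rhoL e σ m Y) * dRho e σ m Y Z).re := by
    rw [hL', Complex.inner, Complex.star_def, mul_comm]
  have h2 : (wgt N m • (2 • (innerSL ℝ (rhoL e σ m Y)).comp L)) Z
      = wgt N m * (2 • inner ℝ (rhoL e σ m Y) (L Z)) := rfl
  rw [h2, h, dTerm, nsmul_eq_mul]
  push_cast
  ring

/-- Counting powers of ⟨m⟩: the Green multiplier gives −2, the density −1, its differential −1 from
the electrons and +1 times |σ̂| from the ions. The totals ⟨m⟩⁻⁴ and ⟨m⟩⁻²|σ̂| are summable,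
uniformly for bounded wave functions and arbitrary positions. -/
lemma exists_dTerm_bound (e : ℝ) {σ : Torus N → ℝ} (hσ : IsC2 σ) (R : ℝ) :
    ∃ C, 0 ≤ C ∧ ∀ (m : Fin 3 → ℤ) (Y Z : H1 N × IonVec N), ‖Y.1‖ ≤ R →
      |dTerm e σ m Y Z| ≤ C * (1 / br m ^ 4 + ‖fourierCoef σ m‖) * ‖Z‖ := by
  obtain ⟨C, hC0, hC⟩ := exists_rhoL_bound e hσ R
  have hw := wBound_pos (N := N)
  refine ⟨wBound N * C ^ 2, by positivity, fun m Y Z hY => ?_⟩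
  have hb := br_pos m
  obtain ⟨c1, c2⟩ := hC m Y hY
  rw [dTerm, abs_mul, abs_of_nonneg (wgt_nonneg m)]
  set s := ‖fourierCoef σ m‖ with hs
  have hs0 : 0 ≤ s := norm_nonneg _
  have h1 : |(star (rhoL e σ m Y) * dRho e σ m Y Z).re| ≤ ‖rhoL e σ m Y‖ * ‖dRho e σ m Y Z‖ := by
    refine (Complex.abs_re_le_norm _).trans ?_
    rw [norm_mul, norm_star]
  have h2 : ‖rhoL e σ m Y‖ ≤ C * (1 / br m) := by
    rw [mul_one_div, le_div_iff₀ hb]; linarith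
  have h3 : ‖rhoL e σ m Y‖ * ‖dRho e σ m Y Z‖ ≤ C * (1 / br m) * (C * (1 / br m + br m * s) * ‖Z‖) :=
    mul_le_mul h2 (c2 Z) (norm_nonneg _) (by positivity)
  refine (mul_le_mul (wgt_le m) (h1.trans h3) (abs_nonneg _) (by positivity)).trans ?_
  have h5 : wBound N * (1 / br m ^ 2) * (C * (1 / br m) * (C * (1 / br m + br m * s) * ‖Z‖))
      = wBound N * C ^ 2 * (1 / br m ^ 4 + 1 / br m ^ 2 * s) * ‖Z‖ := by
    field_simp
  rw [h5]
  have h6 : 1 / br m ^ 2 ≤ 1 := by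
    rw [div_le_one (by positivity)]; nlinarith [one_le_br m]
  gcongr
  exact mul_le_of_le_one_left hs0 h6

lemma summable_wgt_rhoL_sq (e : ℝ) {σ : Torus N → ℝ} (hσ : IsC2 σ) (Y : H1 N × IonVec N) :
    Summable fun m => wgt N m * ‖rhoL e σ m Y‖ ^ 2 := by
  obtain ⟨C, hC0, hC⟩ := exists_rhoL_bound e hσ ‖Y.1‖
  refine Summable.of_nonneg_of_le (fun m => mul_nonneg (wgt_nonneg m) (sq_nonneg _)) (fun m => ?_)
    ((summable_wgt_rhoC e hσ Y.1 (toIonPos Y.2)).mul_right C)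
  rw [mul_assoc]
  refine mul_le_mul_of_nonneg_left ?_ (wgt_nonneg m)
  have h1 := (hC m Y le_rfl).1
  have h2 : ‖rhoL e σ m Y‖ ≤ C := le_trans (le_mul_of_one_le_left (norm_nonneg _) (one_le_br m)) h1
  rw [sq]
  exact mul_le_mul_of_nonneg_left h2 (norm_nonneg _)

/-- Termwise differentiation of a series of functions. -/
lemma exists_hasFDerivAt_tsum {P ι : Type*} [NormedAddCommGroup P] [NormedSpace ℝ P]
    (f : ι → P → ℝ) (L : ι → P → P →L[ℝ] ℝ) (d : ι → P → P → ℝ) (b : ι → ℝ) (Y : P)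
    (hd : ∀ m Y, HasFDerivAt (f m) (L m Y) Y) (hL : ∀ m Y Z, L m Y Z = d m Y Z)
    (hb0 : ∀ m, 0 ≤ b m) (hb : Summable b)
    (hbound : ∀ m, ∀ Y' ∈ Metric.ball Y 1, ∀ Z, |d m Y' Z| ≤ b m * ‖Z‖)
    (h0 : Summable fun m => f m Y) :
    ∃ L : P →L[ℝ] ℝ, HasFDerivAt (fun Y => ∑' m, f m Y) L Y ∧
      ∀ Z, HasSum (fun m => d m Y Z) (L Z) := by
  have hmem : Y ∈ Metric.ball Y 1 := Metric.mem_ball_self one_pos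
  have hn : ∀ m, ∀ Y' ∈ Metric.ball Y 1, ‖L m Y'‖ ≤ b m := by
    intro m Y' hY'
    refine ContinuousLinearMap.opNorm_le_bound _ (hb0 m) fun Z => ?_
    rw [hL]
    exact hbound m Y' hY' Z
  refine ⟨_, hasFDerivAt_tsum_of_isPreconnected hb Metric.isOpen_ball
      (convex_ball Y 1).isPreconnected (fun m Y' _ => hd m Y') hn hmem h0 hmem, fun Z => ?_⟩
  have hsum : Summable fun m => L m Y := Summable.of_norm_bounded hb fun m => hn m Y hmem
  have h1 := ContinuousLinearMap.hasSum (ContinuousLinearMap.apply ℝ ℝ Z) hsum.hasSum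
  simpa only [ContinuousLinearMap.apply_apply, hL] using h1

lemma norm_fst_le_of_mem_ball {E F : Type*} [NormedAddCommGroup E] [NormedAddCommGroup F]
    {Y Y' : E × F} (h : Y' ∈ Metric.ball Y 1) : ‖Y'.1‖ ≤ ‖Y.1‖ + 1 := by
  have h1 : ‖Y' - Y‖ < 1 := by simpa [dist_eq_norm] using h
  have h2 : ‖Y'.1 - Y.1‖ ≤ ‖Y' - Y‖ := norm_fst_le (Y' - Y)
  have h3 := norm_sub_norm_le Y'.1 Y.1
  linarith

/-- The Coulomb energy is differentiable. -/
lemma hasFDerivAt_coulomb (e : ℝ) {σ : Torus N → ℝ} (hσ : IsC2 σ) (Y : H1 N × IonVec N) :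
    ∃ L : (H1 N × IonVec N) →L[ℝ] ℝ,
      HasFDerivAt (fun Y : H1 N × IonVec N => coulomb e σ Y.1 (toIonPos Y.2)) L Y ∧
      ∀ Z, HasSum (fun m => (N : ℝ) ^ 3 * dTerm e σ m Y Z) (L Z) := by
  -- The margin 1 covers the unit ball about Y, on which the series is differentiated termwise.
  obtain ⟨C, hC0, hC⟩ := exists_dTerm_bound e hσ (‖Y.1‖ + 1)
  choose L hd hL using fun m (Y : H1 N × IonVec N) => hasFDerivAt_coulombTerm e σ m Y
  have hs := ((summable_br_pow_four.add (summable_sigma hσ))).mul_left (2 * C)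
  obtain ⟨L0, h1, h2⟩ := exists_hasFDerivAt_tsum _ L _ _ Y hd hL
    (fun m => by have := br_pos m; positivity) hs (fun m Y' hY' Z => by
      rw [abs_mul, abs_two]
      have := hC m Y' Z (norm_fst_le_of_mem_ball hY')
      linarith) (summable_wgt_rhoL_sq e hσ Y)
  refine ⟨(1 / 2 * (N : ℝ) ^ 3) • L0, h1.const_mul (1 / 2 * (N : ℝ) ^ 3), fun Z => ?_⟩
  have h3 : (fun m => (N : ℝ) ^ 3 * dTerm e σ m Y Z)
      = fun m => 1 / 2 * (N : ℝ) ^ 3 * (2 * dTerm e σ m Y Z) := by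
    funext m
    ring
  rw [h3]
  exact (h2 Z).mul_left _

/-! ### The gradient of the Coulomb energy -/

/-- Multiplication by the real potential `2 Re (c e^{i ξ x_j})`. -/
def potMul1 (j : Fin (N ^ 3)) (m : Fin 3 → ℤ) (c : ℂ) : H1 N →L[ℂ] H1 N :=
  c • modeH1 j m + star c • modeH1 j (-m)

lemma toL2_potMul1 (j : Fin (N ^ 3)) (m : Fin 3 → ℤ) (c : ℂ) (u : H1 N) :
    toL2 (potMul1 j m c u) = c • modeL2 j m (toL2 u) + star c • modeL2 j (-m) (toL2 u) := rfl

lemma norm_potMul1_apply_le (j : Fin (N ^ 3)) (m : Fin 3 → ℤ) (c : ℂ) (u : H1 N) :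
    ‖potMul1 j m c u‖ ≤ 2 * modeBound N * (br m * ‖c‖) * ‖u‖ := by
  have h0 : potMul1 j m c u = c • modeH1 j m u + star c • modeH1 j (-m) u := rfl
  rw [h0]
  refine (norm_add_le _ _).trans ?_
  rw [norm_smul, norm_smul, norm_star]
  have h1 := (modeH1 j m).le_of_opNorm_le (norm_modeH1_le j m) u
  have h2 := (modeH1 j (-m)).le_of_opNorm_le (norm_modeH1_le j (-m)) u
  rw [br_neg] at h2
  nlinarith [norm_nonneg c, mul_le_mul_of_nonneg_left h1 (norm_nonneg c),
    mul_le_mul_of_nonneg_left h2 (norm_nonneg c)]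

lemma potMul1_sub_apply (j : Fin (N ^ 3)) (m : Fin 3 → ℤ) (c d : ℂ) (u : H1 N) :
    potMul1 j m (c - d) u = potMul1 j m c u - potMul1 j m d u := by
  refine ext_toL2 ?_
  rw [map_sub, toL2_potMul1, toL2_potMul1, toL2_potMul1, star_sub, sub_smul, sub_smul]
  abel

/-- Multiplication by the real potential `∑ⱼ 2 Re (c e^{i ξ x_j})`. -/
def potMul (m : Fin 3 → ℤ) (c : ℂ) : H1 N →L[ℂ] H1 N := ∑ j : Fin (N ^ 3), potMul1 j m c

lemma potMul_apply (m : Fin 3 → ℤ) (c : ℂ) (u : H1 N) :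
    potMul m c u = ∑ j : Fin (N ^ 3), potMul1 j m c u := by
  rw [potMul, sum_apply]

lemma potMul_sub_apply (m : Fin 3 → ℤ) (c d : ℂ) (u : H1 N) :
    potMul m (c - d) u = potMul m c u - potMul m d u := by
  simp only [potMul_apply, potMul1_sub_apply, Finset.sum_sub_distrib]

lemma norm_potMul_apply_le (m : Fin 3 → ℤ) (c : ℂ) (u : H1 N) :
    ‖potMul m c u‖ ≤ 2 * (N : ℝ) ^ 3 * modeBound N * (br m * ‖c‖) * ‖u‖ := by
  rw [potMul_apply]
  refine (norm_sum_le _ _).trans ?_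
  refine (Finset.sum_le_sum fun j _ => norm_potMul1_apply_le j m c u).trans (le_of_eq ?_)
  simp; ring

/-- The mode −m is the adjoint of the mode m; this turns the second summand into a conjugate with u
and v exchanged. -/
lemma inner_potMul1 (j : Fin (N ^ 3)) (m : Fin 3 → ℤ) (c : ℂ) (u v : H1 N) :
    inner ℂ (toL2 (potMul1 j m c u)) (toL2 v) = star c * bil j m u v + c * star (bil j m v u) := by
  have h2 : inner ℂ (modeL2 j (-m) (toL2 u)) (toL2 v) = star (bil j m v u) := by
    rw [inner_modeL2_left, neg_neg, bil, Complex.star_def, inner_conj_symm]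
  rw [toL2_potMul1, inner_add_left, inner_smul_left, inner_smul_left, h2]
  simp only [bil, Complex.star_def, Complex.conj_conj]

/-- The potentials are real: the multiplication operators are symmetric. -/
lemma inner_potMul_self (m : Fin 3 → ℤ) (c : ℂ) (u : H1 N) :
    (inner ℂ (toL2 (potMul m c u)) (toL2 u)).im = 0 := by
  simp only [potMul_apply, map_sum, sum_inner, inner_potMul1, Complex.im_sum]
  refine Finset.sum_eq_zero fun j _ => ?_
  simp only [Complex.star_def, Complex.add_im, Complex.mul_im, Complex.conj_re, Complex.conj_im]
  ring

/-- The terms of the gradient of the Coulomb energy with respect to the wave function. -/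
def potTerm (e : ℝ) (σ : Torus N → ℝ) (m : Fin 3 → ℤ) (Y : H1 N × IonVec N) : H1 N :=
  ((-(e / 2 * wgt N m) : ℝ) : ℂ) • potMul m (rhoL e σ m Y) Y.1

/-- The gradient of the Coulomb energy with respect to the wave function (up to the factor two),
that is, the product of the wave function with the potential. -/
def potF (e : ℝ) (σ : Torus N → ℝ) (Y : H1 N × IonVec N) : H1 N := ∑' m, potTerm e σ m Y

/-- The terms of the gradient of the Coulomb energy with respect to the positions of the ions. -/
def forceTerm (e : ℝ) (σ : Torus N → ℝ) (m : Fin 3 → ℤ) (n : Lattice N) (i : Fin 3)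
    (Y : H1 N × IonVec N) : ℝ :=
  (N : ℝ) ^ 3 * (wgt N m * (star (rhoL e σ m Y) *
    (fourierCoef σ m * (-Complex.I * phs m n Y.2 * (xi N (m i) : ℂ)))).re)

/-- The gradient of the Coulomb energy with respect to the positions of the ions. -/
def forceF (e : ℝ) (σ : Torus N → ℝ) (Y : H1 N × IonVec N) : IonVec N := fun n i =>
  ∑' m, forceTerm e σ m n i Y

/-- Under the real part the two halves of the differential of the electronic density combine into a
pairing with a real potential times ψ, and the volume N³ cancels the N⁻³ of `elC`. The factor 2 is
split off so that `potF` is exactly the product Vψ in iψ̇ = −½Δψ + Vψ. -/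
lemma dTerm_eq (e : ℝ) (σ : Torus N → ℝ) (m : Fin 3 → ℤ) (Y Z : H1 N × IonVec N) :
    (N : ℝ) ^ 3 * dTerm e σ m Y Z = 2 * (inner ℂ (toL2 (potTerm e σ m Y)) (toL2 Z.1)).re +
      ∑ n, ∑ i, forceTerm e σ m n i Y * Z.2 n i := by
  have hN : (N : ℝ) ≠ 0 := (N_pos (N := N)).ne'
  have h1 : (star (rhoL e σ m Y) * (-(e : ℂ) * ((N : ℂ) ^ 3)⁻¹ *
      ∑ j, (bil j m Y.1 Z.1 + bil j m Z.1 Y.1))).re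
      = -e * ((N : ℝ) ^ 3)⁻¹ * (inner ℂ (toL2 (potMul m (rhoL e σ m Y) Y.1)) (toL2 Z.1)).re := by
    have h2 : (star (rhoL e σ m Y) * (-(e : ℂ) * ((N : ℂ) ^ 3)⁻¹ *
      ∑ j, (bil j m Y.1 Z.1 + bil j m Z.1 Y.1))) = ((-e * ((N : ℝ) ^ 3)⁻¹ : ℝ) : ℂ) *
      ∑ j, star (rhoL e σ m Y) * (bil j m Y.1 Z.1 + bil j m Z.1 Y.1) := by
      rw [← Finset.mul_sum]; push_cast; ring
    rw [h2, Complex.re_ofReal_mul]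
    congr 1
    simp only [potMul_apply, map_sum, sum_inner, inner_potMul1, Complex.re_sum]
    refine Finset.sum_congr rfl fun j _ => ?_
    simp only [Complex.star_def, Complex.add_re, Complex.add_im, Complex.mul_re, Complex.conj_re,
      Complex.conj_im]
    ring
  have h3 : (star (rhoL e σ m Y) * (fourierCoef σ m *
      ∑ n, -Complex.I * phs m n Y.2 * (wdot m n Z.2 : ℂ))).re
      = ∑ n, ∑ i, (star (rhoL e σ m Y) *
    (fourierCoef σ m * (-Complex.I * phs m n Y.2 * (xi N (m i) : ℂ)))).re * Z.2 n i := by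
    simp only [wdot_apply, Finset.mul_sum, Complex.re_sum, Complex.ofReal_sum]
    refine Finset.sum_congr rfl fun n _ => Finset.sum_congr rfl fun i _ => ?_
    rw [← Complex.re_mul_ofReal]
    congr 1
    push_cast; ring
  rw [dTerm, dRho, mul_add, Complex.add_re, h1, h3, potTerm, map_smul, inner_smul_left,
    Complex.conj_ofReal, Complex.re_ofReal_mul]
  have h4 : ∀ n i, forceTerm e σ m n i Y * Z.2 n i = (N : ℝ) ^ 3 * wgt N m *
      ((star (rhoL e σ m Y) *
    (fourierCoef σ m * (-Complex.I * phs m n Y.2 * (xi N (m i) : ℂ)))).re * Z.2 n i) := by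
    intro n i; rw [forceTerm]; ring
  simp only [h4, ← Finset.mul_sum]
  field_simp
  ring

/-! ### Bounds for the forces -/

lemma summable_and_norm_tsum_le {ι E : Type*} [NormedAddCommGroup E] [CompleteSpace E] {f : ι → E}
    {C : ℝ} (h : ∀ s : Finset ι, ∑ m ∈ s, ‖f m‖ ≤ C) : Summable f ∧ ‖∑' m, f m‖ ≤ C := by
  have hs : Summable fun m => ‖f m‖ := summable_of_sum_le (fun _ => norm_nonneg _) h
  exact ⟨hs.of_norm, (norm_tsum_le_tsum_norm hs).trans (hs.tsum_le_of_sum_le h)⟩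

lemma norm_tsum_sub_tsum_le {ι E : Type*} [NormedAddCommGroup E] [CompleteSpace E] {f g : ι → E}
    {C : ℝ} (hf : Summable f) (hg : Summable g) (h : ∀ s : Finset ι, ∑ m ∈ s, ‖f m - g m‖ ≤ C) :
    ‖∑' m, f m - ∑' m, g m‖ ≤ C := by
  rw [← hf.tsum_sub hg]
  exact (summable_and_norm_tsum_le h).2

lemma sum_sum_bil_le (e : ℝ) (u v : H1 N) (s : Finset (Fin 3 → ℤ)) :
    ∑ m ∈ s, 1 / br m * ‖-(e : ℂ) * ((N : ℂ) ^ 3)⁻¹ * ∑ j, bil j m u v‖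
      ≤ |e| * (1000 * brBound N) * (‖u‖ * ‖v‖) := by
  have hN := N_pos (N := N)
  have h1 : ∀ m ∈ s, 1 / br m * ‖-(e : ℂ) * ((N : ℂ) ^ 3)⁻¹ * ∑ j, bil (N := N) j m u v‖
      ≤ |e| * ((N : ℝ) ^ 3)⁻¹ * ∑ j : Fin (N ^ 3), 1 / br m * ‖bil j m u v‖ := by
    intro m _
    have hb := br_pos m
    rw [norm_mul, norm_mul, norm_neg, norm_inv, norm_pow, Complex.norm_real, Complex.norm_natCast,
      Real.norm_eq_abs, mul_left_comm, ← Finset.mul_sum]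
    refine mul_le_mul_of_nonneg_left (mul_le_mul_of_nonneg_left (norm_sum_le _ _) ?_) ?_ <;>
    positivity
  refine (Finset.sum_le_sum h1).trans ?_
  rw [← Finset.mul_sum, Finset.sum_comm]
  refine (mul_le_mul_of_nonneg_left (Finset.sum_le_sum fun j _ => sum_bil_le j u v s)
    (by positivity)).trans (le_of_eq ?_)
  rw [Finset.sum_const, Finset.card_univ, Fintype.card_fin, nsmul_eq_mul]
  push_cast
  field_simp

lemma bil_self_sub (j : Fin (N ^ 3)) (m : Fin 3 → ℤ) (u v : H1 N) :
    bil j m u u - bil j m v v = bil j m (u - v) u + bil j m v (u - v) := by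
  simp only [bil, map_sub, inner_sub_left, inner_sub_right]; ring

/-- The ions are controlled by Σ |σ̂|, the electrons by `sum_bil_le`. In the difference, each ionic
phase is Lipschitz with a constant proportional to ⟨m⟩, which the weight 1/⟨m⟩ absorbs. -/
lemma exists_sum_rhoL_bound (e : ℝ) {σ : Torus N → ℝ} (hσ : IsC2 σ) (R : ℝ) :
    ∃ C, 0 ≤ C ∧ (∀ (Y : H1 N × IonVec N), ‖Y.1‖ ≤ R → ∀ s : Finset (Fin 3 → ℤ),
      ∑ m ∈ s, 1 / br m * ‖rhoL e σ m Y‖ ≤ C) ∧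
      ∀ (Y Y' : H1 N × IonVec N), ‖Y.1‖ ≤ R → ‖Y'.1‖ ≤ R → ∀ s : Finset (Fin 3 → ℤ),
      ∑ m ∈ s, 1 / br m * ‖rhoL e σ m Y - rhoL e σ m Y'‖ ≤ C * ‖Y - Y'‖ := by
  have hx := xi_one_pos (N := N)
  have hbB := brBound_pos (N := N)
  set K : ℝ := (Fintype.card (Lattice N) : ℝ) with hK
  have hK0 : 0 ≤ K := Nat.cast_nonneg _
  set S : ℝ := ∑' m, ‖fourierCoef σ m‖ with hS
  have hS0 : 0 ≤ S := tsum_nonneg fun _ => norm_nonneg _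
  have hSs : ∀ s : Finset (Fin 3 → ℤ), ∑ m ∈ s, ‖fourierCoef σ m‖ ≤ S := fun s =>
    (summable_sigma hσ).sum_le_tsum s fun _ _ => norm_nonneg _
  set A : ℝ := |e| * (1000 * brBound N) with hA
  have hA0 : 0 ≤ A := by positivity
  refine ⟨K * S + A * R ^ 2 + K * (3 * xi N 1) * S + 2 * A * |R|, by positivity,
    fun Y hY s => ?_, fun Y Y' hY hY' s => ?_⟩
  · have h1 : ∀ m ∈ s, 1 / br m * ‖rhoL e σ m Y‖ ≤ K * ‖fourierCoef σ m‖ +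
        1 / br m * ‖-(e : ℂ) * ((N : ℂ) ^ 3)⁻¹ * ∑ j, bil j m Y.1 Y.1‖ := by
      intro m _
      have hb := br_pos m
      have h2 : ‖rhoL e σ m Y‖ ≤ ‖ionC σ (toIonPos Y.2) m‖ + ‖elC e Y.1 m‖ := norm_add_le _ _
      have h3 := norm_ionC_le σ (toIonPos Y.2) m
      have h4 := one_div_br_le_one m
      have h5 : 0 ≤ 1 / br m := by positivity
      have h6 := mul_le_of_le_one_left (norm_nonneg (ionC σ (toIonPos Y.2) m)) h4
      have h7 := mul_le_mul_of_nonneg_left h2 h5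
      unfold elC at h7
      linarith
    refine (Finset.sum_le_sum h1).trans ?_
    rw [Finset.sum_add_distrib, ← Finset.mul_sum]
    have h2 := mul_le_mul_of_nonneg_left (hSs s) hK0
    have h3 := sum_sum_bil_le e Y.1 Y.1 s
    have hR : 0 ≤ R := (norm_nonneg _).trans hY
    have hY2 : ‖Y.1‖ * ‖Y.1‖ ≤ R ^ 2 := by nlinarith [norm_nonneg Y.1]
    have h4 := mul_le_mul_of_nonneg_left hY2 hA0
    have h5 : 0 ≤ K * (3 * xi N 1) * S := by positivity
    have h6 : 0 ≤ 2 * A * |R| := by positivity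
    linarith
  · have hR : 0 ≤ R := (norm_nonneg _).trans hY
    have h1 : ∀ m ∈ s, 1 / br m * ‖rhoL e σ m Y - rhoL e σ m Y'‖ ≤
        K * (3 * xi N 1) * ‖Y - Y'‖ * ‖fourierCoef σ m‖ +
        (1 / br m * ‖-(e : ℂ) * ((N : ℂ) ^ 3)⁻¹ * ∑ j, bil j m (Y.1 - Y'.1) Y.1‖ +
        1 / br m * ‖-(e : ℂ) * ((N : ℂ) ^ 3)⁻¹ * ∑ j, bil j m Y'.1 (Y.1 - Y'.1)‖) := by
      intro m _
      have hb := br_pos m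
      have e1 : rhoL e σ m Y - rhoL e σ m Y' = fourierCoef σ m * (∑ n, (phs m n Y.2 - phs m n Y'.2)) +
          (-(e : ℂ) * ((N : ℂ) ^ 3)⁻¹ * (∑ j, bil j m (Y.1 - Y'.1) Y.1) +
          -(e : ℂ) * ((N : ℂ) ^ 3)⁻¹ * ∑ j, bil j m Y'.1 (Y.1 - Y'.1)) := by
        rw [← mul_add, ← Finset.sum_add_distrib, ← Finset.sum_congr rfl fun j _ => bil_self_sub j m _ _,
          Finset.sum_sub_distrib, Finset.sum_sub_distrib]
        simp only [rhoL, rhoC, elC, ionC_toIonPos]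
        ring
      have e2 : ‖fourierCoef σ m * (∑ n, (phs m n Y.2 - phs m n Y'.2))‖
          ≤ ‖fourierCoef σ m‖ * (K * (3 * xi N 1 * br m * ‖Y - Y'‖)) := by
        rw [norm_mul]
        refine mul_le_mul_of_nonneg_left ?_ (norm_nonneg _)
        have e3 : ∀ n ∈ (Finset.univ : Finset (Lattice N)), ‖phs m n Y.2 - phs m n Y'.2‖
            ≤ 3 * xi N 1 * br m * ‖Y - Y'‖ := fun n _ =>
          (norm_phs_sub_le m n _ _).trans
            (mul_le_mul_of_nonneg_left (norm_snd_le (Y - Y')) (by positivity))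
        refine (norm_sum_le _ _).trans ((Finset.sum_le_sum e3).trans (le_of_eq ?_))
        rw [Finset.sum_const, Finset.card_univ, nsmul_eq_mul]
      have e4 := (norm_add_le _ _).trans (add_le_add e2 (norm_add_le
        (-(e : ℂ) * ((N : ℂ) ^ 3)⁻¹ * (∑ j, bil j m (Y.1 - Y'.1) Y.1))
        (-(e : ℂ) * ((N : ℂ) ^ 3)⁻¹ * ∑ j, bil j m Y'.1 (Y.1 - Y'.1))))
      rw [← e1] at e4
      refine (mul_le_mul_of_nonneg_left e4 (by positivity)).trans (le_of_eq ?_)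
      field_simp
    refine (Finset.sum_le_sum h1).trans ?_
    rw [Finset.sum_add_distrib, Finset.sum_add_distrib, ← Finset.mul_sum]
    have g1 : ‖Y.1 - Y'.1‖ ≤ ‖Y - Y'‖ := norm_fst_le (Y - Y')
    have g0 : 0 ≤ ‖Y - Y'‖ := norm_nonneg _
    have h2 := mul_le_mul_of_nonneg_left (hSs s)
      (show 0 ≤ K * (3 * xi N 1) * ‖Y - Y'‖ by positivity)
    have h3 := sum_sum_bil_le e (Y.1 - Y'.1) Y.1 s
    have h4 := sum_sum_bil_le e Y'.1 (Y.1 - Y'.1) s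
    have h5 := mul_le_mul_of_nonneg_left (mul_le_mul g1 hY (norm_nonneg _) g0) hA0
    have h6 := mul_le_mul_of_nonneg_left (mul_le_mul hY' g1 (norm_nonneg _) hR) hA0
    rw [abs_of_nonneg hR]
    have h7 : 0 ≤ (K * S + A * R ^ 2) * ‖Y - Y'‖ := by positivity
    nlinarith

/-- The balance of powers: the mode costs ⟨m⟩ on H¹ and the Green multiplier gains ⟨m⟩⁻². With c =
ρ̂(m) the remainder ⟨m⟩⁻¹|c| is summable by `exists_sum_rhoL_bound`. -/
lemma norm_potTerm_le (e : ℝ) (m : Fin 3 → ℤ) (c : ℂ) (u : H1 N) :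
    ‖((-(e / 2 * wgt N m) : ℝ) : ℂ) • potMul m c u‖
      ≤ |e| * (N : ℝ) ^ 3 * modeBound N * wBound N * (1 / br m * ‖c‖) * ‖u‖ := by
  have hb := br_pos m
  have hN := N_pos (N := N)
  have hM := modeBound_pos (N := N)
  rw [norm_smul, Complex.norm_real, norm_neg, Real.norm_eq_abs, abs_mul, abs_div, abs_two,
    abs_of_nonneg (wgt_nonneg m)]
  have h1 := norm_potMul_apply_le m c u
  have h2 : |e| / 2 * wgt N m * ‖potMul m c u‖
      ≤ |e| / 2 * wgt N m * (2 * (N : ℝ) ^ 3 * modeBound N * (br m * ‖c‖) * ‖u‖) :=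
    mul_le_mul_of_nonneg_left h1 (mul_nonneg (by positivity) (wgt_nonneg m))
  refine h2.trans ?_
  have h3 := mul_le_mul_of_nonneg_left (wgt_mul_br_le (N := N) m)
    (show 0 ≤ |e| * (N : ℝ) ^ 3 * modeBound N * ‖c‖ * ‖u‖ by positivity)
  linarith

/-- Each term is real-bilinear in the coefficient ρ̂(m) and the wave function, so a difference
splits into a change of the density and a change of ψ. -/
lemma sum_potTerm_bounds (e : ℝ) {σ : Torus N → ℝ} (hσ : IsC2 σ) (R : ℝ) :
    ∃ C, 0 ≤ C ∧ (∀ (Y : H1 N × IonVec N), ‖Y.1‖ ≤ R → ∀ s : Finset (Fin 3 → ℤ),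
      ∑ m ∈ s, ‖potTerm e σ m Y‖ ≤ C) ∧
      ∀ (Y Y' : H1 N × IonVec N), ‖Y.1‖ ≤ R → ‖Y'.1‖ ≤ R → ∀ s : Finset (Fin 3 → ℤ),
      ∑ m ∈ s, ‖potTerm e σ m Y - potTerm e σ m Y'‖ ≤ C * ‖Y - Y'‖ := by
  obtain ⟨C, hC0, hC1, hC2⟩ := exists_sum_rhoL_bound e hσ R
  have hN := N_pos (N := N)
  have hM := modeBound_pos (N := N)
  have hw := wBound_pos (N := N)
  set A := |e| * (N : ℝ) ^ 3 * modeBound N * wBound N with hA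
  have hA0 : 0 ≤ A := by positivity
  refine ⟨A * C * |R| + A * C, by positivity, fun Y hY s => ?_, fun Y Y' hY hY' s => ?_⟩
  · have hR : 0 ≤ R := (norm_nonneg _).trans hY
    have h1 := Finset.sum_le_sum fun m (_ : m ∈ s) => norm_potTerm_le e m (rhoL e σ m Y) Y.1
    refine h1.trans ?_
    rw [← Finset.sum_mul, ← Finset.mul_sum, abs_of_nonneg hR]
    have h2 := mul_le_mul (mul_le_mul_of_nonneg_left (hC1 Y hY s) hA0) hY (norm_nonneg _)
      (by positivity)
    have h3 : 0 ≤ A * C := by positivity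
    linarith
  · have hR : 0 ≤ R := (norm_nonneg _).trans hY
    have h1 : ∀ m ∈ s, ‖potTerm e σ m Y - potTerm e σ m Y'‖ ≤
        A * (1 / br m * ‖rhoL e σ m Y - rhoL e σ m Y'‖) * ‖Y.1‖ +
        A * (1 / br m * ‖rhoL e σ m Y'‖) * ‖Y.1 - Y'.1‖ := by
      intro m _
      have e1 : potTerm e σ m Y - potTerm e σ m Y' =
          ((-(e / 2 * wgt N m) : ℝ) : ℂ) • potMul m (rhoL e σ m Y - rhoL e σ m Y') Y.1 +
          ((-(e / 2 * wgt N m) : ℝ) : ℂ) • potMul m (rhoL e σ m Y') (Y.1 - Y'.1) := by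
        rw [← smul_add, potMul_sub_apply, map_sub, potTerm, potTerm, ← smul_sub]
        congr 1
        abel
      rw [e1]
      exact (norm_add_le _ _).trans (add_le_add (norm_potTerm_le _ _ _ _) (norm_potTerm_le _ _ _ _))
    refine (Finset.sum_le_sum h1).trans ?_
    rw [Finset.sum_add_distrib, ← Finset.sum_mul, ← Finset.mul_sum, ← Finset.sum_mul,
      ← Finset.mul_sum, abs_of_nonneg hR]
    have g1 : ‖Y.1 - Y'.1‖ ≤ ‖Y - Y'‖ := norm_fst_le (Y - Y')
    have h2 := mul_le_mul (mul_le_mul_of_nonneg_left (hC2 Y Y' hY hY' s) hA0) hY (norm_nonneg _)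
      (by positivity)
    have h3 := mul_le_mul (mul_le_mul_of_nonneg_left (hC1 Y' hY' s) hA0) g1 (norm_nonneg _)
      (by positivity)
    linarith

/-- To be applied with z the conjugate coefficient ρ̂(m) times a phase, up to −i, or with a
difference of two such. The factor ξ costs one power of ⟨m⟩ and the Green multiplier returns two. -/
lemma abs_forceTerm_le (σ : Torus N → ℝ) (m : Fin 3 → ℤ) (i : Fin 3) (z : ℂ) :
    |(N : ℝ) ^ 3 * (wgt N m * (z * fourierCoef σ m * (xi N (m i) : ℂ)).re)|
      ≤ (N : ℝ) ^ 3 * wBound N * xi N 1 * (1 / br m * ‖z‖ * ‖fourierCoef σ m‖) := by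
  have hN := N_pos (N := N)
  have hx := xi_one_pos (N := N)
  have hb := br_pos m
  rw [abs_mul, abs_mul, abs_of_nonneg (wgt_nonneg m), abs_of_pos (show (0 : ℝ) < (N : ℝ) ^ 3 by positivity)]
  have h1 : |(z * fourierCoef σ m * (xi N (m i) : ℂ)).re| ≤
      ‖z‖ * ‖fourierCoef σ m‖ * (xi N 1 * br m) := by
    refine (Complex.abs_re_le_norm _).trans ?_
    rw [norm_mul, norm_mul, Complex.norm_real]
    exact mul_le_mul_of_nonneg_left (abs_xi_le m i) (by positivity)
  have h2 := mul_le_mul_of_nonneg_left h1 (wgt_nonneg (N := N) m)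
  have h3 := mul_le_mul_of_nonneg_left (wgt_mul_br_le (N := N) m)
    (show 0 ≤ ‖z‖ * ‖fourierCoef σ m‖ * xi N 1 by positivity)
  have h4 : wgt N m * |(z * fourierCoef σ m * (xi N (m i) : ℂ)).re| ≤
      ‖z‖ * ‖fourierCoef σ m‖ * xi N 1 * (wBound N * (1 / br m)) := by linarith
  refine (mul_le_mul_of_nonneg_left h4 (by positivity)).trans (le_of_eq (by ring))

lemma forceTerm_eq (e : ℝ) (σ : Torus N → ℝ) (m : Fin 3 → ℤ) (n : Lattice N) (i : Fin 3)
    (Y : H1 N × IonVec N) : forceTerm e σ m n i Y = (N : ℝ) ^ 3 * (wgt N m *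
      ((-Complex.I * (star (rhoL e σ m Y) * phs m n Y.2)) * fourierCoef σ m * (xi N (m i) : ℂ)).re) := by
  rw [forceTerm]
  congr 3
  ring

/-- A difference of phases costs a further factor ⟨m⟩, paid for by the bound on ⟨m⟩|σ̂(m)| from
`exists_sigma_bound`. -/
lemma sum_forceTerm_bounds (e : ℝ) {σ : Torus N → ℝ} (hσ : IsC2 σ) (R : ℝ) :
    ∃ C, 0 ≤ C ∧ (∀ (Y : H1 N × IonVec N), ‖Y.1‖ ≤ R → ∀ n i, ∀ s : Finset (Fin 3 → ℤ),
      ∑ m ∈ s, ‖forceTerm e σ m n i Y‖ ≤ C) ∧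
      ∀ (Y Y' : H1 N × IonVec N), ‖Y.1‖ ≤ R → ‖Y'.1‖ ≤ R → ∀ n i, ∀ s : Finset (Fin 3 → ℤ),
      ∑ m ∈ s, ‖forceTerm e σ m n i Y - forceTerm e σ m n i Y'‖ ≤ C * ‖Y - Y'‖ := by
  obtain ⟨C, hC0, hC1, hC2⟩ := exists_sum_rhoL_bound e hσ R
  obtain ⟨S, hS0, hS⟩ := exists_sigma_bound hσ
  have hN := N_pos (N := N)
  have hx := xi_one_pos (N := N)
  have hw := wBound_pos (N := N)
  have hS' : ∀ m, ‖fourierCoef σ m‖ ≤ S := fun m =>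
    le_trans (le_mul_of_one_le_left (norm_nonneg _) (one_le_br m)) (hS m)
  set A := (N : ℝ) ^ 3 * wBound N * xi N 1 with hA
  have hA0 : 0 ≤ A := by positivity
  refine ⟨A * S * C + A * S * (3 * xi N 1) * C, by positivity,
    fun Y hY n i s => ?_, fun Y Y' hY hY' n i s => ?_⟩
  · have h1 : ∀ m ∈ s, ‖forceTerm e σ m n i Y‖ ≤ A * S * (1 / br m * ‖rhoL e σ m Y‖) := by
      intro m _
      have hb := br_pos m
      rw [forceTerm_eq, Real.norm_eq_abs]
      refine (abs_forceTerm_le _ _ _ _).trans ?_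
      rw [norm_mul, norm_mul, norm_neg, Complex.norm_I, norm_star, norm_phs, one_mul, mul_one]
      have := mul_le_mul_of_nonneg_left (hS' m)
        (show 0 ≤ A * (1 / br m * ‖rhoL e σ m Y‖) by positivity)
      linarith
    refine (Finset.sum_le_sum h1).trans ?_
    rw [← Finset.mul_sum]
    have := mul_le_mul_of_nonneg_left (hC1 Y hY s) (show 0 ≤ A * S by positivity)
    have : 0 ≤ A * S * (3 * xi N 1) * C := by positivity
    linarith
  · have h1 : ∀ m ∈ s, ‖forceTerm e σ m n i Y - forceTerm e σ m n i Y'‖ ≤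
        A * S * (1 / br m * ‖rhoL e σ m Y - rhoL e σ m Y'‖) +
        A * S * (3 * xi N 1) * ‖Y - Y'‖ * (1 / br m * ‖rhoL e σ m Y'‖) := by
      intro m _
      have hb := br_pos m
      have e1 : forceTerm e σ m n i Y - forceTerm e σ m n i Y' = (N : ℝ) ^ 3 * (wgt N m *
          ((-Complex.I * (star (rhoL e σ m Y - rhoL e σ m Y') * phs m n Y.2 +
            star (rhoL e σ m Y') * (phs m n Y.2 - phs m n Y'.2))) *
            fourierCoef σ m * (xi N (m i) : ℂ)).re) := by
        rw [forceTerm_eq, forceTerm_eq, ← mul_sub, ← mul_sub, ← Complex.sub_re, star_sub]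
        congr 3
        ring
      rw [e1, Real.norm_eq_abs]
      refine (abs_forceTerm_le _ _ _ _).trans ?_
      have e2 : ‖-Complex.I * (star (rhoL e σ m Y - rhoL e σ m Y') * phs m n Y.2 +
            star (rhoL e σ m Y') * (phs m n Y.2 - phs m n Y'.2))‖
          ≤ ‖rhoL e σ m Y - rhoL e σ m Y'‖ + ‖rhoL e σ m Y'‖ * (3 * xi N 1 * br m * ‖Y - Y'‖) := by
        rw [norm_mul, norm_neg, Complex.norm_I, one_mul]
        refine (norm_add_le _ _).trans ?_
        rw [norm_mul, norm_mul, norm_star, norm_star, norm_phs, mul_one]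
        have e3 := (norm_phs_sub_le m n Y.2 Y'.2).trans
          (mul_le_mul_of_nonneg_left (norm_snd_le (Y - Y')) (by positivity))
        have := mul_le_mul_of_nonneg_left e3 (norm_nonneg (rhoL e σ m Y'))
        linarith
      have e4 := mul_le_mul_of_nonneg_left e2
        (show 0 ≤ A * (1 / br m) * ‖fourierCoef σ m‖ by positivity)
      have e5 := mul_le_mul_of_nonneg_left (hS' m)
        (show 0 ≤ A * (1 / br m * ‖rhoL e σ m Y - rhoL e σ m Y'‖) by positivity)
      have e6 := mul_le_mul_of_nonneg_left (hS m)
        (show 0 ≤ A * (3 * xi N 1) * ‖Y - Y'‖ * (1 / br m * ‖rhoL e σ m Y'‖) by positivity)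
      linarith
    refine (Finset.sum_le_sum h1).trans ?_
    rw [Finset.sum_add_distrib, ← Finset.mul_sum, ← Finset.mul_sum]
    have g0 : 0 ≤ ‖Y - Y'‖ := norm_nonneg _
    have h2 := mul_le_mul_of_nonneg_left (hC2 Y Y' hY hY' s) (show 0 ≤ A * S by positivity)
    have h3 := mul_le_mul_of_nonneg_left (hC1 Y' hY' s)
      (show 0 ≤ A * S * (3 * xi N 1) * ‖Y - Y'‖ by positivity)
    linarith

lemma summable_potTerm (e : ℝ) {σ : Torus N → ℝ} (hσ : IsC2 σ) (Y : H1 N × IonVec N) :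
    Summable fun m => potTerm e σ m Y := by
  obtain ⟨C, _, h, _⟩ := sum_potTerm_bounds e hσ ‖Y.1‖
  exact (summable_and_norm_tsum_le (h Y le_rfl)).1

lemma summable_forceTerm (e : ℝ) {σ : Torus N → ℝ} (hσ : IsC2 σ) (Y : H1 N × IonVec N)
    (n : Lattice N) (i : Fin 3) : Summable fun m => forceTerm e σ m n i Y := by
  obtain ⟨C, _, h, _⟩ := sum_forceTerm_bounds e hσ ‖Y.1‖
  exact (summable_and_norm_tsum_le (h Y le_rfl n i)).1

/-- The forces are bounded and Lipschitz continuous, locally in the wave function. -/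
lemma exists_force_bounds (e : ℝ) {σ : Torus N → ℝ} (hσ : IsC2 σ) (R : ℝ) :
    ∃ C, 0 ≤ C ∧ (∀ (Y : H1 N × IonVec N), ‖Y.1‖ ≤ R → ‖potF e σ Y‖ ≤ C ∧ ‖forceF e σ Y‖ ≤ C) ∧
      ∀ (Y Y' : H1 N × IonVec N), ‖Y.1‖ ≤ R → ‖Y'.1‖ ≤ R →
      ‖potF e σ Y - potF e σ Y'‖ ≤ C * ‖Y - Y'‖ ∧
      ‖forceF e σ Y - forceF e σ Y'‖ ≤ C * ‖Y - Y'‖ := by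
  obtain ⟨C, hC0, hC1, hC2⟩ := sum_potTerm_bounds e hσ R
  obtain ⟨D, hD0, hD1, hD2⟩ := sum_forceTerm_bounds e hσ R
  refine ⟨max C D, le_max_of_le_left hC0, fun Y hY => ⟨?_, ?_⟩, fun Y Y' hY hY' => ⟨?_, ?_⟩⟩
  · exact ((summable_and_norm_tsum_le (hC1 Y hY)).2).trans (le_max_left _ _)
  · refine (pi_norm_le_iff_of_nonneg (le_max_of_le_left hC0)).2 fun n =>
      (pi_norm_le_iff_of_nonneg (le_max_of_le_left hC0)).2 fun i => ?_
    exact ((summable_and_norm_tsum_le (hD1 Y hY n i)).2).trans (le_max_right _ _)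
  · refine le_trans ?_ (mul_le_mul_of_nonneg_right (le_max_left C D) (norm_nonneg _))
    exact norm_tsum_sub_tsum_le (summable_potTerm e hσ Y) (summable_potTerm e hσ Y')
      (hC2 Y Y' hY hY')
  · have h0 : 0 ≤ max C D * ‖Y - Y'‖ := mul_nonneg (le_max_of_le_left hC0) (norm_nonneg _)
    refine (pi_norm_le_iff_of_nonneg h0).2 fun n => (pi_norm_le_iff_of_nonneg h0).2 fun i => ?_
    refine le_trans ?_ (mul_le_mul_of_nonneg_right (le_max_right C D) (norm_nonneg _))
    exact norm_tsum_sub_tsum_le (summable_forceTerm e hσ Y n i) (summable_forceTerm e hσ Y' n i)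
      (hD2 Y Y' hY hY' n i)

lemma dotCLM_apply (v κ : IonVec N) : dotCLM v κ = ∑ n, ∑ i, v n i * κ n i := by
  simp [dotCLM]

lemma toHm1_apply (u v : H1 N) : toHm1 u v = (inner ℂ (toL2 u) (toL2 v)).re := rfl

/-- The gradient of the Coulomb energy. -/
lemma hasFDerivAt_coulomb' (e : ℝ) {σ : Torus N → ℝ} (hσ : IsC2 σ) (Y : H1 N × IonVec N) :
    ∃ L : (H1 N × IonVec N) →L[ℝ] ℝ,
      HasFDerivAt (fun Y : H1 N × IonVec N => coulomb e σ Y.1 (toIonPos Y.2)) L Y ∧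
      ∀ Z, L Z = 2 * toHm1 (potF e σ Y) Z.1 + dotCLM (forceF e σ Y) Z.2 := by
  obtain ⟨L, h1, h2⟩ := hasFDerivAt_coulomb e hσ Y
  refine ⟨L, h1, fun Z => (h2 Z).unique ?_⟩
  have h3 : HasSum (fun m => (inner ℂ (toL2 (potTerm e σ m Y)) (toL2 Z.1)).re)
      (toHm1 (potF e σ Y) Z.1) := by
    have h4 := (toL2.hasSum (summable_potTerm e hσ Y).hasSum)
    have h5 := (innerSL ℂ (toL2 Z.1)).hasSum h4
    have h6 := Complex.hasSum_re h5
    have h7 : ∀ a b : L2 N, (inner ℂ a b).re = (innerSL ℂ b a).re := fun a b => by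
      rw [innerSL_apply_apply, ← inner_conj_symm, Complex.conj_re]
    simp only [toHm1_apply, h7]
    exact h6
  have h4 : HasSum (fun m => ∑ n, ∑ i, forceTerm e σ m n i Y * Z.2 n i)
      (dotCLM (forceF e σ Y) Z.2) := by
    rw [dotCLM_apply]
    exact hasSum_sum fun n _ => hasSum_sum fun i _ =>
      ((summable_forceTerm e hσ Y n i).hasSum).mul_right _
  simp only [dTerm_eq]
  exact (h3.mul_left 2).add h4

/-! ### Ordinary differential equations in Banach spaces -/

section ODE

variable {E : Type*} [NormedAddCommGroup E] [NormedSpace ℝ E]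

/-- A curve is differentiable with continuous derivative `g` if it is so after the application of
the members of a separating family of functionals. -/
lemma hasDerivAt_of_separating [CompleteSpace E] {ι F : Type*} [NormedAddCommGroup F]
    [NormedSpace ℝ F] (l : ι → E →L[ℝ] F) (hl : ∀ x y, (∀ i, l i x = l i y) → x = y)
    {f g : ℝ → E} (hg : Continuous g)
    (h : ∀ i t, HasDerivAt (fun s => l i (f s)) (l i (g t)) t) (t : ℝ) : HasDerivAt f (g t) t := by
  have h1 : ∀ t, HasDerivAt (fun s => ∫ τ in (0 : ℝ)..s, g τ) (g t) t := fun t =>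
    intervalIntegral.integral_hasDerivAt_right (hg.intervalIntegrable _ _)
      hg.aestronglyMeasurable.stronglyMeasurableAtFilter hg.continuousAt
  -- Every functional of f − ∫g has derivative zero. As the functionals separate points, f is a
  -- primitive of g, and continuity of g yields the derivative in norm.
  have h2 : ∀ s, f s = f 0 + ∫ τ in (0 : ℝ)..s, g τ := by
    intro s
    refine hl _ _ fun i => ?_
    have h3 : ∀ t, HasDerivAt (fun s => l i (f s) - l i (∫ τ in (0 : ℝ)..s, g τ)) 0 t := by
      intro t
      have := (h i t).sub ((l i).hasFDerivAt.comp_hasDerivAt t (h1 t))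
      rw [sub_self] at this
      exact this
    have h4 := is_const_of_deriv_eq_zero (fun t => (h3 t).differentiableAt)
      (fun t => (h3 t).deriv) s 0
    simp only [intervalIntegral.integral_same, map_zero, sub_zero] at h4
    rw [map_add, ← h4, sub_add_cancel]
  have h5 := (h1 t).const_add (f 0)
  have h6 : f = fun s => f 0 + ∫ τ in (0 : ℝ)..s, g τ := funext h2
  rw [h6]
  simpa using h5

/-- Global existence for bounded vector fields that are Lipschitz in space. -/
lemma exists_forall_hasDerivAt [CompleteSpace E] {G : ℝ → E → E} {K C : NNReal}
    (hK : ∀ t, LipschitzWith K (G t)) (hC : ∀ t x, ‖G t x‖ ≤ C)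
    (hc : ∀ x, Continuous fun t => G t x) (x₀ : E) :
    ∃ y : ℝ → E, y 0 = x₀ ∧ ∀ t, HasDerivAt y (G t (y t)) t := by
  have h1 : ∀ n : ℕ, ∃ y : ℝ → E, y 0 = x₀ ∧
      ∀ t ∈ Set.Ioo (-(n + 1 : ℝ)) (n + 1), HasDerivAt y (G t (y t)) t := by
    intro n
    have hn : (0 : ℝ) < n + 1 := by positivity
    -- A field bounded by C moves a point by at most C(n + 1) within time n + 1, so the interval
    -- need not be shortened.
    have hp : IsPicardLindelof G (tmin := -(n + 1 : ℝ)) (tmax := n + 1) ⟨0, by linarith, hn.le⟩ x₀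
        (C * (n + 1)) 0 C K :=
      { lipschitzOnWith := fun t _ => (hK t).lipschitzOnWith
        continuousOn := fun x _ => (hc x).continuousOn
        norm_le := fun t _ x _ => hC t x
        mul_max_le := by simp }
    obtain ⟨y, hy0, hy⟩ := hp.exists_eq_forall_mem_Icc_hasDerivWithinAt₀
    exact ⟨y, hy0, fun t ht => (hy t (Set.Ioo_subset_Icc_self ht)).hasDerivAt
      (Icc_mem_nhds ht.1 ht.2)⟩
  choose y hy0 hy using h1
  have h2 : ∀ m n : ℕ, m ≤ n → Set.EqOn (y n) (y m) (Set.Ioo (-(m + 1 : ℝ)) (m + 1)) := by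
    intro m n hmn
    have hmn' : (m : ℝ) ≤ n := by exact_mod_cast hmn
    refine ODE_solution_unique_of_mem_Ioo (v := G) (s := fun _ => Set.univ) (t₀ := 0)
      (fun t _ => (hK t).lipschitzOnWith)
      ⟨by linarith [(m.cast_nonneg : (0 : ℝ) ≤ m)], by positivity⟩
      (fun t ht => ⟨hy n t ⟨by linarith [ht.1], by linarith [ht.2]⟩, trivial⟩)
      (fun t ht => ⟨hy m t ht, trivial⟩) (by rw [hy0, hy0])
  -- The extra 1 in the length of the intervals makes t an interior point of the one chosen for it.
  set z : ℝ → E := fun t => y ⌈|t|⌉₊ t with hz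
  have h3 : ∀ n : ℕ, ∀ t ∈ Set.Ioo (-(n + 1 : ℝ)) (n + 1), z t = y n t := by
    intro n t ht
    have h4 : t ∈ Set.Ioo (-((⌈|t|⌉₊ : ℝ) + 1)) ((⌈|t|⌉₊ : ℝ) + 1) := by
      have := Nat.le_ceil |t|
      have := abs_le.1 (le_refl |t|)
      constructor <;> linarith
    rcases le_total n ⌈|t|⌉₊ with h | h
    · exact h2 _ _ h ht
    · exact (h2 _ _ h h4).symm
  refine ⟨z, by simp [hz, hy0], fun t => ?_⟩
  have ht : t ∈ Set.Ioo (-((⌈|t|⌉₊ : ℝ) + 1)) ((⌈|t|⌉₊ : ℝ) + 1) := by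
    have := Nat.le_ceil |t|
    have := abs_le.1 (le_refl |t|)
    constructor <;> linarith
  have h5 := hy _ t ht
  rw [← h3 _ t ht] at h5
  refine h5.congr_of_eventuallyEq ?_
  filter_upwards [Ioo_mem_nhds ht.1 ht.2] with s hs using h3 _ s hs

/-- Uniqueness for vector fields that are Lipschitz on balls, uniformly in time. -/
lemma eq_of_hasDerivAt {G : ℝ → E → E}
    (hK : ∀ R : ℝ, ∃ K : NNReal, ∀ t, LipschitzOnWith K (G t) (Metric.closedBall 0 R))
    {y z : ℝ → E} (hy : ∀ t, HasDerivAt y (G t (y t)) t) (hz : ∀ t, HasDerivAt z (G t (z t)) t)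
    (h0 : y 0 = z 0) : y = z := by
  have hyc : Continuous y := continuous_iff_continuousAt.2 fun t => (hy t).continuousAt
  have hzc : Continuous z := continuous_iff_continuousAt.2 fun t => (hz t).continuousAt
  ext t
  set T := |t| + 1 with hT
  have ht := abs_le.1 (le_refl |t|)
  obtain ⟨R₁, hR₁⟩ := ((isCompact_Icc (a := -T) (b := T)).bddAbove_image
    (hyc.norm.continuousOn))
  obtain ⟨R₂, hR₂⟩ := ((isCompact_Icc (a := -T) (b := T)).bddAbove_image
    (hzc.norm.continuousOn))
  obtain ⟨K, hK⟩ := hK (max R₁ R₂)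
  have ha : 0 ≤ |t| := abs_nonneg t
  refine ODE_solution_unique_of_mem_Ioo (v := G) (s := fun _ => Metric.closedBall 0 (max R₁ R₂))
    (t₀ := 0) (a := -T) (b := T) (fun t _ => hK t) ⟨by linarith, by linarith⟩
    (fun s hs => ⟨hy s, ?_⟩) (fun s hs => ⟨hz s, ?_⟩) h0 ⟨by linarith, by linarith⟩
  · rw [mem_closedBall_zero_iff]
    exact (hR₁ ⟨s, Set.Ioo_subset_Icc_self hs, rfl⟩).trans (le_max_left _ _)
  · rw [mem_closedBall_zero_iff]
    exact (hR₂ ⟨s, Set.Ioo_subset_Icc_self hs, rfl⟩).trans (le_max_right _ _)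

/-- The radial retraction to the ball of radius `R`. -/
def radial (R : ℝ) (x : E) : E := (R / max R ‖x‖) • x

lemma radial_of_le {R : ℝ} (hR : 0 < R) {x : E} (hx : ‖x‖ ≤ R) : radial R x = x := by
  rw [radial, max_eq_left hx, div_self hR.ne', one_smul]

lemma norm_radial_le {R : ℝ} (hR : 0 < R) (x : E) : ‖radial R x‖ ≤ R := by
  have h : 0 < max R ‖x‖ := lt_of_lt_of_le hR (le_max_left _ _)
  rw [radial, norm_smul, Real.norm_of_nonneg (by positivity), div_mul_eq_mul_div, div_le_iff₀ h]
  exact mul_le_mul_of_nonneg_left (le_max_right _ _) hR.le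

/-- The scaling factor and the vector are varied separately, each contributing ‖x − y‖. No inner
product is needed, as the momenta carry a maximum norm. -/
lemma norm_radial_sub_le {R : ℝ} (hR : 0 < R) (x y : E) :
    ‖radial R x - radial R y‖ ≤ 2 * ‖x - y‖ := by
  have hx : 0 < max R ‖x‖ := lt_of_lt_of_le hR (le_max_left _ _)
  have hy : 0 < max R ‖y‖ := lt_of_lt_of_le hR (le_max_left _ _)
  have h1 : radial R x - radial R y =
      (R / max R ‖x‖) • (x - y) + (R / max R ‖x‖ - R / max R ‖y‖) • y := by
    simp only [radial, smul_sub, sub_smul]; abel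
  have h2 : |max R ‖y‖ - max R ‖x‖| ≤ ‖x - y‖ := by
    rw [max_comm R, max_comm R, norm_sub_rev]
    exact (abs_max_sub_max_le_abs ‖y‖ ‖x‖ R).trans (abs_norm_sub_norm_le y x)
  have h3 : ‖(R / max R ‖x‖) • (x - y)‖ ≤ ‖x - y‖ := by
    rw [norm_smul, Real.norm_of_nonneg (by positivity)]
    refine mul_le_of_le_one_left (norm_nonneg _) ?_
    rw [div_le_one hx]; exact le_max_left _ _
  have h4 : ‖(R / max R ‖x‖ - R / max R ‖y‖) • y‖ ≤ ‖x - y‖ := by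
    have h5 : R / max R ‖x‖ - R / max R ‖y‖ =
        (max R ‖y‖ - max R ‖x‖) * ((R / max R ‖x‖) / max R ‖y‖) := by
      field_simp
    rw [norm_smul, h5, norm_mul, Real.norm_of_nonneg (r := R / max R ‖x‖ / max R ‖y‖)
      (by positivity), mul_assoc, Real.norm_eq_abs]
    have h6 : R / max R ‖x‖ / max R ‖y‖ * ‖y‖ ≤ 1 := by
      rw [div_div, div_mul_eq_mul_div, div_le_one (by positivity)]
      exact mul_le_mul (le_max_left _ _) (le_max_right _ _) (norm_nonneg _) hx.le
    exact (mul_le_of_le_one_right (abs_nonneg _) h6).trans h2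
  rw [h1]
  linarith [norm_add_le ((R / max R ‖x‖) • (x - y)) ((R / max R ‖x‖ - R / max R ‖y‖) • y)]

/-- Let a be the first time with f a ≥ R. By continuity f ≤ R on [0, a], so g is constant there, and
then f a < R. -/
lemma lt_of_bootstrap_nonneg {f : ℝ → ℝ} {g : ℝ → E} {R : ℝ} (hf : Continuous f)
    (h0 : f 0 < R) (hd : ∀ t, f t ≤ R → HasDerivAt g 0 t)
    (hb : ∀ t, g t = g 0 → f t < R) (t : ℝ) (ht : 0 ≤ t) : f t < R := by
  by_contra hcon
  push Not at hcon
  set S : Set ℝ := {s | 0 ≤ s ∧ R ≤ f s} with hS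
  have hSc : IsClosed S := (isClosed_le continuous_const continuous_id).inter
    (isClosed_le continuous_const hf)
  have hSb : BddBelow S := ⟨0, fun s hs => hs.1⟩
  have hmem : sInf S ∈ S := hSc.csInf_mem ⟨t, ht, hcon⟩ hSb
  set a := sInf S with ha
  have hlt : ∀ s ∈ Set.Ico 0 a, f s < R := by
    intro s hs
    by_contra h
    push Not at h
    exact absurd (csInf_le hSb (show s ∈ S from ⟨hs.1, h⟩)) (not_le.2 hs.2)
  have hapos : 0 < a := lt_of_le_of_ne hmem.1 (by rintro h; exact absurd hmem.2 (by rw [← h]; linarith))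
  have hle : f a ≤ R := by
    have h1 : Filter.Tendsto f (nhdsWithin a (Set.Iio a)) (nhds (f a)) :=
      hf.continuousAt.tendsto.mono_left nhdsWithin_le_nhds
    refine le_of_tendsto h1 ?_
    filter_upwards [Ioo_mem_nhdsLT hapos] with s hs using (hlt s ⟨hs.1.le, hs.2⟩).le
  have hd' : ∀ s ∈ Set.Icc 0 a, HasDerivAt g 0 s := by
    intro s hs
    rcases eq_or_lt_of_le hs.2 with rfl | h
    · exact hd _ hle
    · exact hd _ (hlt s ⟨hs.1, h⟩).le
  have h5 : g a = g 0 :=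
    (constant_of_has_deriv_right_zero (fun s hs => (hd' s hs).continuousAt.continuousWithinAt)
      (fun s hs => (hd' s (Set.Ico_subset_Icc_self hs)).hasDerivWithinAt)) a ⟨hapos.le, le_rfl⟩
  exact absurd (hb a h5) (not_lt.2 hmem.2)

/-- A continuity argument: a quantity that is controlled by a conserved one, which is known to be
conserved only while the quantity is small, remains small. -/
lemma lt_of_bootstrap {f : ℝ → ℝ} {g : ℝ → E} {R : ℝ} (hf : Continuous f)
    (h0 : f 0 < R) (hd : ∀ t, f t ≤ R → HasDerivAt g 0 t)
    (hb : ∀ t, g t = g 0 → f t < R) (t : ℝ) : f t < R := by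
  rcases le_total 0 t with ht | ht
  · exact lt_of_bootstrap_nonneg hf h0 hd hb t ht
  · have := lt_of_bootstrap_nonneg (f := fun s => f (-s)) (g := fun s => g (-s)) (R := R)
      (hf.comp continuous_neg) (by simpa using h0) (fun s hs => by
        have := (hd (-s) hs).scomp s (hasDerivAt_neg s)
        simpa [Function.comp_def] using this) (fun s hs => hb _ (by simpa using hs)) (-t)
        (by linarith)
    simpa using this

/-- The chain rule for a function whose gradient is more regular than its arguments: the curve need
only be differentiable after the embedding `T` into a larger space. -/
lemma hasDerivAt_comp_weak {V : Type*} [NormedAddCommGroup V] [NormedSpace ℝ V]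
    {T : E → E →L[ℝ] ℝ} (hT : ∀ x y, T (x - y) = T x - T y) (hT' : ∀ x y, T x y = T y x)
    {W : E × V → ℝ} {F : E × V → E} {f : E × V → V →L[ℝ] ℝ} (hF : Continuous F) (hf : Continuous f)
    (hW : ∀ y, ∃ L : E × V →L[ℝ] ℝ, HasFDerivAt W L y ∧ ∀ z, L z = 2 * T (F y) z.1 + f y z.2)
    {ψ : ℝ → E} {κ : ℝ → V} {D : E →L[ℝ] ℝ} {v : V} {t : ℝ} (hψ : Continuous ψ)
    (hκc : Continuous κ)
    (hD : HasDerivAt (fun s => T (ψ s)) D t) (hκ : HasDerivAt κ v t) :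
    HasDerivAt (fun s => W (ψ s, κ s)) (2 * D (F (ψ t, κ t)) + f (ψ t, κ t) v) t := by
  set y : ℝ → E × V := fun s => (ψ s, κ s) with hy
  have hyc : Continuous y := hψ.prodMk hκc
  -- Mean value theorem along the segment from y t to y s. Symmetry of T moves the increment of ψ
  -- into the functional, which is then evaluated at the gradient in an intermediate point.
  have h1 : ∀ s, ∃ θ ∈ Set.Ioo (0 : ℝ) 1, W (y s) - W (y t) =
      2 * (T (ψ s) - T (ψ t)) (F (y t + θ • (y s - y t))) +
        f (y t + θ • (y s - y t)) (κ s - κ t) := by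
    intro s
    have h2 : ∀ θ : ℝ, HasDerivAt (fun θ : ℝ => W (y t + θ • (y s - y t)))
        (2 * (T (ψ s) - T (ψ t)) (F (y t + θ • (y s - y t))) +
        f (y t + θ • (y s - y t)) (κ s - κ t)) θ := by
      intro θ
      obtain ⟨L, hL, hL'⟩ := hW (y t + θ • (y s - y t))
      have h3 : HasDerivAt (fun θ : ℝ => y t + θ • (y s - y t)) (y s - y t) θ := by
        simpa using ((hasDerivAt_id θ).smul_const (y s - y t)).const_add (y t)
      have h4 := hL.comp_hasDerivAt θ h3
      rw [hL'] at h4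
      rw [hT', Prod.fst_sub, Prod.snd_sub, hT] at h4
      exact h4
    obtain ⟨θ, hθ, h5⟩ := exists_hasDerivAt_eq_slope _ _ (zero_lt_one (α := ℝ))
      (fun θ _ => (h2 θ).continuousAt.continuousWithinAt) (fun θ _ => h2 θ)
    refine ⟨θ, hθ, ?_⟩
    rw [h5]
    simp
  choose θ hθ hW' using h1
  have h6 : Filter.Tendsto (fun s => y t + θ s • (y s - y t)) (nhdsWithin t {t}ᶜ)
      (nhds (y t)) := by
    have h7 : Filter.Tendsto (fun s => y s - y t) (nhds t) (nhds 0) := by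
      have := (hyc.sub continuous_const).tendsto (f := fun s => y s - y t) t
      simpa using this
    have h8 : Filter.Tendsto (fun s => θ s • (y s - y t)) (nhds t) (nhds 0) := by
      rw [tendsto_zero_iff_norm_tendsto_zero] at h7 ⊢
      refine squeeze_zero (fun _ => norm_nonneg _) (fun s => ?_) h7
      rw [norm_smul, Real.norm_of_nonneg (hθ s).1.le]
      exact mul_le_of_le_one_left (norm_nonneg _) (hθ s).2.le
    have := (h8.const_add (y t)).mono_left (nhdsWithin_le_nhds (s := {t}ᶜ))
    simpa using this
  have hFt := (hF.tendsto (y t)).comp h6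
  have hft := (hf.tendsto (y t)).comp h6
  rw [hasDerivAt_iff_tendsto_slope] at hD hκ ⊢
  -- The difference quotient of T ∘ ψ converges in the dual while its argument F converges in E, so
  -- their pairing converges.
  have h8 := (isBoundedBilinearMap_apply (𝕜 := ℝ) (E := E) (F := ℝ)).continuous.continuousAt.tendsto.comp
    (hD.prodMk_nhds hFt)
  have h7 := (isBoundedBilinearMap_apply (𝕜 := ℝ) (E := V) (F := ℝ)).continuous.continuousAt.tendsto.comp
    (hft.prodMk_nhds hκ)
  have h9 := (h8.const_mul 2).add h7
  refine h9.congr fun s => ?_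
  have h10 := hW' s
  simp only [slope, vsub_eq_sub, Function.comp_apply, smul_apply, smul_eq_mul, map_smul]
  simp only [hy] at h10 ⊢
  rw [h10]
  ring

end ODE

/-! ### The gradient of the energy -/

lemma hasFDerivAt_norm_sq_complex {E : Type*} [NormedAddCommGroup E] [InnerProductSpace ℂ E]
    (x : E) : HasFDerivAt (fun y : E => ‖y‖ ^ 2)
      ((2 : ℝ) • (Complex.reCLM ∘L (innerSL ℂ x).restrictScalars ℝ)) x := by
  let _ : InnerProductSpace ℝ E := InnerProductSpace.rclikeToReal ℂ E
  refine (hasStrictFDerivAt_norm_sq x).hasFDerivAt.congr_fderiv ?_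
  ext y
  simp only [smul_apply, ContinuousLinearMap.comp_apply]
  rw [two_nsmul, smul_eq_mul, two_mul]
  rfl

/-- The functional `h ↦ (∇u, ∇h)`. -/
def kinForm (u : H1 N) : Hm1 N :=
  ∑ c : Coord N, Complex.reCLM ∘L ((innerSL ℂ (wpartial c u)) ∘L wpartial c).restrictScalars ℝ

lemma kinForm_apply (u h : H1 N) :
    kinForm u h = ∑ c : Coord N, (inner ℂ (wpartial c u) (wpartial c h)).re := by
  rw [kinForm, sum_apply]; rfl

lemma continuous_kinForm : Continuous (kinForm : H1 N → Hm1 N) := by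
  refine continuous_finsetSum _ fun c _ => ?_
  have h1 : Continuous fun u : H1 N => (innerSL ℂ (wpartial c u)) ∘L wpartial c :=
    ((innerSL ℂ).continuous.comp (wpartial c).continuous).clm_comp continuous_const
  have h2 : Continuous fun u : H1 N =>
      ((innerSL ℂ (wpartial c u)) ∘L wpartial c).restrictScalars ℝ :=
    (ContinuousLinearMap.restrictScalarsL ℂ (H1 N) ℂ ℝ ℝ).continuous.comp h1
  exact continuous_const.clm_comp h2

lemma continuous_toHm1 : Continuous (toHm1 : H1 N → Hm1 N) := by
  have h1 : Continuous fun u : H1 N => (innerSL ℂ (toL2 u)) ∘L toL2 :=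
    ((innerSL ℂ).continuous.comp toL2.continuous).clm_comp continuous_const
  have h2 : Continuous fun u : H1 N => ((innerSL ℂ (toL2 u)) ∘L toL2).restrictScalars ℝ :=
    (ContinuousLinearMap.restrictScalarsL ℂ (H1 N) ℂ ℝ ℝ).continuous.comp h1
  exact continuous_const.clm_comp h2

lemma toHm1_sub (u v : H1 N) : toHm1 (u - v) = toHm1 u - toHm1 v := by
  ext h
  rw [sub_apply, toHm1_apply, toHm1_apply, toHm1_apply, map_sub, inner_sub_left, Complex.sub_re]

lemma toHm1_comm (u v : H1 N) : toHm1 u v = toHm1 v u := by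
  rw [toHm1_apply, toHm1_apply, ← inner_conj_symm, Complex.conj_re]

lemma pairing_apply (D : Cotangent N) (Y : Tangent N) :
    pairing D Y = D.1 Y.1 + (dotCLM D.2.1 Y.2.1 + dotCLM D.2.2 Y.2.2) := rfl

lemma dotCLM_injective : Function.Injective (dotCLM : IonVec N → _) := by
  intro v w h
  ext n i
  have := congrArg (fun L => L (Pi.single n (Pi.single i 1))) h
  simpa [dotCLM_apply, Pi.single_apply, Finset.sum_ite_eq, apply_ite, ite_apply] using this

/-- Hence the gradient in `IsEnergyGradient` is unique. -/
lemma pairing_injective : Function.Injective (pairing : Cotangent N → _) := by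
  intro D D' h
  have h1 : ∀ Y, pairing D Y = pairing D' Y := fun Y => by rw [h]
  simp only [pairing_apply] at h1
  refine Prod.ext ?_ (Prod.ext (dotCLM_injective ?_) (dotCLM_injective ?_))
  · ext u; simpa using h1 (u, 0, 0)
  · ext κ; simpa using h1 (0, κ, 0)
  · ext p; simpa using h1 (0, 0, p)

/-- The differential of the energy at the state `(ψ, κ mod N, p)`. -/
def gradE (e M : ℝ) (σ : Torus N → ℝ) (Y : Tangent N) : Cotangent N :=
  (kinForm Y.1 + (2 : ℝ) • toHm1 (potF e σ (Y.1, Y.2.1)), forceF e σ (Y.1, Y.2.1), M⁻¹ • Y.2.2)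

/-- The state with wave function, lifted positions and momenta given by `Y`. -/
def toPhase (Y : Tangent N) : Phase N := (Y.1, toIonPos Y.2.1, Y.2.2)

lemma toIonPos_add (κ κ' : IonVec N) : toIonPos (κ + κ') = toIonPos κ + toIonPos κ' :=
  funext fun n => toTorus_add (κ n) (κ' n)

lemma translate_toPhase (Y Z : Tangent N) : translate (toPhase Y) Z = toPhase (Y + Z) := by
  simp [translate, toPhase, toIonPos_add]

lemma hasFDerivAt_sum_norm_sq {E F ι : Type*} [NormedAddCommGroup E] [NormedSpace ℂ E]
    [NormedAddCommGroup F] [InnerProductSpace ℂ F] [Fintype ι] (A : ι → E →L[ℂ] F) (u : E) :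
    HasFDerivAt (fun u : E => 1 / 2 * ∑ c, ‖A c u‖ ^ 2)
      (∑ c, Complex.reCLM ∘L ((innerSL ℂ (A c u)) ∘L A c).restrictScalars ℝ : E →L[ℝ] ℝ) u := by
  have h1 := HasFDerivAt.fun_sum (u := Finset.univ) fun c _ =>
    (hasFDerivAt_norm_sq_complex (A c u)).comp u ((A c).restrictScalars ℝ).hasFDerivAt
  have h2 := h1.const_mul (1 / 2 : ℝ)
  refine h2.congr_fderiv ?_
  ext h
  rw [smul_apply, sum_apply, sum_apply, Finset.smul_sum]
  refine Finset.sum_congr rfl fun c _ => ?_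
  rw [ContinuousLinearMap.comp_apply, smul_apply, smul_smul]
  norm_num

lemma hasFDerivAt_kinetic (u : H1 N) :
    HasFDerivAt (fun u : H1 N => 1 / 2 * ∑ c : Coord N, ‖wpartial c u‖ ^ 2) (kinForm u) u :=
  hasFDerivAt_sum_norm_sq wpartial u

lemma hasFDerivAt_momentum (M : ℝ) (p : IonVec N) :
    HasFDerivAt (fun p : IonVec N => ∑ n : Lattice N, (∑ i, p n i ^ 2) / (2 * M))
      (dotCLM (M⁻¹ • p)) p := by
  have h0 : ∀ n i, HasFDerivAt (fun p : IonVec N => p n i)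
      ((ContinuousLinearMap.proj i : (Fin 3 → ℝ) →L[ℝ] ℝ) ∘L
      (ContinuousLinearMap.proj n : IonVec N →L[ℝ] (Fin 3 → ℝ))) p := fun n i =>
    ((ContinuousLinearMap.proj i : (Fin 3 → ℝ) →L[ℝ] ℝ) ∘L
      (ContinuousLinearMap.proj n : IonVec N →L[ℝ] (Fin 3 → ℝ))).hasFDerivAt
  have h1 := HasFDerivAt.fun_sum (u := Finset.univ) fun (n : Lattice N) _ =>
    (HasFDerivAt.fun_sum (u := Finset.univ) fun (i : Fin 3) _ => (h0 n i).pow 2).mul_const (2 * M)⁻¹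
  simp only [div_eq_mul_inv]
  refine h1.congr_fderiv ?_
  ext h
  simp only [sum_apply, smul_apply, dotCLM_apply, ContinuousLinearMap.comp_apply,
    ContinuousLinearMap.proj_apply, Pi.smul_apply, smul_eq_mul, Finset.mul_sum]
  refine Finset.sum_congr rfl fun n _ => Finset.sum_congr rfl fun i _ => ?_
  rw [mul_inv]
  simp
  ring

lemma hasFDerivAt_energy (e M : ℝ) {σ : Torus N → ℝ} (hσ : IsC2 σ) (Y : Tangent N) :
    HasFDerivAt (fun Y => energy e M σ (toPhase Y)) (pairing (gradE e M σ Y)) Y := by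
  simp only [energy_eq e M hσ]
  obtain ⟨L, hL, hL'⟩ := hasFDerivAt_coulomb' e hσ (Y.1, Y.2.1)
  have h1 := (hasFDerivAt_kinetic Y.1).comp Y (hasFDerivAt_fst (𝕜 := ℝ) (p := Y))
  have h2 := (hasFDerivAt_momentum M Y.2.2).comp Y
    ((hasFDerivAt_snd (𝕜 := ℝ) (p := Y.2)).comp Y (hasFDerivAt_snd (𝕜 := ℝ) (p := Y)))
  have h3 := hL.comp Y ((hasFDerivAt_fst (𝕜 := ℝ) (p := Y)).prodMk
    ((hasFDerivAt_fst (𝕜 := ℝ) (p := Y.2)).comp Y (hasFDerivAt_snd (𝕜 := ℝ) (p := Y))))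
  refine ((h1.add h3).add h2).congr_fderiv ?_
  refine ContinuousLinearMap.ext fun Z => ?_
  have h4 := hL' (Z.1, Z.2.1)
  calc _ = kinForm Y.1 Z.1 + L (Z.1, Z.2.1) + dotCLM (M⁻¹ • Y.2.2) Z.2.2 := rfl
    _ = _ := by
      rw [h4, pairing_apply, gradE, add_apply, smul_apply, smul_eq_mul]
      ring

/-- Replaces the gradient whose existence `IsSolution` asserts by an explicit one, at any lift of
the state. -/
lemma isEnergyGradient_iff (e M : ℝ) {σ : Torus N → ℝ} (hσ : IsC2 σ) (Y : Tangent N)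
    (D : Cotangent N) : IsEnergyGradient e M σ (toPhase Y) D ↔ D = gradE e M σ Y := by
  have h1 : IsEnergyGradient e M σ (toPhase Y) (gradE e M σ Y) := by
    have h2 : HasFDerivAt (fun Y => energy e M σ (toPhase Y)) (pairing (gradE e M σ Y)) (Y + 0) := by
      rw [add_zero]; exact hasFDerivAt_energy e M hσ Y
    have h3 := h2.comp (0 : Tangent N) ((hasFDerivAt_id (𝕜 := ℝ) (0 : Tangent N)).const_add Y)
    rw [IsEnergyGradient]
    simp only [translate_toPhase]
    exact h3
  refine ⟨fun h => pairing_injective (h.unique h1), ?_⟩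
  rintro rfl
  exact h1

lemma exists_toPhase (X : Phase N) : ∃ κ, X = toPhase (X.1, κ, X.2.2) := by
  choose κ hκ using fun n => surjective_toTorus (X.2.1 n)
  exact ⟨κ, Prod.ext rfl (Prod.ext (funext fun n => (hκ n).symm) rfl)⟩

/-! ### Isometries acting on Fourier coefficients -/

lemma memlp_mul_comp_equiv {ι : Type*} {c : ι → ℂ} (hc : ∀ i, ‖c i‖ = 1) (τ : ι ≃ ι)
    (f : lp (fun _ : ι => ℂ) 2) : Memℓp (fun i => c i * f (τ i)) 2 := by
  have h := lp.memℓp f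
  rw [memℓp_gen_iff (by norm_num)] at h ⊢
  simpa [hc, Function.comp_def] using τ.summable_iff.2 h

/-- The isometry of `ℓ²` that multiplies coordinates by unimodular factors and permutes them. -/
def lpIso {ι : Type*} (c : ι → ℂ) (hc : ∀ i, ‖c i‖ = 1) (τ : ι ≃ ι) :
    lp (fun _ : ι => ℂ) 2 →ₗᵢ[ℂ] lp (fun _ : ι => ℂ) 2 where
  toFun f := ⟨fun i => c i * f (τ i), memlp_mul_comp_equiv hc τ f⟩
  map_add' f g := lp.ext (funext fun i => mul_add (c i) (f (τ i)) (g (τ i)))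
  map_smul' a f := lp.ext (funext fun i => mul_left_comm (c i) a (f (τ i)))
  norm_map' f := by
    have h2 : (0 : ℝ) < (2 : ENNReal).toReal := by norm_num
    have h1 : ‖(⟨fun i => c i * f (τ i), memlp_mul_comp_equiv hc τ f⟩ :
        lp (fun _ : ι => ℂ) 2)‖ ^ (2 : ENNReal).toReal = ‖f‖ ^ (2 : ENNReal).toReal := by
      rw [lp.norm_rpow_eq_tsum h2, lp.norm_rpow_eq_tsum h2]
      simp only [norm_mul, hc, one_mul]
      exact τ.tsum_eq (fun i => ‖f i‖ ^ (2 : ENNReal).toReal)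
    exact (Real.rpow_left_inj (norm_nonneg _) (norm_nonneg _) h2.ne').1 h1

/-- The isometry of a Hilbert space that multiplies the coordinates with respect to a basis by
unimodular factors and permutes them. -/
def coordIso {ι E : Type*} [NormedAddCommGroup E] [InnerProductSpace ℂ E] (b : HilbertBasis ι ℂ E)
    (c : ι → ℂ) (hc : ∀ i, ‖c i‖ = 1) (τ : ι ≃ ι) : E →ₗᵢ[ℂ] E :=
  b.repr.symm.toLinearIsometry.comp ((lpIso c hc τ).comp b.repr.toLinearIsometry)

lemma repr_coordIso {ι E : Type*} [NormedAddCommGroup E] [InnerProductSpace ℂ E]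
    (b : HilbertBasis ι ℂ E) (c : ι → ℂ) (hc : ∀ i, ‖c i‖ = 1) (τ : ι ≃ ι) (u : E) (i : ι) :
    b.repr (coordIso b c hc τ u) i = c i * b.repr u (τ i) := by
  have h : b.repr (coordIso b c hc τ u) = lpIso c hc τ (b.repr u) := b.repr.apply_symm_apply _
  rw [h]
  rfl

/-- `A` acts on the Fourier coefficients by unimodular factors and a permutation of the modes that
preserves the kinetic energies. -/
def IsModeIso (c : Modes N → ℂ) (τ : Modes N ≃ Modes N) (A : H1 N →ₗᵢ[ℂ] H1 N) : Prop :=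
  (∀ k, ‖c k‖ = 1) ∧ ∀ u k, fc k (toL2 (A u)) = c k * fc (τ k) (toL2 u)

lemma isModeIso_coordIso {c : Modes N → ℂ} (hc : ∀ i, ‖c i‖ = 1) {τ : Modes N ≃ Modes N}
    (hτ : ∀ k, ksq (τ k) = ksq k) : IsModeIso c τ (coordIso (hb N) c hc τ) := by
  refine ⟨hc, fun u k => ?_⟩
  have h1 := repr_coordIso (hb N) c hc τ u k
  rw [hb_repr_apply, hb_repr_apply, hτ] at h1
  have h2 : (√(1 + ksq k) : ℂ) ≠ 0 := by exact_mod_cast (sqrt_one_add_ksq_pos k).ne'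
  refine mul_left_cancel₀ h2 (h1.trans ?_)
  ring

/-- Parseval: the unimodular factors cancel, and the permutation of the modes only reorders the sum.
-/
lemma IsModeIso.inner_toL2 {c : Modes N → ℂ} {τ : Modes N ≃ Modes N} {A : H1 N →ₗᵢ[ℂ] H1 N}
    (h : IsModeIso c τ A) (u v : H1 N) :
    inner ℂ (toL2 (A u)) (toL2 (A v)) = inner ℂ (toL2 u) (toL2 v) := by
  have h1 := hasSum_fc_inner (toL2 (A u)) (toL2 (A v))
  have h2 := τ.hasSum_iff.2 (hasSum_fc_inner (toL2 u) (toL2 v))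
  refine h1.unique ?_
  convert h2 using 2 with k
  rw [h.2, h.2, star_mul']
  have h3 : star (c k) * c k = 1 := by
    rw [Complex.star_def, ← Complex.normSq_eq_conj_mul_self, Complex.normSq_eq_norm_sq, h.1]
    simp
  simp only [Function.comp_apply]
  linear_combination (star (fc (τ k) (toL2 u)) * fc (τ k) (toL2 v)) * h3

lemma IsModeIso.toHm1 {c : Modes N → ℂ} {τ : Modes N ≃ Modes N} {A : H1 N →ₗᵢ[ℂ] H1 N}
    (h : IsModeIso c τ A) (u v : H1 N) : toHm1 (A u) (A v) = toHm1 u v := by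
  rw [toHm1_apply, toHm1_apply, h.inner_toL2]

/-- Consequently an operator isometric for both the H¹ and the L² product preserves the kinetic
form. -/
lemma kinForm_eq (u v : H1 N) : kinForm u v = (inner ℂ u v).re - toHm1 u v := by
  rw [kinForm_apply, H1_inner_eq, Complex.add_re, Complex.re_sum, toHm1_apply]
  ring

lemma IsModeIso.kinForm {c : Modes N → ℂ} {τ : Modes N ≃ Modes N} {A : H1 N →ₗᵢ[ℂ] H1 N}
    (h : IsModeIso c τ A) (u v : H1 N) : kinForm (A u) (A v) = kinForm u v := by
  rw [kinForm_eq, kinForm_eq, h.toHm1, A.inner_map_map]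

lemma kinForm_self (u : H1 N) : kinForm u u = ∑ c, ‖wpartial c u‖ ^ 2 := by
  rw [kinForm_apply]
  refine Finset.sum_congr rfl fun c _ => ?_
  rw [inner_self_eq_norm_sq_to_K]
  norm_cast

lemma toHm1_self (u : H1 N) : toHm1 u u = ‖toL2 u‖ ^ 2 := by
  rw [toHm1_apply, inner_self_eq_norm_sq_to_K]
  norm_cast

/-! ### The free Schrödinger group -/

/-- The phase factors of the free Schrödinger group. -/
def freePhase (t : ℝ) (k : Modes N) : ℂ := Complex.exp (((-(t * ksq k / 2) : ℝ) : ℂ) * Complex.I)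

lemma norm_freePhase (t : ℝ) (k : Modes N) : ‖freePhase t k‖ = 1 :=
  Complex.norm_exp_ofReal_mul_I _

/-- The free Schrödinger group `e^{itΔ/2}` on `H¹`. -/
def freeU (t : ℝ) : H1 N →ₗᵢ[ℂ] H1 N :=
  coordIso (hb N) (freePhase t) (norm_freePhase t) (Equiv.refl _)

lemma isModeIso_freeU (t : ℝ) : IsModeIso (freePhase t) (Equiv.refl _) (freeU t : H1 N →ₗᵢ[ℂ] H1 N) :=
  isModeIso_coordIso _ fun _ => rfl

lemma fc_freeU (t : ℝ) (u : H1 N) (k : Modes N) :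
    fc k (toL2 (freeU t u)) = freePhase t k * fc k (toL2 u) := (isModeIso_freeU t).2 u k

lemma freeU_zero (u : H1 N) : freeU 0 u = u := by
  refine ext_H1_fc fun k => ?_
  rw [fc_freeU]
  simp [freePhase]

lemma freeU_freeU (s t : ℝ) (u : H1 N) : freeU s (freeU t u) = freeU (s + t) u := by
  refine ext_H1_fc fun k => ?_
  rw [fc_freeU, fc_freeU, fc_freeU, ← mul_assoc]
  congr 1
  rw [freePhase, freePhase, freePhase, ← Complex.exp_add]
  congr 1
  push_cast
  ring

lemma freeU_freeU_neg (t : ℝ) (u : H1 N) : freeU t (freeU (-t) u) = u := by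
  rw [freeU_freeU, add_neg_cancel, freeU_zero]

lemma continuous_freePhase (k : Modes N) : Continuous fun t => freePhase t k := by
  unfold freePhase
  fun_prop

/-- Dominated convergence in the Fourier series of the squared H¹ norm; a difference of two phases
is at most 2. -/
lemma continuous_freeU_apply (u : H1 N) : Continuous fun t => freeU t u := by
  refine continuous_iff_continuousAt.2 fun t => ?_
  refine tendsto_iff_norm_sub_tendsto_zero.2 ?_
  have h1 : ∀ s, ‖freeU s u - freeU t u‖ ^ 2 =
      ∑' k, (1 + ksq k) * ‖(freePhase s k - freePhase t k) * fc k (toL2 u)‖ ^ 2 := by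
    intro s
    rw [← (hasSum_H1_sq _).tsum_eq]
    simp only [map_sub, fc_freeU, sub_mul]
  have h2 : Filter.Tendsto (fun s => ‖freeU s u - freeU t u‖ ^ 2) (nhds t)
      (nhds (∑' k : Modes N, (0 : ℝ))) := by
    simp only [h1]
    refine tendsto_tsum_of_dominated_convergence
      (bound := fun k => 4 * ((1 + ksq k) * ‖fc k (toL2 u)‖ ^ 2))
      ((hasSum_H1_sq u).summable.mul_left 4) (fun k => ?_) (Filter.Eventually.of_forall fun s k => ?_)
    · have h3 : Continuous fun s =>
          (1 + ksq k) * ‖(freePhase s k - freePhase t k) * fc k (toL2 u)‖ ^ 2 := by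
        have := continuous_freePhase k
        fun_prop
      have := h3.tendsto t
      simpa using this
    · have hk := ksq_nonneg k
      rw [Real.norm_of_nonneg (by positivity), norm_mul, mul_pow]
      have h4 : ‖freePhase s k - freePhase t k‖ ≤ 2 := by
        refine (norm_sub_le _ _).trans ?_
        rw [norm_freePhase, norm_freePhase]; norm_num
      have h5 : ‖freePhase s k - freePhase t k‖ ^ 2 ≤ 4 := by
        nlinarith [norm_nonneg (freePhase s k - freePhase t k)]
      have h6 := mul_le_mul_of_nonneg_right h5
        (show 0 ≤ (1 + ksq k) * ‖fc k (toL2 u)‖ ^ 2 by positivity)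
      linarith
  rw [tsum_zero] at h2
  have h3 := h2.sqrt
  simpa using h3

/-- Strong continuity becomes joint continuity because every `freeU t` is an isometry. -/
lemma continuous_freeU : Continuous fun p : ℝ × H1 N => freeU p.1 p.2 := by
  refine continuous_iff_continuousAt.2 fun p => ?_
  refine tendsto_iff_norm_sub_tendsto_zero.2 ?_
  have h1 : Continuous fun q : ℝ × H1 N => ‖q.2 - p.2‖ + ‖freeU q.1 p.2 - freeU p.1 p.2‖ :=
    (continuous_snd.sub continuous_const).norm.add
      (((continuous_freeU_apply p.2).comp continuous_fst).sub continuous_const).norm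
  have h2 := h1.tendsto p
  simp only [sub_self, norm_zero, add_zero] at h2
  refine squeeze_zero (fun _ => norm_nonneg _) (fun q => ?_) h2
  have h3 : freeU q.1 q.2 - freeU p.1 p.2 =
      freeU q.1 (q.2 - p.2) + (freeU q.1 p.2 - freeU p.1 p.2) := by
    rw [map_sub]; abel
  rw [h3]
  refine (norm_add_le _ _).trans ?_
  rw [LinearIsometry.norm_map]

/-! ### The interaction picture -/

lemma continuous_of_lipschitz_on_bounded {E F : Type*} [NormedAddCommGroup E]
    [NormedAddCommGroup F] {f : E → F} {g : E → ℝ} (hg : Continuous g)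
    (h : ∀ R, ∃ C, ∀ x y, g x ≤ R → g y ≤ R → ‖f x - f y‖ ≤ C * ‖x - y‖) : Continuous f := by
  refine continuous_iff_continuousAt.2 fun y => ?_
  obtain ⟨C, hC⟩ := h (g y + 1)
  refine tendsto_iff_norm_sub_tendsto_zero.2 ?_
  have h1 : Continuous fun x => C * ‖x - y‖ := by fun_prop
  have h2 := h1.tendsto y
  simp only [sub_self, norm_zero, mul_zero] at h2
  refine squeeze_zero' (Filter.Eventually.of_forall fun _ => norm_nonneg _) ?_ h2
  filter_upwards [(hg.tendsto y).eventually (gt_mem_nhds (lt_add_one (g y)))] with x hx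
  exact hC x y hx.le (lt_add_one _).le

lemma continuous_potF (e : ℝ) {σ : Torus N → ℝ} (hσ : IsC2 σ) : Continuous (potF e σ) := by
  refine continuous_of_lipschitz_on_bounded (g := fun Y : H1 N × IonVec N => ‖Y.1‖)
    (continuous_fst.norm) fun R => ?_
  obtain ⟨C, -, -, hC⟩ := exists_force_bounds e hσ R
  exact ⟨C, fun x y hx hy => (hC x y hx hy).1⟩

lemma continuous_forceF (e : ℝ) {σ : Torus N → ℝ} (hσ : IsC2 σ) : Continuous (forceF e σ) := by
  refine continuous_of_lipschitz_on_bounded (g := fun Y : H1 N × IonVec N => ‖Y.1‖)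
    (continuous_fst.norm) fun R => ?_
  obtain ⟨C, -, -, hC⟩ := exists_force_bounds e hσ R
  exact ⟨C, fun x y hx hy => (hC x y hx hy).2⟩

/-- The passage from the interaction picture to the Schrödinger picture. -/
def schr (t : ℝ) (Y : Tangent N) : Tangent N := (freeU t Y.1, Y.2)

/-- The vector field of the system in the interaction picture. -/
def field (e M : ℝ) (σ : Torus N → ℝ) (t : ℝ) (Y : Tangent N) : Tangent N :=
  (freeU (-t) ((-Complex.I) • potF e σ (freeU t Y.1, Y.2.1)), M⁻¹ • Y.2.2,
    -forceF e σ (freeU t Y.1, Y.2.1))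

lemma continuous_neg_I_smul {α : Type*} [TopologicalSpace α] {f : α → H1 N} (hf : Continuous f) :
    Continuous fun a => (-Complex.I) • f a := by
  have h1 := continuous_const_smul (T := H1 N) (-Complex.I)
  have h2 := h1.comp hf
  exact h2

lemma continuous_freeU_comp {τ : ℝ → ℝ} {f : ℝ → H1 N} (hτ : Continuous τ) (hf : Continuous f) :
    Continuous fun t => freeU (τ t) (f t) := by
  have h1 : Continuous fun t => (τ t, f t) := hτ.prodMk hf
  have h2 := (continuous_freeU (N := N)).comp h1
  exact h2

lemma continuous_schr_fst {Y : ℝ → Tangent N} (hY : Continuous Y) :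
    Continuous fun t => (freeU t (Y t).1, (Y t).2.1) :=
  (continuous_freeU_comp continuous_id hY.fst).prodMk hY.snd.fst

lemma continuous_schr {Y : ℝ → Tangent N} (hY : Continuous Y) :
    Continuous fun t => schr t (Y t) :=
  (continuous_freeU_comp continuous_id hY.fst).prodMk hY.snd

lemma continuous_field (e M : ℝ) {σ : Torus N → ℝ} (hσ : IsC2 σ) {Y : ℝ → Tangent N}
    (hY : Continuous Y) : Continuous fun t => field e M σ t (Y t) := by
  have h1 := continuous_schr_fst hY
  have h2 := (continuous_potF e hσ).comp h1
  have h3 : Continuous fun t => M⁻¹ • (Y t).2.2 := hY.snd.snd.const_smul M⁻¹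
  have h4 := ((continuous_forceF e hσ).comp h1).neg
  have h5 := continuous_freeU_comp continuous_neg (continuous_neg_I_smul h2)
  have h6 := h5.prodMk (h3.prodMk h4)
  exact h6

lemma toHm1_smul_hmode (u : H1 N) (k : Modes N) (c : ℂ) :
    toHm1 u (c • hmode k) = (c * star (fc k (toL2 u))).re := by
  rw [toHm1_apply, map_smul, toL2_hmode, inner_smul_right, fc_apply, Complex.star_def,
    inner_conj_symm]

lemma kinForm_smul_hmode (u : H1 N) (k : Modes N) (c : ℂ) :
    kinForm u (c • hmode k) = ksq k * (c * star (fc k (toL2 u))).re := by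
  rw [kinForm_eq, toHm1_smul_hmode]
  have h1 := inner_smul_right (𝕜 := ℂ) u (hmode k) c
  have h2 : inner ℂ u (hmode k) = (1 + ksq k : ℝ) * star (fc k (toL2 u)) := by
    have h3 := inner_conj_symm (𝕜 := ℂ) u (hmode k)
    rw [inner_hmode, map_mul, Complex.conj_ofReal] at h3
    exact h3.symm
  rw [h1, h2, mul_left_comm, Complex.re_ofReal_mul]
  ring

/-- The `H⁻¹` velocity of the wave function. -/
def waveVel (u F : H1 N) : Hm1 N := cmul (-Complex.I / 2) (kinForm u + (2 : ℝ) • toHm1 F)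

lemma cmul_apply (c : ℂ) (η : Hm1 N) (h : H1 N) : cmul c η h = η (star c • h) := rfl

/-- In mode k the equation reads ψ̂′ = −i(|ξ|²/2)ψ̂ − iF̂; the arbitrary multiple c recovers a
complex number from real functionals. -/
lemma waveVel_smul_hmode (u F : H1 N) (k : Modes N) (c : ℂ) :
    waveVel u F (c • hmode k) = (c * star (-(Complex.I * (ksq k / 2 : ℝ)) * fc k (toL2 u)
      - Complex.I * fc k (toL2 F))).re := by
  rw [waveVel, cmul_apply, smul_smul, add_apply, smul_apply, kinForm_smul_hmode, toHm1_smul_hmode]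
  simp [Complex.mul_re, Complex.mul_im]
  ring

lemma continuous_waveVel : Continuous fun p : H1 N × H1 N => waveVel p.1 p.2 := by
  have h1 : Continuous fun p : H1 N × H1 N => kinForm p.1 + (2 : ℝ) • toHm1 p.2 :=
    (continuous_kinForm.comp continuous_fst).add
      ((continuous_toHm1.comp continuous_snd).const_smul (2 : ℝ))
  exact h1.clm_comp continuous_const

lemma symplJ_gradE (e M : ℝ) (σ : Torus N → ℝ) (Y : Tangent N) :
    symplJ (gradE e M σ Y) = (waveVel Y.1 (potF e σ (Y.1, Y.2.1)), M⁻¹ • Y.2.2,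
      -forceF e σ (Y.1, Y.2.1)) := rfl

lemma hasDerivAt_complex_iff {a : ℝ → ℂ} {d : ℂ} {t : ℝ} :
    HasDerivAt a d t ↔ ∀ c : ℂ, HasDerivAt (fun s => (c * star (a s)).re) (c * star d).re t := by
  constructor
  · intro h c
    have h1 := h.star.const_mul c
    exact Complex.reCLM.hasFDerivAt.comp_hasDerivAt t h1
  · intro h
    have h1 : HasDerivAt (fun s => (a s).re) d.re t := by simpa using h 1
    have h2 : HasDerivAt (fun s => (a s).im) d.im t := by simpa using h Complex.I
    have h3 := h1.ofReal_comp.add (h2.ofReal_comp.mul_const Complex.I)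
    rw [Complex.re_add_im] at h3
    refine h3.congr_of_eventuallyEq (Filter.Eventually.of_forall fun s => ?_)
    exact (Complex.re_add_im (a s)).symm

lemma hasDerivAt_freePhase (t : ℝ) (k : Modes N) : HasDerivAt (fun t => freePhase t k)
    (-(Complex.I * (ksq k / 2 : ℝ)) * freePhase t k) t := by
  have h1 : HasDerivAt (fun t : ℝ => ((-(t * ksq k / 2) : ℝ) : ℂ) * Complex.I)
      ((-(ksq k / 2) : ℝ) * Complex.I) t := by
    refine (HasDerivAt.ofReal_comp ?_).mul_const Complex.I
    have := ((hasDerivAt_id t).mul_const (ksq k / 2)).neg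
    simp only [id_eq, one_mul] at this
    refine this.congr_of_eventuallyEq (Filter.Eventually.of_forall fun s => ?_)
    simp; ring
  refine h1.cexp.congr_deriv ?_
  rw [freePhase]
  push_cast
  ring

lemma freePhase_neg_mul (t : ℝ) (k : Modes N) : freePhase (-t) k * freePhase t k = 1 := by
  rw [freePhase, freePhase, ← Complex.exp_add, ← add_mul, ← Complex.ofReal_add,
    show -(-t * ksq k / 2) + -(t * ksq k / 2) = 0 by ring]
  simp

/-- The Fourier coefficients of elements of `H¹` as real linear functionals. -/
def fcR (k : Modes N) : H1 N →L[ℝ] ℂ := (fc k ∘L toL2 : H1 N →L[ℂ] ℂ).restrictScalars ℝ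

lemma fcR_apply (k : Modes N) (u : H1 N) : fcR k u = fc k (toL2 u) := rfl

/-- Evaluation at the multiples of the modes. -/
def evalMode (p : Modes N × ℂ) : Hm1 N →L[ℝ] ℝ :=
  ContinuousLinearMap.apply ℝ ℝ (p.2 • hmode p.1 : H1 N)

lemma evalMode_apply (p : Modes N × ℂ) (η : Hm1 N) : evalMode p η = η (p.2 • hmode p.1) := rfl

/-- Upgrades differentiation mode by mode to differentiation in H¹; this is what continuity of g in
H¹ is for. -/
lemma hasDerivAt_of_fc {φ g : ℝ → H1 N} (hg : Continuous g)
    (h : ∀ k t, HasDerivAt (fun s => fcR k (φ s)) (fcR k (g t)) t) (t : ℝ) :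
    HasDerivAt φ (g t) t :=
  hasDerivAt_of_separating fcR (fun _ _ hxy => ext_H1_fc hxy) hg h t

lemma hasDerivAt_of_evalMode {φ g : ℝ → Hm1 N} (hg : Continuous g)
    (h : ∀ k t, HasDerivAt (fun s => evalMode k (φ s)) (evalMode k (g t)) t) (t : ℝ) :
    HasDerivAt φ (g t) t :=
  hasDerivAt_of_separating evalMode (fun _ _ hxy => ext_Hm1 fun k c => hxy (k, c)) hg h t

lemma hasDerivAt_functional_apply {E : Type*} [NormedAddCommGroup E] [NormedSpace ℝ E]
    {η : ℝ → E →L[ℝ] ℝ} {D : E →L[ℝ] ℝ} {t : ℝ} (h : HasDerivAt η D t) (x : E) :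
    HasDerivAt (fun s => η s x) (D x) t := by
  simpa using h.clm_apply (hasDerivAt_const t x)

lemma hasDerivAt_toHm1_apply {ψ : ℝ → H1 N} {D : Hm1 N} {t : ℝ}
    (h : HasDerivAt (fun s => toHm1 (ψ s)) D t) (x : H1 N) :
    HasDerivAt (fun s => toHm1 (ψ s) x) (D x) t := hasDerivAt_functional_apply h x

/-- The equation for the wave function in `H⁻¹` is equivalent to the one in the interaction
picture. -/
lemma hasDerivAt_interaction {φ F : ℝ → H1 N} (hF : Continuous F)
    (h : ∀ t, HasDerivAt (fun s => toHm1 (freeU s (φ s))) (waveVel (freeU t (φ t)) (F t)) t)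
    (t : ℝ) : HasDerivAt φ (freeU (-t) ((-Complex.I) • F t)) t := by
  have hg : Continuous fun t => freeU (-t) ((-Complex.I) • F t) :=
    continuous_freeU_comp continuous_neg (continuous_neg_I_smul hF)
  refine hasDerivAt_of_fc hg (fun k t => ?_) t
  simp only [fcR_apply]
  have h1 : HasDerivAt (fun s => fc k (toL2 (freeU s (φ s))))
      (-(Complex.I * (ksq k / 2 : ℝ)) * fc k (toL2 (freeU t (φ t))) - Complex.I * fc k (toL2 (F t)))
      t := by
    refine hasDerivAt_complex_iff.2 fun c => ?_
    have h2 := hasDerivAt_toHm1_apply (h t) (c • hmode k)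
    simp only [waveVel_smul_hmode, toHm1_smul_hmode] at h2
    exact h2
  -- Multiplication by e^{it|ξ|²/2} cancels the Laplacian term.
  have h3 := ((hasDerivAt_freePhase (-t) k).scomp t (hasDerivAt_neg t)).mul h1
  refine (h3.congr_of_eventuallyEq (Filter.Eventually.of_forall fun s => ?_)).congr_deriv ?_
  · simp only [Function.comp_def, fc_freeU, Pi.mul_apply]
    rw [← mul_assoc, freePhase_neg_mul, one_mul]
  · simp only [fc_freeU, map_smul, smul_eq_mul, Function.comp_apply, Complex.real_smul]
    push_cast
    ring

/-- The converse of `hasDerivAt_interaction`. The candidate velocity is continuous in H⁻¹, so it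
suffices to test with multiples of the modes, which separate functionals by `ext_Hm1`. -/
lemma hasDerivAt_schroedinger {φ F : ℝ → H1 N} (hF : Continuous F)
    (h : ∀ t, HasDerivAt φ (freeU (-t) ((-Complex.I) • F t)) t) (t : ℝ) :
    HasDerivAt (fun s => toHm1 (freeU s (φ s))) (waveVel (freeU t (φ t)) (F t)) t := by
  have hφ : Continuous φ := continuous_iff_continuousAt.2 fun t => (h t).continuousAt
  have h0 := (continuous_freeU_comp continuous_id hφ).prodMk hF
  have h1 := (continuous_waveVel (N := N)).comp h0
  have hg : Continuous fun t => waveVel (freeU t (φ t)) (F t) := by exact h1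
  refine hasDerivAt_of_evalMode hg (fun p t => ?_) t
  obtain ⟨k, c⟩ := p
  simp only [evalMode_apply, waveVel_smul_hmode, toHm1_smul_hmode]
  refine hasDerivAt_complex_iff.1 ?_ c
  have h1 : HasDerivAt (fun s => fc k (toL2 (φ s)))
      (fc k (toL2 (freeU (-t) ((-Complex.I) • F t)))) t :=
    (fcR k).hasFDerivAt.comp_hasDerivAt t (h t)
  have h2 := (hasDerivAt_freePhase t k).mul h1
  refine (h2.congr_of_eventuallyEq (Filter.Eventually.of_forall fun s => ?_)).congr_deriv ?_
  · simp only [fc_freeU, Pi.mul_apply]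
  · simp only [fc_freeU, map_smul, smul_eq_mul]
    have h3 := freePhase_neg_mul t k
    linear_combination (-Complex.I * fc k (toL2 (F t))) * h3

/-! ### Lifting the ion positions from the torus -/

lemma norm_addCircle_coe_le (x : ℝ) : ‖(x : AddCircle (N : ℝ))‖ ≤ |x| :=
  QuotientAddGroup.norm_mk_le_norm

/-- A curve in the torus is determined by its velocity. -/
lemma eq_toIonPos_of_velocity {q : ℝ → IonPos N} {κ v : ℝ → IonVec N}
    (hq : ∀ t, HasTorusVelocity q (v t) t) (hκ : ∀ t, HasDerivAt κ (v t) t)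
    (h0 : q 0 = toIonPos (κ 0)) (t : ℝ) : q t = toIonPos (κ t) := by
  ext n i
  set d : ℝ → AddCircle (N : ℝ) := fun s => q s n i - ((κ s n i : ℝ) : AddCircle (N : ℝ)) with hd
  have hd0 : d 0 = 0 := by
    simp only [hd, h0]
    exact sub_self _
  -- The lift r of q may change with the time t. For each t the increments of r − κ dominate those
  -- of ‖d‖ and are o(s − t), so ‖d‖ has derivative zero.
  have h1 : ∀ t, HasDerivAt (fun s => ‖d s‖) 0 t := by
    intro t
    obtain ⟨r, hr, hr'⟩ := hq t
    have h2 := (hasDerivAt_pi.1 (hasDerivAt_pi.1 (hr'.sub (hκ t)) n) i)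
    have h3 : ∀ s, |(‖d s‖ - ‖d t‖)| ≤ |(r s - κ s) n i - (r t - κ t) n i| := by
      intro s
      refine (abs_norm_sub_norm_le _ _).trans ?_
      have h4 : ∀ s, d s = (((r s - κ s) n i : ℝ) : AddCircle (N : ℝ)) := by
        intro s
        simp only [hd, ← hr s]
        rfl
      rw [h4, h4, ← AddCircle.coe_sub]
      exact norm_addCircle_coe_le _
    rw [sub_self] at h2
    rw [hasDerivAt_iff_isLittleO] at h2 ⊢
    refine Asymptotics.IsBigO.trans_isLittleO (Asymptotics.IsBigO.of_bound 1
      (Filter.Eventually.of_forall fun s => ?_)) h2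
    simpa using h3 s
  have h5 := is_const_of_deriv_eq_zero (fun t => (h1 t).differentiableAt)
    (fun t => (h1 t).deriv) t 0
  simp only [hd0, norm_zero, norm_eq_zero] at h5
  exact sub_eq_zero.1 h5

/-! ### Solutions as images of integral curves -/

/-- `Y` is an integral curve of the system in the interaction picture. -/
def IsCurve (e M : ℝ) (σ : Torus N → ℝ) (Y : ℝ → Tangent N) : Prop :=
  ∀ t, HasDerivAt Y (field e M σ t (Y t)) t

lemma IsCurve.continuous {e M : ℝ} {σ : Torus N → ℝ} {Y : ℝ → Tangent N} (h : IsCurve e M σ Y) :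
    Continuous Y := continuous_iff_continuousAt.2 fun t => (h t).continuousAt

lemma hasVelocity_of_isSolution {e M : ℝ} {σ : Torus N → ℝ} (hσ : IsC2 σ) {X : ℝ → Phase N}
    (h : IsSolution e M σ X) {t : ℝ} {Y : Tangent N} (hY : X t = toPhase Y) :
    HasVelocity X (waveVel Y.1 (potF e σ (Y.1, Y.2.1)), M⁻¹ • Y.2.2,
      -forceF e σ (Y.1, Y.2.1)) t := by
  obtain ⟨D, hD, hv⟩ := h t
  rw [hY, isEnergyGradient_iff e M hσ] at hD
  rwa [hD, symplJ_gradE] at hv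

lemma hasDerivAt_integral_of_continuous {E : Type*} [NormedAddCommGroup E] [NormedSpace ℝ E]
    [CompleteSpace E] {v : ℝ → E} (hv : Continuous v) (x : E) :
    ∃ κ : ℝ → E, κ 0 = x ∧ ∀ t, HasDerivAt κ (v t) t := by
  refine ⟨fun s => x + ∫ τ in (0 : ℝ)..s, v τ, by simp, fun t => ?_⟩
  have := (intervalIntegral.integral_hasDerivAt_right (hv.intervalIntegrable 0 t)
    hv.aestronglyMeasurable.stronglyMeasurableAtFilter hv.continuousAt).const_add x
  simpa using this

/-- The positions are lifted by integrating p/M from the given lift of the initial positions, and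
the wave function is pulled back by the free group. Uniqueness of solutions is thereby reduced to
`IsCurve.eq`. -/
lemma exists_isCurve {e M : ℝ} {σ : Torus N → ℝ} (hσ : IsC2 σ) {X : ℝ → Phase N}
    (hX : Continuous X) (h : IsSolution e M σ X) {κ₀ : IonVec N}
    (h0 : X 0 = toPhase ((X 0).1, κ₀, (X 0).2.2)) :
    ∃ Y : ℝ → Tangent N, Y 0 = ((X 0).1, κ₀, (X 0).2.2) ∧ IsCurve e M σ Y ∧
      ∀ t, X t = toPhase (schr t (Y t)) := by
  have hp : Continuous fun t => M⁻¹ • (X t).2.2 := hX.snd.snd.const_smul M⁻¹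
  obtain ⟨κ, hκ0, hκ⟩ := hasDerivAt_integral_of_continuous hp κ₀
  have hκc : Continuous κ := continuous_iff_continuousAt.2 fun t => (hκ t).continuousAt
  have hq : ∀ t, (X t).2.1 = toIonPos (κ t) := by
    refine eq_toIonPos_of_velocity (fun t => ?_) hκ ?_
    · obtain ⟨κ', hκ'⟩ := exists_toPhase (X t)
      exact (hasVelocity_of_isSolution hσ h hκ').2.1
    · rw [hκ0]
      exact congrArg (fun Z : Phase N => Z.2.1) h0
  have hXe : ∀ t, X t = toPhase ((X t).1, κ t, (X t).2.2) := fun t =>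
    Prod.ext rfl (Prod.ext (hq t) rfl)
  have hv := fun t => hasVelocity_of_isSolution hσ h (hXe t)
  have hF0 : Continuous fun t => ((X t).1, κ t) := hX.fst.prodMk hκc
  have hF := (continuous_potF e hσ).comp hF0
  have hU : ∀ t, freeU t (freeU (-t) (X t).1) = (X t).1 := fun t => freeU_freeU_neg t _
  have hφ := hasDerivAt_interaction (φ := fun t => freeU (-t) (X t).1) hF (fun t => by
    simp only [hU]
    exact (hv t).1)
  refine ⟨fun t => (freeU (-t) (X t).1, κ t, (X t).2.2), ?_, fun t => ?_, fun t => ?_⟩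
  · simp only [neg_zero, freeU_zero, hκ0]
  · have h1 := (hφ t).prodMk ((hκ t).prodMk (hv t).2.2)
    rw [field]
    simp only [hU]
    exact h1
  · rw [schr]
    simp only [hU]
    exact hXe t

lemma IsCurve.isSolution {e M : ℝ} {σ : Torus N → ℝ} (hσ : IsC2 σ) {Y : ℝ → Tangent N}
    (h : IsCurve e M σ Y) : IsSolution e M σ fun t => toPhase (schr t (Y t)) := by
  have hF := (continuous_potF e hσ).comp (continuous_schr_fst h.continuous)
  have h1 : ∀ t, HasDerivAt (fun s => (Y s).1)
      (freeU (-t) ((-Complex.I) • potF e σ (freeU t (Y t).1, (Y t).2.1))) t := fun t => (h t).fst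
  have h2 := hasDerivAt_schroedinger hF h1
  intro t
  refine ⟨gradE e M σ (schr t (Y t)), (isEnergyGradient_iff e M hσ _ _).2 rfl, ?_⟩
  rw [symplJ_gradE]
  exact ⟨h2 t, ⟨fun s => (Y s).2.1, fun s => rfl, (h t).snd.fst⟩, (h t).snd.snd⟩

lemma continuous_toTorus : Continuous (toTorus N) :=
  continuous_pi fun i => (AddCircle.continuous_mk' _).comp (continuous_apply i)

lemma continuous_toIonPos : Continuous (toIonPos : IonVec N → IonPos N) :=
  continuous_pi fun n => continuous_toTorus.comp (continuous_apply n)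

lemma IsCurve.continuous_toPhase {e M : ℝ} {σ : Torus N → ℝ} {Y : ℝ → Tangent N}
    (h : IsCurve e M σ Y) : Continuous fun t => toPhase (schr t (Y t)) := by
  have h1 := continuous_schr h.continuous
  have h2 := (continuous_toIonPos (N := N)).comp h1.snd.fst
  have h3 := h1.fst.prodMk (h2.prodMk h1.snd.snd)
  exact h3

/-! ### Conservation laws -/

/-- The potential is real, so (ψ, Vψ) is real and −iVψ is orthogonal to ψ in the real scalar
product: the reason for charge conservation. -/
lemma toHm1_potF_smul_I (e : ℝ) {σ : Torus N → ℝ} (hσ : IsC2 σ) (Y : H1 N × IonVec N) :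
    toHm1 Y.1 ((-Complex.I) • potF e σ Y) = 0 := by
  have h1 : HasSum (fun m => inner ℂ (toL2 Y.1) (toL2 (potTerm e σ m Y)))
      (inner ℂ (toL2 Y.1) (toL2 (potF e σ Y))) :=
    (innerSL ℂ (toL2 Y.1)).hasSum (toL2.hasSum (summable_potTerm e hσ Y).hasSum)
  have h2 : ∀ m, (inner ℂ (toL2 Y.1) (toL2 (potTerm e σ m Y))).im = 0 := by
    intro m
    rw [potTerm, map_smul, inner_smul_right, Complex.im_ofReal_mul, ← inner_conj_symm,
      Complex.conj_im, inner_potMul_self, neg_zero, mul_zero]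
  have h3 := Complex.hasSum_im h1
  simp only [h2] at h3
  have h4 := h3.unique hasSum_zero
  rw [toHm1_apply, map_smul, inner_smul_right]
  simp [h4]

lemma hasFDerivAt_charge (u : H1 N) :
    HasFDerivAt (fun u : H1 N => 1 / 2 * ‖toL2 u‖ ^ 2) (toHm1 u) u := by
  have h := hasFDerivAt_sum_norm_sq (fun _ : Unit => (toL2 : H1 N →L[ℂ] L2 N)) u
  simp only [Finset.univ_unique, Finset.sum_singleton] at h
  exact h

lemma continuous_dotCLM : Continuous (dotCLM : IonVec N → IonVec N →L[ℝ] ℝ) := by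
  unfold dotCLM
  fun_prop

lemma dotCLM_comm (v w : IonVec N) : dotCLM v w = dotCLM w v := by
  simp only [dotCLM_apply, mul_comm]

lemma toHm1_I_smul_self (u : H1 N) : toHm1 u (Complex.I • u) = 0 := by
  rw [toHm1_apply, map_smul, inner_smul_right, inner_self_eq_norm_sq_to_K]
  have h : ((‖toL2 u‖ : ℂ) ^ 2).im = 0 := by rw [← Complex.ofReal_pow, Complex.ofReal_im]
  simpa using h

/-- The pairing of F with iF vanishes, so only the Laplacian contributes. The result is the rate of
change of the Coulomb energy due to ψ, which cancels against that of the kinetic energy. -/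
lemma two_mul_waveVel (u F : H1 N) : 2 * waveVel u F F = kinForm u (Complex.I • F) := by
  have h1 : (star (-Complex.I / 2)) • F + (star (-Complex.I / 2)) • F = Complex.I • F := by
    have h2 := add_smul (star (-Complex.I / 2)) (star (-Complex.I / 2)) F
    have h3 : star (-Complex.I / 2) + star (-Complex.I / 2) = Complex.I := by
      simp
    rw [h3] at h2
    exact h2.symm
  have h4 : toHm1 F (star (-Complex.I / 2) • F) = 0 := by
    have h5 := toHm1_I_smul_self F
    rw [← h1, map_add] at h5
    linarith
  rw [waveVel, cmul_apply, add_apply, smul_apply, h4, smul_zero, add_zero, two_mul, ← map_add, h1]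

section Conservation

variable {e M : ℝ} {σ : Torus N → ℝ} {φ G : ℝ → H1 N} {κ p : ℝ → IonVec N} {t : ℝ}

/-- Conservation of the charge. -/
lemma hasDerivAt_charge_curve (hσ : IsC2 σ)
    (hφ : HasDerivAt φ (freeU (-t) ((-Complex.I) • G t)) t)
    (hG : G t = potF e σ (freeU t (φ t), κ t)) :
    HasDerivAt (fun s => 1 / 2 * ‖toL2 (freeU s (φ s))‖ ^ 2) 0 t := by
  -- The free group preserves the charge, so it is enough to differentiate along φ, which is
  -- differentiable in H¹.
  have h1 := (hasFDerivAt_charge (φ t)).comp_hasDerivAt t hφ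
  have h2 : toHm1 (φ t) (freeU (-t) ((-Complex.I) • G t)) = 0 := by
    rw [← (isModeIso_freeU t).toHm1, freeU_freeU_neg, hG]
    exact toHm1_potF_smul_I e hσ (freeU t (φ t), κ t)
  rw [h2] at h1
  refine h1.congr_of_eventuallyEq (Filter.Eventually.of_forall fun s => ?_)
  simp only [Function.comp_apply, ← toHm1_self, (isModeIso_freeU s).toHm1]

/-- Conservation of the energy. -/
lemma hasDerivAt_energy_curve (hσ : IsC2 σ) (hGc : Continuous G) (hκc : Continuous κ)
    (hφ : ∀ t, HasDerivAt φ (freeU (-t) ((-Complex.I) • G t)) t)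
    (hG : G t = potF e σ (freeU t (φ t), κ t)) (hκ : HasDerivAt κ (M⁻¹ • p t) t)
    (hp : HasDerivAt p (-forceF e σ (freeU t (φ t), κ t)) t) :
    HasDerivAt (fun s => energy e M σ (toPhase (freeU s (φ s), κ s, p s))) 0 t := by
  have hφc : Continuous φ := continuous_iff_continuousAt.2 fun t => (hφ t).continuousAt
  -- The kinetic energy is invariant under the free group and is differentiated along φ. The Coulomb
  -- energy has to be differentiated along ψ = `freeU s (φ s)`, whose velocity is given only in H⁻¹;
  -- hence the weak chain rule.
  have h1 := (hasFDerivAt_kinetic (φ t)).comp_hasDerivAt t (hφ t)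
  have h2 := hasDerivAt_comp_weak (T := toHm1) toHm1_sub toHm1_comm (continuous_potF e hσ)
    (f := fun y => dotCLM (forceF e σ y))
    (continuous_dotCLM.comp (continuous_forceF e hσ)) (hasFDerivAt_coulomb' e hσ)
    (continuous_freeU_comp continuous_id hφc) hκc (hasDerivAt_schroedinger hGc hφ t) hκ
  have h3 := (hasFDerivAt_momentum M (p t)).comp_hasDerivAt t hp
  have h4 : kinForm (φ t) (freeU (-t) ((-Complex.I) • G t)) = -kinForm (freeU t (φ t)) (Complex.I • G t) := by
    rw [← (isModeIso_freeU t).kinForm, freeU_freeU_neg, ← map_neg]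
    congr 1
    exact neg_smul Complex.I (G t)
  have h5 := (h1.add h2).add h3
  refine (h5.congr_of_eventuallyEq (Filter.Eventually.of_forall fun s => ?_)).congr_deriv ?_
  · simp only [energy_eq e M hσ, toPhase, Pi.add_apply, Function.comp_apply, ← kinForm_self,
      (isModeIso_freeU s).kinForm]
    rfl
  -- The terms ∓(∇ψ, ∇(iG)) of the kinetic and the Coulomb energy cancel, and so do the terms
  -- ±`forceF`·p/M of the Coulomb energy and of the ions.
  · simp only [id_eq]
    rw [← hG, two_mul_waveVel, h4, map_neg, dotCLM_comm (M⁻¹ • p t)]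
    ring

end Conservation

/-! ### Global existence and uniqueness -/

lemma norm_neg_I_smul (u : H1 N) : ‖(-Complex.I) • u‖ = ‖u‖ := by
  have h := norm_smul (-Complex.I) u
  rw [norm_neg, Complex.norm_I, one_mul] at h
  exact h

lemma norm_fst_snd_sub_le (a b : H1 N) (Y Y' : Tangent N) (h : ‖a - b‖ ≤ ‖Y.1 - Y'.1‖) :
    ‖(a, Y.2.1) - (b, Y'.2.1)‖ ≤ ‖Y - Y'‖ := by
  rw [Prod.mk_sub_mk, Prod.norm_mk]
  refine max_le (h.trans (norm_fst_le (Y - Y'))) ?_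
  exact (norm_fst_le (Y - Y').2).trans (norm_snd_le (Y - Y'))

/-- The bounds are uniform in time because the free group is isometric. The positions need no
restriction, as they enter only through unimodular phases. -/
lemma exists_field_bounds (e M : ℝ) {σ : Torus N → ℝ} (hσ : IsC2 σ) (R : ℝ) (hR : 0 ≤ R) :
    ∃ C : NNReal, (∀ t (Y : Tangent N), ‖Y.1‖ ≤ R → ‖Y.2.2‖ ≤ R → ‖field e M σ t Y‖ ≤ C) ∧
      ∀ t (Y Y' : Tangent N), ‖Y.1‖ ≤ R → ‖Y'.1‖ ≤ R →
        ‖field e M σ t Y - field e M σ t Y'‖ ≤ C * ‖Y - Y'‖ := by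
  obtain ⟨C, hC0, hC1, hC2⟩ := exists_force_bounds e hσ R
  -- The factor R + 1 serves both for the bound of p/M and, being at least 1, for its Lipschitz
  -- constant.
  have hM : 0 ≤ |M⁻¹| * (R + 1) := mul_nonneg (abs_nonneg _) (by linarith)
  have hn : 0 ≤ C + |M⁻¹| * (R + 1) := add_nonneg hC0 hM
  have hU : ∀ t (u : H1 N), ‖freeU t u‖ = ‖u‖ := fun t u => (freeU t).norm_map u
  refine ⟨NNReal.mk (C + |M⁻¹| * (R + 1)) hn, fun t Y h1 h2 => ?_, fun t Y Y' h1 h1' => ?_⟩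
  · obtain ⟨h3, h4⟩ := hC1 (freeU t Y.1, Y.2.1) (by simpa only [hU] using h1)
    rw [field, Prod.norm_mk, Prod.norm_mk, norm_neg, hU, norm_neg_I_smul, norm_smul,
      Real.norm_eq_abs, NNReal.coe_mk]
    have h5 : |M⁻¹| * ‖Y.2.2‖ ≤ |M⁻¹| * (R + 1) :=
      mul_le_mul_of_nonneg_left (by linarith) (abs_nonneg _)
    exact max_le (by linarith) (max_le (by linarith) (by linarith))
  · obtain ⟨h3, h4⟩ := hC2 (freeU t Y.1, Y.2.1) (freeU t Y'.1, Y'.2.1)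
      (by simpa only [hU] using h1) (by simpa only [hU] using h1')
    have h5 := norm_fst_snd_sub_le (freeU t Y.1) (freeU t Y'.1) Y Y'
      (by rw [← map_sub, hU])
    have h6 := mul_le_mul_of_nonneg_left h5 hC0
    have h7 : ‖freeU (-t) ((-Complex.I) • potF e σ (freeU t Y.1, Y.2.1)) -
        freeU (-t) ((-Complex.I) • potF e σ (freeU t Y'.1, Y'.2.1))‖ =
        ‖potF e σ (freeU t Y.1, Y.2.1) - potF e σ (freeU t Y'.1, Y'.2.1)‖ := by
      have h8 := smul_sub (-Complex.I) (potF e σ (freeU t Y.1, Y.2.1))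
        (potF e σ (freeU t Y'.1, Y'.2.1))
      rw [← map_sub, hU, ← h8, norm_neg_I_smul]
    have h9 : ‖M⁻¹ • Y.2.2 - M⁻¹ • Y'.2.2‖ ≤ |M⁻¹| * ‖Y - Y'‖ := by
      rw [← smul_sub, norm_smul, Real.norm_eq_abs]
      refine mul_le_mul_of_nonneg_left ?_ (abs_nonneg _)
      exact (norm_snd_le (Y - Y').2).trans (norm_snd_le (Y - Y'))
    have h10 : ‖-forceF e σ (freeU t Y.1, Y.2.1) - -forceF e σ (freeU t Y'.1, Y'.2.1)‖ =
        ‖forceF e σ (freeU t Y.1, Y.2.1) - forceF e σ (freeU t Y'.1, Y'.2.1)‖ := by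
      rw [← neg_sub', norm_neg]
    have hY := norm_nonneg (Y - Y')
    have h11 : |M⁻¹| * ‖Y - Y'‖ ≤ |M⁻¹| * (R + 1) * ‖Y - Y'‖ :=
      mul_le_mul_of_nonneg_right (le_mul_of_one_le_right (abs_nonneg _) (by linarith)) hY
    have h12 : 0 ≤ C * ‖Y - Y'‖ := mul_nonneg hC0 hY
    have h13 : 0 ≤ |M⁻¹| * (R + 1) * ‖Y - Y'‖ := mul_nonneg hM hY
    rw [field, field, Prod.mk_sub_mk, Prod.mk_sub_mk, Prod.norm_mk, Prod.norm_mk, h7, h10,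
      NNReal.coe_mk, add_mul]
    exact max_le (by linarith) (max_le (by linarith) (by linarith))

lemma IsCurve.eq {e M : ℝ} {σ : Torus N → ℝ} (hσ : IsC2 σ) {Y Z : ℝ → Tangent N}
    (hY : IsCurve e M σ Y) (hZ : IsCurve e M σ Z) (h0 : Y 0 = Z 0) : Y = Z := by
  refine eq_of_hasDerivAt (G := field e M σ) (fun R => ?_) hY hZ h0
  obtain ⟨C, -, hC⟩ := exists_field_bounds (N := N) e M hσ (max R 0) (le_max_right _ _)
  refine ⟨C, fun t => LipschitzOnWith.of_dist_le_mul fun x hx y hy => ?_⟩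
  rw [dist_eq_norm, dist_eq_norm]
  rw [mem_closedBall_zero_iff] at hx hy
  exact hC t x y (((norm_fst_le x).trans hx).trans (le_max_left _ _))
    (((norm_fst_le y).trans hy).trans (le_max_left _ _))

/-- The cutoff of the wave function and the momenta. -/
def cutoff (R : ℝ) (Y : Tangent N) : Tangent N := (radial R Y.1, Y.2.1, radial R Y.2.2)

lemma norm_cutoff_sub_le {R : ℝ} (hR : 0 < R) (Y Y' : Tangent N) :
    ‖cutoff R Y - cutoff R Y'‖ ≤ 2 * ‖Y - Y'‖ := by
  have h1 := norm_radial_sub_le hR Y.1 Y'.1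
  have h2 := norm_radial_sub_le hR Y.2.2 Y'.2.2
  have h3 : ‖Y.1 - Y'.1‖ ≤ ‖Y - Y'‖ := norm_fst_le (Y - Y')
  have h4 : ‖Y.2 - Y'.2‖ ≤ ‖Y - Y'‖ := norm_snd_le (Y - Y')
  have h5 : ‖Y.2.1 - Y'.2.1‖ ≤ ‖Y.2 - Y'.2‖ := norm_fst_le (Y.2 - Y'.2)
  have h6 : ‖Y.2.2 - Y'.2.2‖ ≤ ‖Y.2 - Y'.2‖ := norm_snd_le (Y.2 - Y'.2)
  have h7 := norm_nonneg (Y - Y')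
  rw [cutoff, cutoff, Prod.mk_sub_mk, Prod.mk_sub_mk, Prod.norm_mk, Prod.norm_mk]
  exact max_le (by linarith) (max_le (by linarith) (by linarith))

lemma cutoff_of_le {R : ℝ} (hR : 0 < R) {Y : Tangent N} (h1 : ‖Y.1‖ ≤ R) (h2 : ‖Y.2.2‖ ≤ R) :
    cutoff R Y = Y := by
  rw [cutoff, radial_of_le hR h1, radial_of_le hR h2]

/-- After the cutoff the field is bounded and globally Lipschitz, whatever the positions are. -/
lemma exists_cutoff_curve (e M : ℝ) {σ : Torus N → ℝ} (hσ : IsC2 σ) {R : ℝ} (hR : 0 < R)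
    (Y₀ : Tangent N) : ∃ Y : ℝ → Tangent N, Y 0 = Y₀ ∧
      ∀ t, HasDerivAt Y (field e M σ t (cutoff R (Y t))) t := by
  obtain ⟨C, hC1, hC2⟩ := exists_field_bounds (N := N) e M hσ R hR.le
  refine exists_forall_hasDerivAt (G := fun t Y => field e M σ t (cutoff R Y)) (K := C * 2) (C := C)
    (fun t => LipschitzWith.of_dist_le_mul fun x y => ?_)
    (fun t x => hC1 t _ (norm_radial_le hR _) (norm_radial_le hR _))
    (fun x => continuous_field e M hσ continuous_const) Y₀
  rw [dist_eq_norm, dist_eq_norm]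
  refine (hC2 t _ _ (norm_radial_le hR _) (norm_radial_le hR _)).trans ?_
  push_cast
  rw [mul_assoc]
  exact mul_le_mul_of_nonneg_left (norm_cutoff_sub_le hR x y) C.2

/-- All parts of the energy are nonnegative, so each is bounded by the total; the charge supplies
the L² part of the H¹ norm. -/
lemma energy_bounds (e : ℝ) {M : ℝ} (hM : 0 < M) {σ : Torus N → ℝ} (hσ : IsC2 σ) (Y : Tangent N) :
    ‖Y.1‖ ^ 2 ≤ 2 * (1 / 2 * ‖toL2 Y.1‖ ^ 2) + 2 * energy e M σ (toPhase Y) ∧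
      ‖Y.2.2‖ ^ 2 ≤ 2 * M * energy e M σ (toPhase Y) := by
  have h1 := energy_eq e M hσ (toPhase Y)
  have h2 := coulomb_nonneg e σ Y.1 (toIonPos Y.2.1)
  have h3 : 0 ≤ ∑ n : Lattice N, (∑ i, Y.2.2 n i ^ 2) / (2 * M) := by positivity
  have h4 : 0 ≤ ∑ c : Coord N, ‖wpartial c Y.1‖ ^ 2 := by positivity
  simp only [toPhase] at h1
  refine ⟨?_, ?_⟩
  · rw [H1_norm_sq, toPhase]; linarith
  · set A := 2 * M * energy e M σ (toPhase Y) with hA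
    have h5 : ∀ n i, Y.2.2 n i ^ 2 ≤ A := by
      intro n i
      have h6 : Y.2.2 n i ^ 2 ≤ ∑ i, Y.2.2 n i ^ 2 :=
        Finset.single_le_sum (f := fun i => Y.2.2 n i ^ 2) (fun _ _ => sq_nonneg _)
          (Finset.mem_univ i)
      have h7 : (∑ i, Y.2.2 n i ^ 2) / (2 * M) ≤ ∑ n : Lattice N, (∑ i, Y.2.2 n i ^ 2) / (2 * M) :=
        Finset.single_le_sum (f := fun n => (∑ i, Y.2.2 n i ^ 2) / (2 * M))
          (fun _ _ => by positivity) (Finset.mem_univ n)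
      have h8 : (∑ i, Y.2.2 n i ^ 2) / (2 * M) ≤ energy e M σ (toPhase Y) := by
        rw [toPhase, h1]; linarith
      rw [div_le_iff₀ (by positivity)] at h8
      rw [hA]; linarith
    have hA0 : 0 ≤ A := (sq_nonneg _).trans (h5 0 0)
    have h9 : ‖Y.2.2‖ ≤ √A := by
      refine (pi_norm_le_iff_of_nonneg (Real.sqrt_nonneg _)).2 fun n =>
        (pi_norm_le_iff_of_nonneg (Real.sqrt_nonneg _)).2 fun i => ?_
      rw [Real.norm_eq_abs]
      exact Real.abs_le_sqrt (h5 n i)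
    calc ‖Y.2.2‖ ^ 2 ≤ √A ^ 2 := pow_le_pow_left₀ (norm_nonneg _) h9 2
      _ = A := Real.sq_sqrt hA0

/-- Charge and energy of a state in the interaction picture. -/
def invariants (e M : ℝ) (σ : Torus N → ℝ) (t : ℝ) (Y : Tangent N) : ℝ × ℝ :=
  (1 / 2 * ‖toL2 (freeU t Y.1)‖ ^ 2, energy e M σ (toPhase (schr t Y)))

/-- P is the state at which the field is evaluated, either Y itself or its cutoff. Agreement of P
with Y is needed only at the time t, whereas the continuity of P at all times provides the H⁻¹
velocity of the wave function. -/
lemma hasDerivAt_invariants {e M : ℝ} {σ : Torus N → ℝ} (hσ : IsC2 σ) {Y P : ℝ → Tangent N}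
    (hPc : Continuous P) (hY : ∀ t, HasDerivAt Y (field e M σ t (P t)) t) {t : ℝ}
    (ht : P t = Y t) : HasDerivAt (fun s => invariants e M σ s (Y s)) 0 t := by
  have hYc : Continuous Y := continuous_iff_continuousAt.2 fun t => (hY t).continuousAt
  have hG := (continuous_potF e hσ).comp (continuous_schr_fst hPc)
  set G : ℝ → H1 N := potF e σ ∘ fun t => (freeU t (P t).1, (P t).2.1) with hGdef
  have h1 := (hY t).snd
  rw [ht] at h1
  have h2 : G t = potF e σ (freeU t (Y t).1, (Y t).2.1) := by
    rw [hGdef, Function.comp_apply, ht]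
  have h3 : ∀ t, HasDerivAt (fun s => (Y s).1) (freeU (-t) ((-Complex.I) • G t)) t :=
    fun t => (hY t).fst
  have h4 := hasDerivAt_charge_curve (φ := fun s => (Y s).1) (G := G) (κ := fun s => (Y s).2.1)
    hσ (h3 t) h2
  have h5 := hasDerivAt_energy_curve (φ := fun s => (Y s).1) (G := G) (κ := fun s => (Y s).2.1)
    (p := fun s => (Y s).2.2) hσ hG hYc.snd.fst h3 h2 h1.fst h1.snd
  exact h4.prodMk h5

/-- The radius R is fixed in advance by the charge and energy of the initial state. The cut-off
curve conserves both while wave function and momenta stay within R, so by `lt_of_bootstrap` they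
stay within R for all times, and the curve solves the original system. -/
lemma exists_isCurve_of_initial (e : ℝ) {M : ℝ} (hM : 0 < M) {σ : Torus N → ℝ} (hσ : IsC2 σ)
    (Y₀ : Tangent N) : ∃ Y : ℝ → Tangent N, Y 0 = Y₀ ∧ IsCurve e M σ Y := by
  set Q := 2 * (invariants e M σ 0 Y₀).1 + 2 * (invariants e M σ 0 Y₀).2 with hQ
  set P := 2 * M * (invariants e M σ 0 Y₀).2 with hP
  -- The added 1 makes the a priori bound strict, as the continuity argument requires.
  set R := max (√Q) (√P) + 1 with hR
  have hR0 : 0 < R := by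
    have := (Real.sqrt_nonneg Q).trans (le_max_left _ (√P))
    linarith
  have hU : ∀ t (u : H1 N), ‖freeU t u‖ = ‖u‖ := fun t u => (freeU t).norm_map u
  have hb : ∀ t (Y : Tangent N), invariants e M σ t Y = invariants e M σ 0 Y₀ →
      max ‖Y.1‖ ‖Y.2.2‖ < R := by
    intro t Y h
    obtain ⟨h1, h2⟩ := energy_bounds e hM hσ (schr t Y)
    have h3 : ‖Y.1‖ ^ 2 ≤ Q := by
      rw [hQ, ← h, ← hU t]
      exact h1
    have h4 : ‖Y.2.2‖ ^ 2 ≤ P := by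
      rw [hP, ← h]
      exact h2
    have h5 := (Real.le_sqrt (norm_nonneg _) ((sq_nonneg _).trans h3)).2 h3
    have h6 := (Real.le_sqrt (norm_nonneg _) ((sq_nonneg _).trans h4)).2 h4
    exact (max_le_max h5 h6).trans_lt (lt_add_one _)
  obtain ⟨Y, hY0, hY⟩ := exists_cutoff_curve e M hσ hR0 Y₀
  have hYc : Continuous Y := continuous_iff_continuousAt.2 fun t => (hY t).continuousAt
  have hcc : Continuous (cutoff R : Tangent N → Tangent N) :=
    (LipschitzWith.of_dist_le_mul (K := 2) fun x y => by
      rw [dist_eq_norm, dist_eq_norm]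
      exact norm_cutoff_sub_le hR0 x y).continuous
  have hcut : ∀ t, max ‖(Y t).1‖ ‖(Y t).2.2‖ ≤ R → cutoff R (Y t) = Y t := fun t h =>
    cutoff_of_le hR0 ((le_max_left _ _).trans h) ((le_max_right _ _).trans h)
  have hlt := lt_of_bootstrap (f := fun t => max ‖(Y t).1‖ ‖(Y t).2.2‖)
    (g := fun t => invariants e M σ t (Y t)) (R := R)
    (hYc.fst.norm.max hYc.snd.snd.norm) (hb 0 _ (by rw [hY0]))
    (fun t ht => hasDerivAt_invariants hσ (hcc.comp hYc) hY (hcut t ht))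
    (fun t ht => hb t _ (by rw [ht, hY0]))
  refine ⟨Y, hY0, fun t => ?_⟩
  have h1 := hY t
  rwa [hcut t (hlt t).le] at h1

lemma IsCurve.invariants_eq {e M : ℝ} {σ : Torus N → ℝ} (hσ : IsC2 σ) {Y : ℝ → Tangent N}
    (h : IsCurve e M σ Y) (t : ℝ) : invariants e M σ t (Y t) = invariants e M σ 0 (Y 0) := by
  have h1 : ∀ t, HasDerivAt (fun s => invariants e M σ s (Y s)) 0 t := fun t =>
    hasDerivAt_invariants hσ h.continuous h rfl
  exact is_const_of_deriv_eq_zero (fun t => (h1 t).differentiableAt) (fun t => (h1 t).deriv) t 0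

/-! ### Antisymmetry -/

/-- The action of a permutation of the electrons on the modes. -/
def modePerm (π : Equiv.Perm (Fin (N ^ 3))) : Modes N ≃ Modes N :=
  Equiv.arrowCongr π.symm (Equiv.refl _)

lemma modePerm_apply (π : Equiv.Perm (Fin (N ^ 3))) (k : Modes N) (j : Fin (N ^ 3)) :
    modePerm π k j = k (π j) := rfl

lemma ksq_modePerm (π : Equiv.Perm (Fin (N ^ 3))) (k : Modes N) : ksq (modePerm π k) = ksq k := by
  rw [ksq, ksq, Fintype.sum_prod_type, Fintype.sum_prod_type]
  exact Equiv.sum_comp π fun j => ∑ i, xi N (k j i) ^ 2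

lemma measurePreserving_perm (π : Equiv.Perm (Fin (N ^ 3))) :
    MeasurePreserving (fun (x : Conf N) j => x (π j)) volume volume := by
  have h := volume_measurePreserving_piCongrLeft (fun _ : Fin (N ^ 3) => Torus N) π.symm
  convert! h using 1
  ext x j
  simp [MeasurableEquiv.piCongrLeft, Equiv.piCongrLeft, Equiv.piCongrLeft']

lemma cmode_perm (π : Equiv.Perm (Fin (N ^ 3))) (k : Modes N) (x : Conf N) :
    cmode (modePerm π k) (fun j => x (π j)) = cmode k x := by
  rw [cmode_apply, cmode_apply]
  exact Equiv.prod_comp π fun j => mode (k j) (x j)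

lemma integral_comp_measurePreserving {α : Type*} [MeasurableSpace α] {μ : Measure α} {f : α → α}
    (hf : MeasurePreserving f μ μ) {g : α → ℂ} (hg : AEStronglyMeasurable g μ) :
    ∫ x, g (f x) ∂μ = ∫ x, g x ∂μ := by
  have h := integral_map hf.aemeasurable (f := g) (by rwa [hf.map_eq])
  rw [← h, hf.map_eq]

lemma fc_compMeasurePreserving (π : Equiv.Perm (Fin (N ^ 3))) (ψ : L2 N) (k : Modes N) :
    fc k (Lp.compMeasurePreserving _ (measurePreserving_perm π) ψ) = fc (modePerm π k) ψ := by
  rw [fc_eq_integral, fc_eq_integral]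
  congr 1
  have h1 := Lp.coeFn_compMeasurePreserving ψ (measurePreserving_perm π)
  have h2 : ∫ x : Conf N, ψ (fun j => x (π j)) * star (cmode (modePerm π k) fun j => x (π j)) =
      ∫ x, ψ x * star (cmode (modePerm π k) x) :=
    integral_comp_measurePreserving (measurePreserving_perm π)
      ((Lp.aestronglyMeasurable ψ).mul
        (cmode (modePerm π k)).continuous.star.aestronglyMeasurable)
  rw [← h2]
  refine integral_congr_ae ?_
  filter_upwards [h1] with x hx
  rw [hx, cmode_perm]
  rfl

/-- The sign of a permutation as a complex number. -/
def sgn (π : Equiv.Perm (Fin (N ^ 3))) : ℂ := ((Equiv.Perm.sign π : ℤ) : ℂ)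

lemma sgn_mul_self (π : Equiv.Perm (Fin (N ^ 3))) : sgn π * sgn π = 1 := by
  rw [sgn, ← Int.cast_mul, Int.units_coe_mul_self, Int.cast_one]

lemma norm_sgn (π : Equiv.Perm (Fin (N ^ 3))) : ‖sgn π‖ = 1 := by
  have h := congrArg norm (sgn_mul_self π)
  rw [norm_mul, norm_one] at h
  nlinarith [norm_nonneg (sgn π)]

/-- The almost everywhere identity is an equality in L², hence of Fourier coefficients; the sign
moves across because its square is one. -/
lemma isAntisymmetric_iff (ψ : L2 N) :
    IsAntisymmetric ψ ↔ ∀ π k, sgn π * fc (modePerm π k) ψ = fc k ψ := by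
  refine forall_congr' fun π => ?_
  have h1 := Lp.coeFn_compMeasurePreserving ψ (measurePreserving_perm π)
  have h2 := Lp.coeFn_smul (sgn π) ψ
  have h3 : (∀ᵐ x : Conf N, ψ (fun j => x (π j)) = ((Equiv.Perm.sign π : ℤ) : ℂ) * ψ x) ↔
      Lp.compMeasurePreserving _ (measurePreserving_perm π) ψ = sgn π • ψ := by
    rw [← Lp.ext_iff.symm.trans (Iff.rfl)]
    constructor
    · intro h
      filter_upwards [h, h1, h2] with x hx h1 h2
      rw [h1, h2, Function.comp_apply, hx, Pi.smul_apply, smul_eq_mul, sgn]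
    · intro h
      filter_upwards [h, h1, h2] with x hx h1 h2
      rw [h1, h2, Function.comp_apply, Pi.smul_apply, smul_eq_mul, sgn] at hx
      exact hx
  rw [h3]
  constructor
  · intro h k
    rw [← fc_compMeasurePreserving, h, map_smul, smul_eq_mul, ← mul_assoc, sgn_mul_self, one_mul]
  · intro h
    refine ext_fc fun k => ?_
    rw [fc_compMeasurePreserving, map_smul, smul_eq_mul, ← h k, ← mul_assoc, sgn_mul_self, one_mul]

/-- The antisymmetrized action of a permutation of the electrons on wave functions. -/
def permT (π : Equiv.Perm (Fin (N ^ 3))) : H1 N →ₗᵢ[ℂ] H1 N :=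
  coordIso (hb N) (fun _ => sgn π) (fun _ => norm_sgn π) (modePerm π)

lemma isModeIso_permT (π : Equiv.Perm (Fin (N ^ 3))) :
    IsModeIso (fun _ => sgn π) (modePerm π) (permT π) :=
  isModeIso_coordIso _ (ksq_modePerm π)

lemma fc_permT (π : Equiv.Perm (Fin (N ^ 3))) (u : H1 N) (k : Modes N) :
    fc k (toL2 (permT π u)) = sgn π * fc (modePerm π k) (toL2 u) := (isModeIso_permT π).2 u k

lemma isAntisymmetric_iff_permT (u : H1 N) :
    IsAntisymmetric (toL2 u) ↔ ∀ π, permT π u = u := by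
  rw [isAntisymmetric_iff]
  refine forall_congr' fun π => ⟨fun h => ext_H1_fc fun k => ?_, fun h k => ?_⟩
  · rw [fc_permT, h]
  · rw [← fc_permT, h]

lemma freeU_permT (π : Equiv.Perm (Fin (N ^ 3))) (t : ℝ) (u : H1 N) :
    freeU t (permT π u) = permT π (freeU t u) := by
  refine ext_H1_fc fun k => ?_
  rw [fc_freeU, fc_permT, fc_permT, fc_freeU, freePhase, freePhase, ksq_modePerm]
  ring

lemma modePerm_sub_single (π : Equiv.Perm (Fin (N ^ 3))) (k : Modes N) (j : Fin (N ^ 3))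
    (m : Fin 3 → ℤ) :
    modePerm π (k - Pi.single (π j) m) = modePerm π k - Pi.single j m := by
  ext l : 1
  simp only [modePerm_apply, Pi.sub_apply]
  congr 1
  rcases eq_or_ne l j with rfl | h
  · simp
  · rw [Pi.single_eq_of_ne h, Pi.single_eq_of_ne (π.injective.ne h)]

lemma modeH1_permT (π : Equiv.Perm (Fin (N ^ 3))) (j : Fin (N ^ 3)) (m : Fin 3 → ℤ) (u : H1 N) :
    modeH1 (π j) m (permT π u) = permT π (modeH1 j m u) := by
  refine ext_H1_fc fun k => ?_
  rw [fc_permT, toL2_modeH1, toL2_modeH1, fc_modeL2, fc_modeL2, fc_permT, modePerm_sub_single]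

lemma bil_permT (π : Equiv.Perm (Fin (N ^ 3))) (j : Fin (N ^ 3)) (m : Fin 3 → ℤ) (u v : H1 N) :
    bil (π j) m (permT π u) (permT π v) = bil j m u v := by
  rw [bil, bil, ← toL2_modeH1, modeH1_permT, (isModeIso_permT π).inner_toL2, toL2_modeH1]

/-- The density sums over all electrons, so relabelling them only reorders the sum; the sign drops
out of the sesquilinear terms. -/
lemma rhoL_permT (e : ℝ) (σ : Torus N → ℝ) (π : Equiv.Perm (Fin (N ^ 3))) (m : Fin 3 → ℤ)
    (u : H1 N) (κ : IonVec N) : rhoL e σ m (permT π u, κ) = rhoL e σ m (u, κ) := by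
  have h : ∑ j, bil j m (permT π u) (permT π u) = ∑ j, bil j m u u := by
    rw [← Equiv.sum_comp π]
    simp only [bil_permT]
  rw [rhoL, rhoL, rhoC, rhoC, elC, elC, h]

lemma potMul1_permT (π : Equiv.Perm (Fin (N ^ 3))) (j : Fin (N ^ 3)) (m : Fin 3 → ℤ) (c : ℂ)
    (u : H1 N) : potMul1 (π j) m c (permT π u) = permT π (potMul1 j m c u) := by
  have h : ∀ (j : Fin (N ^ 3)) (v : H1 N),
      potMul1 j m c v = c • modeH1 j m v + star c • modeH1 j (-m) v := fun _ _ => rfl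
  rw [h, h, modeH1_permT, modeH1_permT, map_add]
  have h1 := (permT π).map_smul c (modeH1 j m u)
  have h2 := (permT π).map_smul (star c) (modeH1 j (-m) u)
  rw [h1, h2]

/-- The same function acts in each variable and is summed over all of them, so the total potential
commutes with relabelling. -/
lemma potMul_permT (π : Equiv.Perm (Fin (N ^ 3))) (m : Fin 3 → ℤ) (c : ℂ)
    (u : H1 N) : potMul m c (permT π u) = permT π (potMul m c u) := by
  rw [potMul_apply, potMul_apply, map_sum, ← Equiv.sum_comp π]
  simp only [potMul1_permT]

lemma potTerm_permT (e : ℝ) (σ : Torus N → ℝ) (π : Equiv.Perm (Fin (N ^ 3))) (m : Fin 3 → ℤ)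
    (u : H1 N) (κ : IonVec N) :
    potTerm e σ m (permT π u, κ) = permT π (potTerm e σ m (u, κ)) := by
  have h1 := (permT π).map_smul ((-(e / 2 * wgt N m) : ℝ) : ℂ) (potMul m (rhoL e σ m (u, κ)) u)
  rw [potTerm, potTerm, rhoL_permT]
  refine Eq.trans ?_ h1.symm
  rw [potMul_permT]

lemma potF_permT (e : ℝ) {σ : Torus N → ℝ} (hσ : IsC2 σ) (π : Equiv.Perm (Fin (N ^ 3)))
    (u : H1 N) (κ : IonVec N) : potF e σ (permT π u, κ) = permT π (potF e σ (u, κ)) := by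
  have h1 := (permT π).toContinuousLinearMap.hasSum (summable_potTerm e hσ (u, κ)).hasSum
  rw [potF, potF]
  simp only [potTerm_permT]
  exact h1.tsum_eq

lemma forceF_permT (e : ℝ) (σ : Torus N → ℝ) (π : Equiv.Perm (Fin (N ^ 3)))
    (u : H1 N) (κ : IonVec N) : forceF e σ (permT π u, κ) = forceF e σ (u, κ) := by
  ext n i
  simp only [forceF, forceTerm, rhoL_permT]

lemma field_permT (e M : ℝ) {σ : Torus N → ℝ} (hσ : IsC2 σ) (π : Equiv.Perm (Fin (N ^ 3)))
    (t : ℝ) (Y : Tangent N) : field e M σ t (permT π Y.1, Y.2) =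
      (permT π (field e M σ t Y).1, (field e M σ t Y).2) := by
  have h1 := (permT π).map_smul (-Complex.I) (potF e σ (freeU t Y.1, Y.2.1))
  simp only [field, freeU_permT, potF_permT e hσ, forceF_permT]
  rw [← freeU_permT, h1]

/-- The antisymmetrized action of a permutation as a real linear map. -/
def permR (π : Equiv.Perm (Fin (N ^ 3))) : H1 N →L[ℝ] H1 N :=
  (permT π).toContinuousLinearMap.restrictScalars ℝ

lemma hasDerivAt_map_fst {E K : Type*} [NormedAddCommGroup E] [NormedSpace ℝ E]
    [NormedAddCommGroup K] [NormedSpace ℝ K] (A : E →L[ℝ] E) {Y : ℝ → E × K} {d : E × K} {t : ℝ}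
    (h : HasDerivAt Y d t) : HasDerivAt (fun s => (A (Y s).1, (Y s).2)) (A d.1, d.2) t :=
  (A.hasFDerivAt.comp_hasDerivAt t h.fst).prodMk h.snd

lemma IsCurve.comp_permT {e M : ℝ} {σ : Torus N → ℝ} (hσ : IsC2 σ) {Y : ℝ → Tangent N}
    (h : IsCurve e M σ Y) (π : Equiv.Perm (Fin (N ^ 3))) :
    IsCurve e M σ fun t => (permR π (Y t).1, (Y t).2) := by
  intro t
  have h2 := hasDerivAt_map_fst (permR π) (h t)
  have h3 := field_permT e M hσ π t (Y t)
  refine h2.congr_deriv ?_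
  exact h3.symm

/-- The image of the curve under a signed permutation is an integral curve with the same initial
value, so it is the same curve; the free group commutes with the permutation. -/
lemma IsCurve.isAntisymmetric {e M : ℝ} {σ : Torus N → ℝ} (hσ : IsC2 σ) {Y : ℝ → Tangent N}
    (h : IsCurve e M σ Y) (h0 : IsAntisymmetric (toL2 (Y 0).1)) (t : ℝ) :
    IsAntisymmetric (toL2 (freeU t (Y t).1)) := by
  have h3 := (isAntisymmetric_iff_permT (Y 0).1).1 h0
  refine (isAntisymmetric_iff_permT (freeU t (Y t).1)).2 fun π => ?_
  have h1 := (h.comp_permT hσ π).eq hσ h (Prod.ext (h3 π) rfl)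
  have h2 : permT π (Y t).1 = (Y t).1 := congrArg Prod.fst (congrFun h1 t)
  rw [← freeU_permT, h2]

end SPN

end

/-! ### Assembly of the theorem -/

theorem theoremA1 (N : ℕ) [NeZero N] (e Z M : ℝ) (he : 0 < e) (hZ : 0 < Z) (hM : 0 < M)
    (σ : SPN.Torus N → ℝ) (hσ : SPN.IsC2 σ) (hσZ : ∫ x, σ x = e * Z)
    (X₀ : SPN.Phase N) (hX₀ : SPN.charge X₀ = Z) :
    (∃! X : C(ℝ, SPN.Phase N), X 0 = X₀ ∧ SPN.IsSolution e M σ X) ∧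
    ∀ X : C(ℝ, SPN.Phase N), X 0 = X₀ → SPN.IsSolution e M σ X →
      (∀ t : ℝ, SPN.energy e M σ (X t) = SPN.energy e M σ X₀) ∧
      (∀ t : ℝ, SPN.charge (X t) = SPN.charge X₀) ∧
      (SPN.IsAntisymmetric (SPN.toL2 X₀.1) →
        ∀ t : ℝ, SPN.IsAntisymmetric (SPN.toL2 (X t).1)) := by
  obtain ⟨κ, hκ⟩ := SPN.exists_toPhase X₀
  obtain ⟨Y, hY0, hY⟩ := SPN.exists_isCurve_of_initial e hM hσ (X₀.1, κ, X₀.2.2)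
  -- Lifting an arbitrary solution from the same κ gives an integral curve with the initial value of
  -- Y. So every solution is the image of Y, and the remaining claims need only be proved for it.
  have hXY : ∀ X : C(ℝ, SPN.Phase N), X 0 = X₀ → SPN.IsSolution e M σ X →
      ∀ t, X t = SPN.toPhase (SPN.schr t (Y t)) := by
    intro X h0 h
    obtain ⟨W, hW0, hW, hXW⟩ := SPN.exists_isCurve hσ X.continuous h (κ₀ := κ) (by rw [h0]; exact hκ)
    have hWY : W = Y := hW.eq hσ hY (by rw [hW0, hY0, h0])
    rw [← hWY]
    exact hXW
  have h00 : SPN.toPhase (SPN.schr 0 (Y 0)) = X₀ := by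
    rw [hY0, SPN.schr, SPN.freeU_zero]
    exact hκ.symm
  refine ⟨⟨⟨fun t => SPN.toPhase (SPN.schr t (Y t)), hY.continuous_toPhase⟩,
    ⟨h00, hY.isSolution hσ⟩, ?_⟩, fun X h0 h => ⟨fun t => ?_, fun t => ?_, fun ha t => ?_⟩⟩
  · rintro X ⟨h0, h⟩
    exact ContinuousMap.ext (hXY X h0 h)
  · rw [hXY X h0 h, ← h00]
    exact congrArg Prod.snd (hY.invariants_eq hσ t)
  -- `invariants` carries half the charge.
  · have h1 := congrArg Prod.fst (hY.invariants_eq hσ t)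
    have h2 : SPN.charge (SPN.toPhase (SPN.schr t (Y t))) =
        SPN.charge (SPN.toPhase (SPN.schr 0 (Y 0))) :=
      mul_left_cancel₀ (by norm_num : (1 / 2 : ℝ) ≠ 0) h1
    rw [hXY X h0 h, h2, h00]
  · rw [hXY X h0 h]
    exact hY.isAntisymmetric hσ (by rw [hY0]; exact ha) t
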